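/- **Setting.** Let $p\in\mathbb N$, let $(\Omega,\mathcal A,\mathbb P)$ be a probability space, let $\mathcal I=\bigcup_{n\ge 0}\mathbb N^n$ be the Ulam–Harris tree with root $\varnothing$, and let $\boldsymbol\xi_u=(\xi_u^{i,j})_{i,j=1,\dots,p}$, $u\in\mathcal I$, be i.i.d. $p\times p$ matrices of locally finite point processes on $[0,\infty)$ (the total masses may be infinite, and the entries of one matrix may depend on each other in any way). Put $\boldsymbol\xi=\boldsymbol\xi_\varnothing$. Let $\tau(\varnothing)$ be a random variable with values in $\{1,\dots,p\}$, the type of the ancestor, independent of $(\boldsymbol\xi_u)_{u\in\mathcal I}$. Set $S(\varnothing)=0$. An individual $u$ of type $\tau(u)$ has its $k$-th child $uk$ at time $S(uk)=S(u)+X_{u,k}$, where $X_{u,k}=\inf\{t\ge0:\sum_j\xi_u^{\tau(u),j}([0,t])\ge k\}\in[0,\infty]$. If $X_{u,k}<\infty$, the type of $uk$ is $j$ when the corresponding point belongs to $\xi_u^{\tau(u),j}$, where children born at the same time are listed by increasing type. If $S(u)=\infty$, then $u$ is never born. Let $\mu^{i,j}=\mathbb E[\xi^{i,j}]$ be the intensity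 measures, let $\mathcal L\boldsymbol\mu(z)=\big(\int e^{-zx}\mu^{i,j}(dx)\big)_{i,j}$, and let $\mathrm{Dom}(\mathcal L\boldsymbol\mu)=\{z\in\mathbb C:\int e^{-\mathrm{Re}(z)x}\mu^{i,j}(dx)<\infty\text{ for all }i,j\}$. Write $I_m$ for the $m\times m$ identity matrix and assume: * (A1) the matrix $(\mu^{i,j}(\{0\}))_{i,j}$ has spectral radius $<1$; * (A2) there is an $\alpha>0$ in $\mathrm{Dom}(\mathcal L\boldsymbol\mu)$ such that $\mathcal L\boldsymbol\mu(\alpha)$ has spectral radius $1$, and $\alpha$ denotes the largest such number. Let $\lambda$ be in the interior of $\mathrm{Dom}(\mathcal L\boldsymbol\mu)$ with $\det(I_p-\mathcal L\boldsymbol\mu(\lambda))=0$. Let $k=k_\lambda$ be the maximal order of the pole at $\lambda$ of the entries of $(I_p-\mathcal L\boldsymbol\mu(z))^{-1}$, and let $A_{\lambda,n}$ ($1\le n\le k$) be the matrix of the coefficients of $(z-\lambda)^{-n}$ in the Laurent expansions of these entries around $\lambda$. Let $\vec A_\lambda$ be the $kp\times p$ matrix with blocks $A_{\lambda,1},\dots,A_{\lambda,k}$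 on top of each other, and let $\exp(\lambda,x)$ be the upper triangular $k\times k$ matrix with entries $e^{\lambda x}x^{b-a}/(b-a)!$ for $1\le a\le b\le k$. With $e_1,\dots,e_p$ the standard basis of row vectors and $\otimes$ the Kronecker product, put $$\phi_{\lambda,u}(t)=\mathbf 1_{[0,\infty)}(t)\Big(\int\mathbf 1_{(t,\infty)}(s)\exp(\lambda,t-s)\otimes\boldsymbol\xi_u(ds)\Big)\vec A_\lambda ,$$ $$W_t(\lambda)=\exp(\lambda,-t)\sum_{u\in\mathcal I,\;S(u)<\infty}(I_k\otimes e_{\tau(u)})\,\phi_{\lambda,u}(t-S(u)),\qquad t\ge0.$$ For $u\in\mathcal I$ let $\mathcal A_u$ be the $\sigma$-algebra generated by $\tau(\varnothing)$ and all $\boldsymbol\xi_v$ with $v$ equal to $u$ or an ancestor of $u$, and for $t\ge0$ let $\mathcal F_t=\sigma(A\cap\{S(u)\le t\}:u\in\mathcal I,\ A\in\mathcal A_u)$. **Theorem 2.3.** In this setting, suppose that for some $1<q\le2$, with $\|\cdot\|$ the operator norm of matrices, $$\text{(A3)}\qquad\mathbb E\Big[\Big\|\int\big(1+s^{k_\lambda-1}\big)e^{-\mathrm{Re}(\lambda)s}\,\boldsymbol\xi(ds)\Big\|^q\Big]<\infty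 .$$ If $\mathrm{Re}(\lambda)>\alpha/q$, then $(\mathcal F_t)_{t\ge0}$ is a filtration, for every $t\ge 0$ almost surely only finitely many individuals are born up to time $t$ (so that the sum defining $W_t(\lambda)$ is almost surely a finite sum), and $(W_t(\lambda))_{t\ge0}$ is an $L^q$-bounded martingale with respect to $(\mathcal F_t)_{t\ge0}$, that is, a martingale with $\sup_{t\ge0}\mathbb E[\|W_t(\lambda)\|^q]<\infty$. -/

import Mathlib

open MeasureTheory ProbabilityTheory Filter Topology Set
open scoped NNReal ENNReal Matrix.Norms.L2Operator

noncomputable section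

namespace CMJ

/-- Ulam–Harris labels. The individual `u₁ u₂ … uₙ` is stored youngest digit first, as the list
`[uₙ, …, u₂, u₁]`: the ancestor is `[]`, the `k`-th child of `u` is `k :: u`, and `v` is an ancestor
of `u` (or `u` itself) exactly when `v` is a suffix of `u`. -/
abbrev Label : Type := List ℕ+

/-- Locally finite point measures on `[0, ∞)`: the mass of every Borel set lies in
`{0, 1, 2, …, ∞}` and bounded intervals have finite mass. The total mass may be infinite. -/
def IsPointMeasure (m : Measure ℝ≥0) : Prop :=
  (∀ s, MeasurableSet s → ∃ n : ℕ∞, m s = (n : ℝ≥0∞)) ∧ ∀ t : ℝ≥0, m (Iic t) < ∞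

/-! ### Offspring of one individual -/

section Offspring

variable {p : ℕ}

/-- For the row `m = (m¹, …, mᵖ)` of offspring processes of an individual: the birth time
`inf {t ≥ 0 : ∑ⱼ mʲ [0, t] ≥ k}` of its `k`-th child, relative to its own birth;
it is `∞` if there are fewer than `k` children. -/
def childTime (m : Fin p → Measure ℝ≥0) (k : ℕ+) : ℝ≥0∞ :=
  ⨅ (t : ℝ≥0) (_ : ((k : ℕ) : ℝ≥0∞) ≤ ∑ j, m j (Iic t)), (t : ℝ≥0∞)

open Classical in
/-- The type of the `k`-th child. Children are listed by increasing birth time and children born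
at the same time by increasing type. So, if `x` is the birth time of the `k`-th child, its type is
the least `j` such that at least `k` children either are born before `x`, or are born at `x` and
have type at most `j`. (The default `i` is used only for a child that is never born.) -/
def childType (m : Fin p → Measure ℝ≥0) (i : Fin p) (k : ℕ+) : Fin p :=
  let x : ℝ≥0 := (childTime m k).toNNReal
  let J : Finset (Fin p) := Finset.univ.filter fun j =>
    ((k : ℕ) : ℝ≥0∞) ≤ ∑ j', m j' (Iio x) + ∑ j' ∈ Finset.univ.filter (· ≤ j), m j' {x}
  if h : childTime m k < ∞ ∧ J.Nonempty then J.min' h.2 else i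

end Offspring

/-! ### The branching process -/

section Branching

variable {Ω : Type*} {p : ℕ}

/-- The data of a multi-type general branching process: the type `τ₀` of the ancestor and,
for each label `u`, the `p × p` matrix `ξ u` of offspring processes. The matrices `ξ u` are i.i.d.
(with arbitrary dependence inside one matrix), and `τ₀` is independent of all of them. -/
structure IsReproduction [MeasurableSpace Ω] (P : Measure Ω) (τ₀ : Ω → Fin p)
    (ξ : Label → Ω → Fin p → Fin p → Measure ℝ≥0) : Prop where
  measurable_type : Measurable τ₀
  measurable_offspring : ∀ u, Measurable (ξ u)
  isPointMeasure : ∀ u ω i j, IsPointMeasure (ξ u ω i j)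
  indep : iIndepFun ξ P
  identDistrib : ∀ u, IdentDistrib (ξ u) (ξ []) P P
  indep_type : IndepFun τ₀ (fun ω u => ξ u ω) P

/-- The type `τ(u)` of the individual `u`. -/
def typeOf (τ₀ : Ω → Fin p) (ξ : Label → Ω → Fin p → Fin p → Measure ℝ≥0) :
    Label → Ω → Fin p
  | [], ω => τ₀ ω
  | k :: u, ω => childType (ξ u ω (typeOf τ₀ ξ u ω)) (typeOf τ₀ ξ u ω) k

/-- The birth time `S(u)` of the individual `u`; it is `∞` if `u` is never born. -/
def birthTime (τ₀ : Ω → Fin p) (ξ : Label → Ω → Fin p → Fin p → Measure ℝ≥0) :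
    Label → Ω → ℝ≥0∞
  | [], _ => 0
  | k :: u, ω => birthTime τ₀ ξ u ω + childTime (ξ u ω (typeOf τ₀ ξ u ω)) k

/-- `𝒜_u`, generated by the type of the ancestor and by `ξ_v` for all `v ⪯ u`. -/
@[reducible] def lineageSigma (τ₀ : Ω → Fin p) (ξ : Label → Ω → Fin p → Fin p → Measure ℝ≥0)
    (u : Label) : MeasurableSpace Ω :=
  MeasurableSpace.comap τ₀ inferInstance ⊔
    ⨆ (v : Label) (_ : v <:+ u), MeasurableSpace.comap (ξ v) inferInstance

/-- `ℱ_t = σ(A ∩ {S(u) ≤ t} : u a label, A ∈ 𝒜_u)`. -/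
@[reducible] def timeSigma (τ₀ : Ω → Fin p) (ξ : Label → Ω → Fin p → Fin p → Measure ℝ≥0)
    (t : ℝ≥0) : MeasurableSpace Ω :=
  MeasurableSpace.generateFrom
    {B | ∃ (u : Label) (A : Set Ω), MeasurableSet[lineageSigma τ₀ ξ u] A ∧
      B = A ∩ {ω | birthTime τ₀ ξ u ω ≤ t}}

/-- The intensity measures `μ^{i,j} = E[ξ^{i,j}]`. -/
def intensity [MeasurableSpace Ω] (P : Measure Ω)
    (ξ : Label → Ω → Fin p → Fin p → Measure ℝ≥0) (i j : Fin p) : Measure ℝ≥0 :=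
  P.bind fun ω => ξ [] ω i j

end Branching

/-! ### Laplace transform, Malthusian parameter, Laurent coefficients -/

section Laplace

variable {p : ℕ} (μ : Fin p → Fin p → Measure ℝ≥0)

/-- The domain of the matrix of Laplace transforms. -/
def laplaceDom : Set ℂ :=
  {z | ∀ i j, ∫⁻ s, ENNReal.ofReal (Real.exp (-z.re * (s : ℝ))) ∂(μ i j) < ∞}

/-- The matrix of Laplace transforms `∫ e^{-z s} μ^{i,j}(ds)`. -/
def laplace (z : ℂ) : Matrix (Fin p) (Fin p) ℂ :=
  Matrix.of fun i j => ∫ s, Complex.exp (-z * ((s : ℝ) : ℂ)) ∂(μ i j)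

/-- The matrix `(μ^{i,j}({0}))` of mean numbers of children born at the birth of the parent. -/
def instantMean : Matrix (Fin p) (Fin p) ℂ :=
  Matrix.of fun i j => (((μ i j).real {0} : ℝ) : ℂ)

/-- `α` is the largest positive real in the domain of the Laplace transform at which the
spectral radius of the Laplace transform is `1`. -/
def IsMalthusian (α : ℝ) : Prop :=
  IsGreatest {a : ℝ | 0 < a ∧ (a : ℂ) ∈ laplaceDom μ ∧ spectralRadius ℂ (laplace μ a) = 1} α

/-- The entry `(i, j)` of the resolvent `(I - ℒμ(z))⁻¹`. -/
def resolventEntry (i j : Fin p) (z : ℂ) : ℂ := (1 - laplace μ z)⁻¹ i j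

/-- The maximal order of the pole at `lam` of the entries of the resolvent. -/
def poleOrder (lam : ℂ) : ℕ :=
  Finset.univ.sup fun ij : Fin p × Fin p =>
    (-(meromorphicOrderAt (resolventEntry μ ij.1 ij.2) lam).untop₀).toNat

/-- For `f` with an isolated singularity at `z₀` and `n ≥ 1`: the coefficient of `(z - z₀)⁻ⁿ` in
the Laurent expansion of `f` around `z₀`, which is
`(2πi)⁻¹ ∮ (z - z₀)ⁿ⁻¹ f(z) dz` over any sufficiently small circle around `z₀`. -/
def laurentCoeff (f : ℂ → ℂ) (z₀ : ℂ) (n : ℕ) : ℂ :=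
  limUnder (𝓝[>] (0 : ℝ)) fun r : ℝ =>
    (2 * Real.pi * Complex.I)⁻¹ * ∮ z in C(z₀, r), (z - z₀) ^ (n - 1) * f z

/-- The `kp × p` matrix obtained by stacking the coefficient matrices `A_{lam,1}, …, A_{lam,k}` of
the principal part of the resolvent at `lam`, where `k = poleOrder μ lam`. Its block with index
`l : Fin k` is `A_{lam,l+1}`. -/
def coeffStack (lam : ℂ) : Matrix (Fin (poleOrder μ lam) × Fin p) (Fin p) ℂ :=
  Matrix.of fun li j => laurentCoeff (resolventEntry μ li.2 j) lam (li.1 + 1)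

end Laplace

/-! ### The martingale -/

/-- The upper triangular `k × k` matrix `exp(lam, x)` with entries `e^{lam x} x^{b-a} / (b-a)!`,
`a ≤ b`. -/
def expMatrix (k : ℕ) (lam : ℂ) (x : ℝ) : Matrix (Fin k) (Fin k) ℂ :=
  Matrix.of fun a b =>
    if a ≤ b then
      Complex.exp (lam * x) * (x : ℂ) ^ ((b : ℕ) - (a : ℕ)) / (((b : ℕ) - (a : ℕ)).factorial : ℂ)
    else 0

/-- The `k × kp` matrix `I_k ⊗ e_i`. -/
def rowSelect (k : ℕ) {p : ℕ} (i : Fin p) : Matrix (Fin k) (Fin k × Fin p) ℂ :=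
  Matrix.of fun a bj => if a = bj.1 ∧ bj.2 = i then 1 else 0

/-- The `kp × kp` matrix `∫ 1_{(t,∞)}(s) exp(lam, t - s) ⊗ m(ds)` (Kronecker product),
for a matrix `m` of measures. -/
def tailIntegral (k : ℕ) {p : ℕ} (lam : ℂ) (m : Fin p → Fin p → Measure ℝ≥0) (t : ℝ) :
    Matrix (Fin k × Fin p) (Fin k × Fin p) ℂ :=
  Matrix.of fun ai bj =>
    ∫ s in {s : ℝ≥0 | t < (s : ℝ)}, expMatrix k lam (t - (s : ℝ)) ai.1 bj.1 ∂(m ai.2 bj.2)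

section Martingale

variable {Ω : Type*} {p : ℕ} [MeasurableSpace Ω] (P : Measure Ω)

/-- The random characteristic `φ_{lam,u}(t)`, a random `kp × p` matrix vanishing for `t < 0`. -/
def characteristic (ξ : Label → Ω → Fin p → Fin p → Measure ℝ≥0) (lam : ℂ)
    (u : Label) (t : ℝ) (ω : Ω) :
    Matrix (Fin (poleOrder (intensity P ξ) lam) × Fin p) (Fin p) ℂ :=
  if 0 ≤ t then
    tailIntegral (poleOrder (intensity P ξ) lam) lam (ξ u ω) t * coeffStack (intensity P ξ) lam
  else 0

/-- The branching process counted with the characteristic `φ_lam`: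
`∑_u (I_k ⊗ e_{τ(u)}) φ_{lam,u}(t - S(u))`, where individuals that are never born contribute `0`. -/
def countedProcess (τ₀ : Ω → Fin p) (ξ : Label → Ω → Fin p → Fin p → Measure ℝ≥0) (lam : ℂ)
    (t : ℝ) (ω : Ω) : Matrix (Fin (poleOrder (intensity P ξ) lam)) (Fin p) ℂ :=
  ∑' u : Label,
    (if birthTime τ₀ ξ u ω < ∞ then
      rowSelect (poleOrder (intensity P ξ) lam) (typeOf τ₀ ξ u ω) *
        characteristic P ξ lam u (t - (birthTime τ₀ ξ u ω).toReal) ω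
    else 0 : Matrix (Fin (poleOrder (intensity P ξ) lam)) (Fin p) ℂ)

/-- `W_t(lam) = exp(lam, -t) ∑_u (I_k ⊗ e_{τ(u)}) φ_{lam,u}(t - S(u))`, a random `k × p` matrix,
where `k` is the maximal pole order. -/
def nerman (τ₀ : Ω → Fin p) (ξ : Label → Ω → Fin p → Fin p → Measure ℝ≥0) (lam : ℂ)
    (t : ℝ≥0) (ω : Ω) : Matrix (Fin (poleOrder (intensity P ξ) lam)) (Fin p) ℂ :=
  expMatrix (poleOrder (intensity P ξ) lam) lam (-(t : ℝ)) * countedProcess P τ₀ ξ lam t ω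

end Martingale

/-- The real `p × p` matrix `∫ (1 + s^{k-1}) e^{-θ s} m(ds)`, for a matrix `m` of measures. -/
def weightedMass (k : ℕ) {p : ℕ} (θ : ℝ) (m : Fin p → Fin p → Measure ℝ≥0) :
    Matrix (Fin p) (Fin p) ℝ :=
  Matrix.of fun i j => ∫ s, (1 + (s : ℝ) ^ (k - 1)) * Real.exp (-θ * (s : ℝ)) ∂(m i j)

end CMJ

end

/-!
Let `k` be the maximal pole order at `lam` and `A` the stacked matrix of the Laurent coefficients.
Give an individual of type `i` born at time `x` the value `exp(lam, -x) (I ⊗ e_i) A`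
(`CMJ.reproductiveValue`). Comparing principal parts in `R = 1 + ℒμ R`, where `R = (1 - ℒμ)⁻¹`,
yields `∫ (exp(lam, -s) ⊗ μ(ds)) A = A` (`CMJ.sum_integral_expMatrix_mul_coeffStack`). So the value
of an individual is the mean of the total value of its children, and the difference between the
total value of its children and its own value, its increment, is centred
(`CMJ.IsReproduction.integral_innovation`).

By `exp(lam, x + y) = exp(lam, x) exp(lam, y)`, the contribution of an individual born up to time
`t` to `W_t(lam)` is the value of its children born after time `t`, and `W_t(lam)` is the total
value of all individuals born after `t` to a parent born up to `t`. Summation by parts on the tree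
turns this into the value of the ancestor plus the sum of the increments of all individuals born up
to time `t` (`CMJ.expMatrix_mul_tsum_countedTerm`). These sums are almost surely finite: for every
`β > α` the matrix `ℒμ(β)` is nonnegative with spectral radius less than `1`, so that the mean of
`∑_u e^{-β S(u)}` is given by a convergent Neumann series
(`CMJ.IsReproduction.tsum_discount_lt_top`), which leaves only finitely many individuals in `[0, t]`
(`CMJ.IsReproduction.ae_finite_birthTime_le`).

The increment of `u` depends on the past only through the birth time and the type of `u`; apart from
these it is a function of `ξ_u`, which is independent of the type of the ancestor and of all other
offspring. For the martingale property, an event known at time `s` does not involve `ξ_u` as long as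
`S(u) > s` (`CMJ.IsReproduction.measurableSet_inter_lt_birthTime`), hence the increments in
`W_t(lam) - W_s(lam)` vanish in mean on such an event
(`CMJ.IsReproduction.setIntegral_increment_eq_zero`).

For the bound in `L^q`, adding the increments in an order of increasing generations gives centred
summands that are independent of what came before, given birth times and types. The inequality
`‖a + b‖^q ≤ ‖a‖^q + Re (g(a) b) + 6 ‖b‖^q` for `1 < q ≤ 2`, in which the linear term vanishes in
mean, then yields a von Bahr–Esseen inequality for the sum
(`CMJ.IsReproduction.integral_norm_sum_increment_rpow_le`). The `q`-th moment of the increment of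
`u` is at most a constant times the mean of `e^{-q δ S(u)}` whenever `δ < Re lam`, and since
`Re lam > α / q`, such a `δ` with `q δ > α` exists; the bound is then summable over all `u`,
uniformly in `t`.
-/

noncomputable section

namespace CMJ

/-! ### Point measures and the list of children -/

/-- On bounded sets a point measure has natural mass. -/
theorem IsPointMeasure.exists_nat {m : Measure ℝ≥0} (hm : IsPointMeasure m) {s : Set ℝ≥0}
    (hs : MeasurableSet s) {t : ℝ≥0} (hst : s ⊆ Iic t) : ∃ n : ℕ, m s = n := by
  obtain ⟨n, hn⟩ := hm.1 s hs
  have hlt : m s < ∞ := (measure_mono hst).trans_lt (hm.2 t)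
  induction n using ENat.recTopCoe with
  | top => simp [hn] at hlt
  | coe n => exact ⟨n, by simpa using hn⟩

theorem IsPointMeasure.sum {ι : Type*} [Fintype ι] {m : ι → Measure ℝ≥0}
    (hm : ∀ j, IsPointMeasure (m j)) : IsPointMeasure (∑ j, m j) := by
  refine ⟨fun s hs => ?_, fun t => ?_⟩
  · choose n hn using fun j => (hm j).1 s hs
    refine ⟨∑ j, n j, ?_⟩
    simp only [Measure.coe_finsetSum, Finset.sum_apply, hn]
    exact (map_sum (ENat.toENNRealRingHom) n Finset.univ).symm
  · simp only [Measure.coe_finsetSum, Finset.sum_apply]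
    exact ENNReal.sum_lt_top.2 fun j _ => (hm j).2 t

section Children

variable {p : ℕ} {m : Fin p → Measure ℝ≥0}

/-- The infimum defining the birth time of a child is attained, since `t ↦ N [0, t]` is
right-continuous, where `N` is the total offspring process. -/
theorem childTime_le_iff (hm : ∀ j, IsPointMeasure (m j)) (k : ℕ+) (t : ℝ≥0) :
    childTime m k ≤ t ↔ ((k : ℕ) : ℝ≥0∞) ≤ (∑ j, m j) (Iic t) := by
  have hM := IsPointMeasure.sum hm
  have hc : ∀ s, ∑ j, m j (Iic s) = (∑ j, m j) (Iic s) := by intro s; simp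
  simp only [childTime, hc]
  set M := ∑ j, m j
  refine ⟨fun h => ?_, fun h => iInf₂_le t h⟩
  by_contra! hlt
  have hlim : Tendsto (fun n : ℕ => M (Iic (t + 1 / ((n : ℝ≥0) + 1)))) atTop (𝓝 (M (Iic t))) := by
    have hI : (⋂ n : ℕ, Iic (t + 1 / ((n : ℝ≥0) + 1))) = Iic t := by
      ext s
      simp only [mem_iInter, mem_Iic]
      refine ⟨fun hs => ?_, fun hs n => hs.trans (by simp)⟩
      have : Tendsto (fun n : ℕ => t + 1 / ((n : ℝ≥0) + 1)) atTop (𝓝 (t + 0)) :=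
        tendsto_const_nhds.add tendsto_one_div_add_atTop_nhds_zero_nat
      rw [add_zero] at this
      exact ge_of_tendsto' this hs
    rw [← hI]
    refine tendsto_measure_iInter_atTop (fun n => measurableSet_Iic.nullMeasurableSet) ?_
      ⟨0, (hM.2 _).ne⟩
    intro a b hab
    refine Iic_subset_Iic.2 ?_
    gcongr
  obtain ⟨n, hn⟩ := (hlim.eventually_lt_const hlt).exists
  have h2 : ((t + 1 / ((n : ℝ≥0) + 1) : ℝ≥0) : ℝ≥0∞) ≤ t := by
    refine le_trans ?_ h
    refine le_iInf₂ fun s hs => ?_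
    by_contra! hs2
    have hs3 : s ≤ t + 1 / ((n : ℝ≥0) + 1) := by exact_mod_cast hs2.le
    exact absurd (hs.trans (measure_mono (Iic_subset_Iic.2 hs3))) (not_le.2 hn)
  have h3 : t + 1 / ((n : ℝ≥0) + 1) ≤ t := by exact_mod_cast h2
  have h4 : 0 < 1 / ((n : ℝ≥0) + 1) := by positivity
  exact absurd h3 (not_le.2 (lt_add_of_pos_right t h4))

/-- Here the masses `N [0, s]`, `s < x`, increase to `N [0, x)`; as they are integers, the value `k`
is already reached before `x`. -/
theorem childTime_lt_iff (hm : ∀ j, IsPointMeasure (m j)) (k : ℕ+) (x : ℝ≥0) :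
    childTime m k < x ↔ ((k : ℕ) : ℝ≥0∞) ≤ (∑ j, m j) (Iio x) := by
  have hM := IsPointMeasure.sum hm
  constructor
  · intro h
    lift childTime m k to ℝ≥0 using (h.trans ENNReal.coe_lt_top).ne with s hs
    refine ((childTime_le_iff hm k s).1 hs.ge).trans (measure_mono ?_)
    exact Iic_subset_Iio.2 (by exact_mod_cast h)
  · intro h
    rcases eq_zero_or_pos x with rfl | hx
    · simp at h
    obtain ⟨u, hu, hux, hlim⟩ := exists_seq_strictMono_tendsto' hx
    have hU : (⋃ n, Iic (u n)) = Iio x := by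
      ext s
      simp only [mem_iUnion, mem_Iic, mem_Iio]
      refine ⟨fun ⟨n, hn⟩ => hn.trans_lt (hux n).2, fun hs => ?_⟩
      obtain ⟨n, hn⟩ := (hlim.eventually_const_lt hs).exists
      exact ⟨n, hn.le⟩
    have hlim2 : Tendsto (fun n => (∑ j, m j) (Iic (u n))) atTop (𝓝 ((∑ j, m j) (Iio x))) := by
      rw [← hU]
      exact tendsto_measure_iUnion_atTop fun a b hab => Iic_subset_Iic.2 (hu.monotone hab)
    have hk : (((k : ℕ) - 1 : ℕ) : ℝ≥0∞) < (∑ j, m j) (Iio x) := by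
      refine lt_of_lt_of_le ?_ h
      exact_mod_cast Nat.sub_lt k.pos one_pos
    obtain ⟨n, hn⟩ := (hlim2.eventually_const_lt hk).exists
    refine lt_of_le_of_lt ((childTime_le_iff hm k (u n)).2 ?_) (by exact_mod_cast (hux n).2)
    obtain ⟨N, hN⟩ := hM.exists_nat (measurableSet_Iic (a := u n)) subset_rfl
    rw [hN] at hn ⊢
    have : (k : ℕ) - 1 < N := by exact_mod_cast hn
    exact_mod_cast (by omega : (k : ℕ) ≤ N)

/-- The children born at `x` are those with rank in `(N(x-), N(x)]`; among these the ranks are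
filled by increasing type. -/
theorem childTime_eq_and_childType_eq_iff (hm : ∀ j, IsPointMeasure (m j)) (i j : Fin p) (k : ℕ+)
    (x : ℝ≥0) : childTime m k = x ∧ childType m i k = j ↔
      (∑ j, m j) (Iio x) + ∑ j' ∈ Finset.univ.filter (· < j), m j' {x} < ((k : ℕ) : ℝ≥0∞) ∧
      ((k : ℕ) : ℝ≥0∞) ≤ (∑ j, m j) (Iio x) + ∑ j' ∈ Finset.univ.filter (· ≤ j), m j' {x} := by
  classical
  have hIic : (∑ j, m j) (Iic x) = (∑ j, m j) (Iio x) + ∑ j, m j {x} := by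
    rw [← Iio_union_right, measure_union (by simp) (measurableSet_singleton x)]
    simp
  have hx : childTime m k = x ↔ (∑ j, m j) (Iio x) < ((k : ℕ) : ℝ≥0∞) ∧
      ((k : ℕ) : ℝ≥0∞) ≤ (∑ j, m j) (Iio x) + ∑ j, m j {x} := by
    rw [← hIic, ← childTime_le_iff hm, ← not_le, ← childTime_lt_iff hm, not_lt, and_comm,
      le_antisymm_iff]
  have hmono : ∀ {s t : Finset (Fin p)}, s ⊆ t →
      (∑ j, m j) (Iio x) + ∑ j' ∈ s, m j' {x} ≤ (∑ j, m j) (Iio x) + ∑ j' ∈ t, m j' {x} :=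
    fun h => add_le_add le_rfl (Finset.sum_le_sum_of_subset h)
  -- `J` is the set of types in the definition of `childType`, whose minimum is the type.
  set J : Finset (Fin p) := Finset.univ.filter fun j => ((k : ℕ) : ℝ≥0∞) ≤
      (∑ j', m j') (Iio x) + ∑ j' ∈ Finset.univ.filter (· ≤ j), m j' {x} with hJ
  have htype : childTime m k = x → ∀ h : J.Nonempty, childType m i k = J.min' h := by
    intro h hne
    have hJ' : J = Finset.univ.filter fun j => ((k : ℕ) : ℝ≥0∞) ≤
        ∑ j', m j' (Iio (childTime m k).toNNReal) +
          ∑ j' ∈ Finset.univ.filter (· ≤ j), m j' {(childTime m k).toNNReal} := by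
      ext j0; simp [h, hJ]
    unfold childType
    simp only
    rw [dif_pos ⟨by simp [h], by convert! hne using 1; rw [hJ']⟩]
    congr 1
    rw [hJ']
  constructor
  · rintro ⟨h, rfl⟩
    obtain ⟨h1, h2⟩ := hx.1 h
    have hp : 0 < p := by
      rcases Nat.eq_zero_or_pos p with rfl | hp
      · simp at h2
      · exact hp
    have hne : J.Nonempty := by
      refine ⟨⟨p - 1, by omega⟩, ?_⟩
      rw [hJ, Finset.mem_filter]
      refine ⟨Finset.mem_univ _, h2.trans (hmono fun j' _ => ?_)⟩
      simp only [Finset.mem_filter, Finset.mem_univ, true_and, Fin.le_def]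
      omega
    rw [htype h hne]
    -- If the strict inequality failed, the predecessor of the least element of `J` would be in `J`.
    refine ⟨?_, (Finset.mem_filter.1 (J.min'_mem hne)).2⟩
    by_contra! hle
    rcases (Finset.univ.filter (· < J.min' hne)).eq_empty_or_nonempty with he | hne2
    · rw [he] at hle
      simp only [Finset.sum_empty, add_zero] at hle
      exact absurd hle (not_le.2 h1)
    · have hmem := (Finset.univ.filter (· < J.min' hne)).max'_mem hne2
      set r := (Finset.univ.filter (· < J.min' hne)).max' hne2
      have hr : r ∈ J := by
        rw [hJ, Finset.mem_filter]
        refine ⟨Finset.mem_univ _, hle.trans (hmono fun j' hj' => ?_)⟩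
        rw [Finset.mem_filter]
        exact ⟨Finset.mem_univ _, Finset.le_max' _ _ hj'⟩
      exact absurd (J.min'_le r hr) (not_le.2 (Finset.mem_filter.1 hmem).2)
  · rintro ⟨h1, h2⟩
    have h : childTime m k = x := hx.2 ⟨lt_of_le_of_lt le_self_add h1,
      h2.trans (hmono (Finset.subset_univ _))⟩
    have hj : j ∈ J := Finset.mem_filter.2 ⟨Finset.mem_univ _, h2⟩
    refine ⟨h, (htype h ⟨j, hj⟩).trans ?_⟩
    refine le_antisymm (J.min'_le j hj) ?_
    by_contra! hlt
    have hmem := (Finset.mem_filter.1 (J.min'_mem ⟨j, hj⟩)).2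
    refine absurd (hmem.trans (hmono fun j' hj' => ?_)) (not_le.2 h1)
    rw [Finset.mem_filter] at hj' ⊢
    exact ⟨Finset.mem_univ _, hj'.2.trans_lt hlt⟩

theorem tsum_pnat_ite_Ioc (a b : ℕ) :
    (∑' k : ℕ+, if a < (k : ℕ) ∧ (k : ℕ) ≤ b then (1 : ℝ≥0∞) else 0) = ((b - a : ℕ) : ℝ≥0∞) := by
  have h := (Equiv.pnatEquivNat.symm.tsum_eq
    (fun k : ℕ+ => if a < (k : ℕ) ∧ (k : ℕ) ≤ b then (1 : ℝ≥0∞) else 0)).symm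
  rw [h, tsum_eq_sum (s := Finset.Ico a b)]
  · rw [Finset.sum_congr rfl (g := fun _ => (1 : ℝ≥0∞))]
    · simp
    · intro n hn
      rw [Finset.mem_Ico] at hn
      simp [hn]
  · intro n hn
    rw [Finset.mem_Ico] at hn
    simp
    omega

/-- The point process of the children of type `j`, as the sum of the Dirac masses at the birth times
in the list of children. -/
def childMeasure (m : Fin p → Measure ℝ≥0) (i j : Fin p) : Measure ℝ≥0 :=
  Measure.sum fun k : ℕ+ =>
    open Classical in if childTime m k < ∞ ∧ childType m i k = j then
      Measure.dirac (childTime m k).toNNReal else 0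

theorem childMeasure_apply (i j : Fin p) {s : Set ℝ≥0} (hs : MeasurableSet s) :
    childMeasure m i j s = ∑' k : ℕ+, open Classical in
      if ∃ x ∈ s, childTime m k = (x : ℝ≥0) ∧ childType m i k = j then (1 : ℝ≥0∞) else 0 := by
  classical
  rw [childMeasure, Measure.sum_apply _ hs]
  congr 1
  ext k
  by_cases h : childTime m k < ∞
  · have hx : ((childTime m k).toNNReal : ℝ≥0∞) = childTime m k := ENNReal.coe_toNNReal h.ne
    generalize (childTime m k).toNNReal = x at hx
    rw [← hx]
    by_cases h2 : childType m i k = j <;> by_cases h3 : x ∈ s <;> simp [h2, h3, hs]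
  · rw [not_lt, top_le_iff] at h
    simp [h]

/-- The list of children exhausts the offspring processes: both measures have the same atoms, and
they have the same total mass on bounded intervals when summed over the types. -/
theorem childMeasure_eq (hm : ∀ j, IsPointMeasure (m j)) (i j : Fin p) :
    childMeasure m i j = m j := by
  classical
  have hM := IsPointMeasure.sum hm
  set M := ∑ j, m j with hMdef
  have hsing : ∀ j x, childMeasure m i j {x} = m j {x} := by
    intro j x
    rw [childMeasure_apply _ _ (measurableSet_singleton x)]
    simp only [mem_singleton_iff, exists_eq_left, childTime_eq_and_childType_eq_iff hm]
    rw [← hMdef]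
    obtain ⟨N, hN⟩ := hM.exists_nat (measurableSet_Iio (a := x)) Iio_subset_Iic_self
    choose n hn using fun j => (hm j).exists_nat (measurableSet_singleton x) (t := x) (by simp)
    simp only [hN, hn, ← Nat.cast_sum, ← Nat.cast_add, Nat.cast_lt, Nat.cast_le]
    rw [tsum_pnat_ite_Ioc]
    congr 1
    have : Finset.univ.filter (· ≤ j) = insert j (Finset.univ.filter (· < j)) := by
      ext a; simp [le_iff_eq_or_lt]
    rw [this, Finset.sum_insert (by simp)]
    omega
  -- `R` contains all the birth times, so that `childMeasure` is the restriction of `m j` to `R`.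
  set R : Set ℝ≥0 := range fun k : ℕ+ => (childTime m k).toNNReal
  have hR : R.Countable := countable_range _
  have hRm : MeasurableSet R := hR.measurableSet
  have hnull : ∀ j, childMeasure m i j Rᶜ = 0 := by
    intro j
    rw [childMeasure_apply _ _ hRm.compl, ENNReal.tsum_eq_zero]
    intro k
    rw [if_neg]
    rintro ⟨x, hx, h, -⟩
    exact hx ⟨k, by simp [h]⟩
  have hinter : ∀ j (s : Set ℝ≥0), childMeasure m i j (s ∩ R) = m j (s ∩ R) := by
    intro j s
    have hc : (s ∩ R).Countable := hR.mono inter_subset_right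
    rw [← biUnion_of_singleton (s ∩ R), measure_biUnion hc (fun a _ b _ hab => by simpa using hab)
      (fun _ _ => measurableSet_singleton _), measure_biUnion hc
      (fun a _ b _ hab => by simpa using hab) (fun _ _ => measurableSet_singleton _)]
    simp only [hsing]
  have hinter' : ∀ j (s : Set ℝ≥0), childMeasure m i j s = m j (s ∩ R) := by
    intro j s
    rw [← hinter, measure_inter_conull (by simpa using hnull j)]
  have htot : ∀ t, ∑ j, childMeasure m i j (Iic t) = M (Iic t) := by
    intro t
    simp only [childMeasure_apply _ _ measurableSet_Iic]
    rw [← Summable.tsum_finsetSum (fun _ _ => ENNReal.summable)]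
    obtain ⟨N, hN⟩ := hM.exists_nat (measurableSet_Iic (a := t)) subset_rfl
    rw [hN, ← Nat.sub_zero N, ← tsum_pnat_ite_Ioc]
    congr 1
    ext k
    have hk : (0 < (k : ℕ) ∧ (k : ℕ) ≤ N) ↔ ∃ x ∈ Iic t, childTime m k = (x : ℝ≥0) := by
      have := childTime_le_iff hm k t
      rw [← hMdef, hN, Nat.cast_le] at this
      rw [and_iff_right k.pos, ← this]
      constructor
      · intro h
        lift childTime m k to ℝ≥0 using (h.trans_lt ENNReal.coe_lt_top).ne with x
        exact ⟨x, by exact_mod_cast h, rfl⟩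
      · rintro ⟨x, hx, h⟩
        rw [h]; exact_mod_cast hx
    rw [Finset.sum_eq_single (childType m i k)]
    · simp only [and_true]
      exact if_congr (by simpa using hk.symm) rfl rfl
    · rintro j - hj
      rw [if_neg]
      rintro ⟨x, -, -, h⟩
      exact hj h.symm
    · simp
  -- By finiteness on bounded intervals, equality of the total masses leaves no mass outside `R`.
  have hMR : ∀ t, M (Iic t \ R) = 0 := by
    intro t
    have h1 := htot t
    simp only [hinter'] at h1
    have h2 := measure_inter_add_sdiff (μ := M) (Iic t) hRm
    have h3 : M (Iic t ∩ R) = M (Iic t) := by rw [← h1, hMdef]; simp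
    rw [h3] at h2
    exact (ENNReal.add_right_inj (hM.2 t).ne).1 (h2.trans (add_zero _).symm)
  have hM0 : M Rᶜ = 0 := by
    have : Rᶜ = ⋃ n : ℕ, Iic (n : ℝ≥0) \ R := by
      ext x
      simp only [mem_compl_iff, mem_iUnion, Set.mem_sdiff, mem_Iic, exists_and_right]
      exact ⟨fun h => ⟨exists_nat_ge x, h⟩, fun h => h.2⟩
    rw [this, measure_iUnion_null_iff]
    exact fun n => hMR n
  have hmj : m j Rᶜ = 0 := by
    rw [hMdef] at hM0
    simp only [Measure.coe_finsetSum, Finset.sum_apply] at hM0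
    exact (Finset.sum_eq_zero_iff.1 hM0) j (Finset.mem_univ _)
  ext s hs
  rw [hinter', measure_inter_conull (by simpa using hmj)]

/-- Integrating against the offspring processes is summing over the list of children. -/
theorem lintegral_children (hm : ∀ j, IsPointMeasure (m j)) (i : Fin p)
    (f : Fin p → ℝ≥0 → ℝ≥0∞) :
    (∑ j, ∫⁻ s, f j s ∂(m j)) = ∑' k : ℕ+, open Classical in
      if childTime m k < ∞ then f (childType m i k) (childTime m k).toNNReal else 0 := by
  classical
  have h1 : ∀ j, ∫⁻ s, f j s ∂(m j) = ∑' k : ℕ+, 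
      if childTime m k < ∞ ∧ childType m i k = j then f j (childTime m k).toNNReal else 0 := by
    intro j
    rw [← childMeasure_eq hm i j, childMeasure, lintegral_sum_measure]
    congr 1
    ext k
    split_ifs <;> simp
  simp only [h1]
  rw [← Summable.tsum_finsetSum (fun _ _ => ENNReal.summable)]
  congr 1
  ext k
  by_cases h : childTime m k < ∞ <;> simp [h]

/-- Integrating against the offspring processes up to time `r` is summing over the children born up
to time `r`. -/
theorem integral_children (hm : ∀ j, IsPointMeasure (m j)) (i : Fin p)
    (f : Fin p → ℝ≥0 → ℂ) (r : ℝ≥0) (hf : ∀ j, IntegrableOn (f j) (Iic r) (m j)) :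
    HasSum (fun k : ℕ+ => open Classical in
      if childTime m k ≤ r then f (childType m i k) (childTime m k).toNNReal else 0)
      (∑ j, ∫ s in Iic r, f j s ∂(m j)) := by
  classical
  have h1 : ∀ j, HasSum (fun k : ℕ+ => if childTime m k ≤ r ∧ childType m i k = j then
      f j (childTime m k).toNNReal else 0) (∫ s in Iic r, f j s ∂(m j)) := by
    intro j
    have hfj := (integrable_indicator_iff measurableSet_Iic).2 (hf j)
    rw [← integral_indicator measurableSet_Iic]
    rw [← childMeasure_eq hm i j, childMeasure] at hfj ⊢
    convert! hasSum_integral_measure hfj using 1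
    ext k
    by_cases h : childTime m k < ∞
    · have hx : ((childTime m k).toNNReal : ℝ≥0∞) = childTime m k := ENNReal.coe_toNNReal h.ne
      generalize (childTime m k).toNNReal = x at hx
      rw [← hx]
      by_cases h2 : childType m i k = j <;> by_cases h3 : x ≤ r <;>
        simp [h2, h3]
    · rw [not_lt, top_le_iff] at h
      simp [h]
  convert! hasSum_sum (s := Finset.univ) fun j _ => h1 j using 1
  ext k
  by_cases h : childTime m k ≤ r <;> simp [h]

end Children

/-! ### Measurability -/

section Kernel

variable {Ω : Type*} {𝓜 : MeasurableSpace Ω}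

/-- A random point measure, as a transition kernel. -/
def pointKernel (X : Ω → Measure ℝ≥0) (hX : Measurable X) : Kernel Ω ℝ≥0 := ⟨X, hX⟩

/-- Partitioning `Ω` according to the integer part of the mass of each interval `[n, n + 1)`
exhibits a locally finite random measure as a countable sum of bounded kernels. -/
theorem isSFiniteKernel_pointKernel {X : Ω → Measure ℝ≥0} (hX : Measurable X)
    (hfin : ∀ ω t, X ω (Iic t) < ∞) : IsSFiniteKernel (pointKernel X hX) := by
  classical
  set I : ℕ → Set ℝ≥0 := fun n => Ico (n : ℝ≥0) (n + 1) with hI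
  have hIm : ∀ n, MeasurableSet (I n) := fun n => measurableSet_Ico
  set E : ℕ × ℕ → Set Ω := fun nk =>
    {ω | (nk.2 : ℝ≥0∞) ≤ X ω (I nk.1) ∧ X ω (I nk.1) < (nk.2 : ℝ≥0∞) + 1} with hE
  have hmeas : ∀ n, Measurable fun ω => X ω (I n) := fun n =>
    (Measure.measurable_coe (hIm n)).comp hX
  have hEm : ∀ nk, MeasurableSet (E nk) := fun nk =>
    (measurableSet_le measurable_const (hmeas _)).inter
      (measurableSet_lt (hmeas _) measurable_const)
  set κ : ℕ × ℕ → Kernel Ω ℝ≥0 := fun nk =>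
    Kernel.piecewise (hEm nk) ((pointKernel X hX).restrict (hIm nk.1)) 0 with hκ
  have hfinite : ∀ nk, IsFiniteKernel (κ nk) := by
    intro nk
    refine ⟨⟨(nk.2 : ℝ≥0∞) + 1, by finiteness, fun ω => ?_⟩⟩
    rw [hκ]
    simp only [Kernel.piecewise_apply]
    split_ifs with h
    · rw [Kernel.restrict_apply, Measure.restrict_apply_univ]
      exact h.2.le
    · simp
  have hsum : pointKernel X hX = Kernel.sum κ := by
    ext ω s hs
    rw [Kernel.sum_apply' _ _ hs, ENNReal.tsum_prod']
    have h1 : ∀ n, ∑' k : ℕ, κ (n, k) ω s = X ω (s ∩ I n) := by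
      intro n
      have hlt : X ω (I n) < ∞ :=
        (measure_mono (fun x hx => (hx.2.le : x ≤ (n : ℝ≥0) + 1))).trans_lt (hfin ω ((n : ℝ≥0) + 1))
      lift X ω (I n) to ℝ≥0 using hlt.ne with y hy
      rw [tsum_eq_single ⌊y⌋₊]
      · have : ω ∈ E (n, ⌊y⌋₊) := by
          simp only [hE, mem_ofPred_eq, ← hy]
          constructor
          · exact_mod_cast Nat.floor_le zero_le
          · exact_mod_cast Nat.lt_floor_add_one y
        simp only [hκ, Kernel.piecewise_apply, if_pos this]
        rw [Kernel.restrict_apply, Measure.restrict_apply hs]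
        rfl
      · intro k hk
        have : ω ∉ E (n, k) := by
          simp only [hE, mem_ofPred_eq, ← hy]
          rintro ⟨h1, h2⟩
          refine hk ((Nat.floor_eq_iff zero_le).2 ⟨by exact_mod_cast h1, by exact_mod_cast h2⟩).symm
        simp only [hκ, Kernel.piecewise_apply, if_neg this]
        simp
    simp only [h1]
    rw [← measure_iUnion]
    · congr 1
      rw [← inter_iUnion]
      symm
      refine inter_eq_left.2 fun x _ => mem_iUnion.2 ⟨⌊x⌋₊, Nat.floor_le zero_le, 
        Nat.lt_floor_add_one x⟩
    · intro a b hab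
      refine Disjoint.mono inter_subset_right inter_subset_right ?_
      rw [Set.disjoint_left]
      rintro x ⟨h1, h2⟩ ⟨h3, h4⟩
      apply hab
      rw [← (Nat.floor_eq_iff zero_le).2 ⟨h1, h2⟩, ← (Nat.floor_eq_iff zero_le).2 ⟨h3, h4⟩]
    · exact fun n => hs.inter (hIm n)
  rw [hsum]
  exact Kernel.isSFiniteKernel_sum

/-- The integrand may depend on `ω` because random point measures are s-finite kernels. -/
theorem measurable_integral_pointMeasure {X : Ω → Measure ℝ≥0} (hX : Measurable X)
    (hp : ∀ ω, IsPointMeasure (X ω)) {f : Ω → ℝ≥0 → ℂ} (hf : Measurable (Function.uncurry f)) :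
    Measurable fun ω => ∫ s, f ω s ∂(X ω) := by
  have := isSFiniteKernel_pointKernel hX fun ω => (hp ω).2
  exact (StronglyMeasurable.integral_kernel_prod_right (κ := pointKernel X hX)
    hf.stronglyMeasurable).measurable

theorem measurable_pointMeasure_apply {X : Ω → Measure ℝ≥0} (hX : Measurable X)
    (hp : ∀ ω, IsPointMeasure (X ω)) {S : Set (Ω × ℝ≥0)} (hS : MeasurableSet S) :
    Measurable fun ω => X ω {s | (ω, s) ∈ S} := by
  have := isSFiniteKernel_pointKernel hX fun ω => (hp ω).2
  exact Kernel.measurable_kernel_prodMk_left (κ := pointKernel X hX) hS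

variable {p : ℕ} {X : Ω → Fin p → Measure ℝ≥0}

theorem measurable_childTime (hX : Measurable X) (hp : ∀ ω j, IsPointMeasure (X ω j)) (k : ℕ+) :
    Measurable fun ω => childTime (X ω) k := by
  refine measurable_of_Iic fun t => ?_
  induction t with
  | top => simp
  | coe t =>
    have : (fun ω => childTime (X ω) k) ⁻¹' Iic (t : ℝ≥0∞) =
        {ω | ((k : ℕ) : ℝ≥0∞) ≤ ∑ j, X ω j (Iic t)} := by
      ext ω
      simp [childTime_le_iff (hp ω)]
    rw [this]
    refine measurableSet_le measurable_const (Finset.measurable_sum _ fun j _ => ?_)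
    exact (Measure.measurable_coe measurableSet_Iic).comp ((measurable_pi_apply j).comp hX)

theorem measurable_childType (hX : Measurable X) (hp : ∀ ω j, IsPointMeasure (X ω j)) (k : ℕ+)
    {i : Ω → Fin p} (hi : Measurable i) : Measurable fun ω => childType (X ω) (i ω) k := by
  classical
  refine measurable_to_countable' fun j => ?_
  have hXj : ∀ j, Measurable fun ω => X ω j := fun j => (measurable_pi_apply j).comp hX
  have hT := measurable_childTime hX hp k
  set x : Ω → ℝ≥0 := fun ω => (childTime (X ω) k).toNNReal with hx
  have hxm : Measurable x := hT.ennreal_toNNReal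
  have h1 : Measurable fun ω => (∑ j, X ω j) (Iio (x ω)) := by
    simp only [Measure.coe_finsetSum, Finset.sum_apply]
    refine Finset.measurable_sum _ fun j _ => ?_
    exact measurable_pointMeasure_apply (hXj j) (fun ω => hp ω j)
      (S := {y | y.2 < x y.1}) (measurableSet_lt measurable_snd (hxm.comp measurable_fst))
  have h2 : ∀ j, Measurable fun ω => X ω j {x ω} := fun j =>
    measurable_pointMeasure_apply (hXj j) (fun ω => hp ω j)
      (S := {y | y.2 = x y.1}) (measurableSet_eq_fun measurable_snd (hxm.comp measurable_fst))
  have hset : (fun ω => childType (X ω) (i ω) k) ⁻¹' {j} =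
      ({ω | childTime (X ω) k < ∞} ∩ {ω | (∑ j, X ω j) (Iio (x ω)) +
        ∑ j' ∈ Finset.univ.filter (· < j), X ω j' {x ω} < ((k : ℕ) : ℝ≥0∞)} ∩
        {ω | ((k : ℕ) : ℝ≥0∞) ≤ (∑ j, X ω j) (Iio (x ω)) +
        ∑ j' ∈ Finset.univ.filter (· ≤ j), X ω j' {x ω}}) ∪
      ({ω | childTime (X ω) k < ∞}ᶜ ∩ i ⁻¹' {j}) := by
    ext ω
    by_cases h : childTime (X ω) k < ∞
    · have := childTime_eq_and_childType_eq_iff (hp ω) (i ω) j k (x ω)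
      have hxe : childTime (X ω) k = x ω := (ENNReal.coe_toNNReal h.ne).symm
      rw [← hxe] at this
      simp only [true_and] at this
      simp only [mem_preimage, mem_singleton_iff, mem_union, mem_inter_iff, mem_ofPred_eq, h,
        mem_compl_iff, not_true, false_and, or_false, true_and, this]
    · simp [h, childType]
  rw [hset]
  have h3 := measurableSet_lt hT (measurable_const (a := ∞))
  refine ((h3.inter ?_).inter ?_).union (h3.compl.inter (hi (measurableSet_singleton j)))
  · exact measurableSet_lt (h1.add (Finset.measurable_sum _ fun j _ => h2 j)) measurable_const
  · exact measurableSet_le measurable_const (h1.add (Finset.measurable_sum _ fun j _ => h2 j))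

theorem measurable_row {Y : Ω → Fin p → Fin p → Measure ℝ≥0} (hY : Measurable Y)
    {i : Ω → Fin p} (hi : Measurable i) : Measurable fun ω => Y ω (i ω) := by
  have : Measurable fun y : (Fin p → Fin p → Measure ℝ≥0) × Fin p => y.1 y.2 :=
    measurable_from_prod_countable_left fun j => measurable_pi_apply j
  exact this.comp (hY.prodMk hi)

variable {τ₀ : Ω → Fin p} {ξ : Label → Ω → Fin p → Fin p → Measure ℝ≥0}

/-- Birth time and type of an individual are determined by its strict ancestors. -/
theorem measurable_typeOf_and_birthTime (hτ : Measurable τ₀)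
    (hp : ∀ u ω i j, IsPointMeasure (ξ u ω i j)) (u : Label)
    (h : ∀ v, v <:+ u → v ≠ u → Measurable (ξ v)) :
    Measurable (typeOf τ₀ ξ u) ∧ Measurable (birthTime τ₀ ξ u) := by
  induction u with
  | nil => exact ⟨hτ, measurable_const⟩
  | cons k u ih =>
    have hne : ∀ v, v <:+ u → v ≠ k :: u := by
      rintro v hv rfl
      have := hv.length_le
      simp at this
    obtain ⟨h1, h2⟩ := ih fun v hv _ => h v (hv.trans (List.suffix_cons k u)) (hne v hv)
    have h3 := measurable_row (h u (List.suffix_cons k u) (hne u (List.suffix_refl u))) h1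
    exact ⟨measurable_childType h3 (fun ω j => hp u ω _ j) k h1,
      h2.add (measurable_childTime h3 (fun ω j => hp u ω _ j) k)⟩

/-- The information carried by the offspring of all individuals except `u`. -/
@[reducible] def othersSigma (ξ : Label → Ω → Fin p → Fin p → Measure ℝ≥0) (u : Label) :
    MeasurableSpace Ω :=
  ⨆ w ∈ ({u}ᶜ : Set Label), MeasurableSpace.comap (ξ w) inferInstance

/-- The information carried by the type of the ancestor and by the offspring of all individuals
except `u`. -/
@[reducible] def exceptSigma (τ₀ : Ω → Fin p) (ξ : Label → Ω → Fin p → Fin p → Measure ℝ≥0)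
    (u : Label) : MeasurableSpace Ω :=
  MeasurableSpace.comap τ₀ inferInstance ⊔ othersSigma ξ u

theorem measurable_type_exceptSigma (u : Label) : Measurable[exceptSigma τ₀ ξ u] τ₀ :=
  (comap_measurable τ₀).mono le_sup_left le_rfl

theorem measurable_offspring_exceptSigma {u w : Label} (h : w ≠ u) :
    Measurable[exceptSigma τ₀ ξ u] (ξ w) :=
  (comap_measurable (ξ w)).mono
    ((le_iSup₂_of_le (f := fun (w : Label) (_ : w ∈ ({u}ᶜ : Set Label)) =>
      MeasurableSpace.comap (ξ w) inferInstance) w h le_rfl).trans le_sup_right) le_rfl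

theorem measurable_type_lineageSigma (u : Label) : Measurable[lineageSigma τ₀ ξ u] τ₀ :=
  (comap_measurable τ₀).mono le_sup_left le_rfl

theorem measurable_offspring_lineageSigma {u w : Label} (h : w <:+ u) :
    Measurable[lineageSigma τ₀ ξ u] (ξ w) :=
  (comap_measurable (ξ w)).mono
    ((le_iSup₂_of_le (f := fun (w : Label) (_ : w <:+ u) =>
      MeasurableSpace.comap (ξ w) inferInstance) w h le_rfl).trans le_sup_right) le_rfl

/-- The lineage of an individual that does not descend from `u` does not involve `ξ_u`. -/
theorem lineageSigma_le_exceptSigma {u v : Label} (h : ¬ u <:+ v) :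
    lineageSigma τ₀ ξ v ≤ exceptSigma τ₀ ξ u := by
  refine sup_le le_sup_left (iSup₂_le fun w hw => ?_)
  refine (measurable_offspring_exceptSigma (u := u) ?_).comap_le
  rintro rfl
  exact h hw

end Kernel

section Sigma

variable {Ω : Type*} {mΩ : MeasurableSpace Ω} {P : Measure Ω} {p : ℕ} {τ₀ : Ω → Fin p}
  {ξ : Label → Ω → Fin p → Fin p → Measure ℝ≥0}

namespace IsReproduction

theorem exceptSigma_le (hξ : IsReproduction P τ₀ ξ) (u : Label) : exceptSigma τ₀ ξ u ≤ mΩ :=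
  sup_le hξ.measurable_type.comap_le
    (iSup₂_le fun w _ => (hξ.measurable_offspring w).comap_le)

theorem lineageSigma_le (hξ : IsReproduction P τ₀ ξ) (u : Label) : lineageSigma τ₀ ξ u ≤ mΩ :=
  sup_le hξ.measurable_type.comap_le
    (iSup₂_le fun w _ => (hξ.measurable_offspring w).comap_le)

theorem measurable_lineage (hξ : IsReproduction P τ₀ ξ) (u : Label) :
    Measurable[lineageSigma τ₀ ξ u] (typeOf τ₀ ξ u) ∧
      Measurable[lineageSigma τ₀ ξ u] (birthTime τ₀ ξ u) :=
  measurable_typeOf_and_birthTime (measurable_type_lineageSigma u) hξ.isPointMeasure u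
    fun _ hv _ => measurable_offspring_lineageSigma hv

/-- Type and birth time of `u` do not depend on the offspring of `u` itself. -/
theorem measurable_except (hξ : IsReproduction P τ₀ ξ) (u : Label) :
    Measurable[exceptSigma τ₀ ξ u] (typeOf τ₀ ξ u) ∧
      Measurable[exceptSigma τ₀ ξ u] (birthTime τ₀ ξ u) :=
  measurable_typeOf_and_birthTime (measurable_type_exceptSigma u) hξ.isPointMeasure u
    fun _ _ hv => measurable_offspring_exceptSigma hv

theorem measurable_typeOf (hξ : IsReproduction P τ₀ ξ) (u : Label) : Measurable (typeOf τ₀ ξ u) :=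
  (hξ.measurable_lineage u).1.mono (hξ.lineageSigma_le u) le_rfl

theorem measurable_birthTime (hξ : IsReproduction P τ₀ ξ) (u : Label) :
    Measurable (birthTime τ₀ ξ u) :=
  (hξ.measurable_lineage u).2.mono (hξ.lineageSigma_le u) le_rfl

/-- The offspring of `u` is independent of the type of the ancestor and of all other offspring. -/
theorem indep_exceptSigma [IsProbabilityMeasure P] (hξ : IsReproduction P τ₀ ξ) (u : Label) :
    Indep (exceptSigma τ₀ ξ u) (MeasurableSpace.comap (ξ u) inferInstance) P := by
  have hall : (⨆ w, MeasurableSpace.comap (ξ w) inferInstance) =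
      MeasurableSpace.comap (fun ω u => ξ u ω) inferInstance := by
    simp only [MeasurableSpace.pi, MeasurableSpace.comap_iSup, MeasurableSpace.comap_comp]
    rfl
  have h1 : Indep (othersSigma ξ u) (MeasurableSpace.comap (ξ u) inferInstance) P := by
    have := indep_iSup_of_disjoint (m := fun w => MeasurableSpace.comap (ξ w) inferInstance)
      (fun w => (hξ.measurable_offspring w).comap_le) hξ.indep
      (S := {u}ᶜ) (T := {u}) disjoint_compl_left
    simpa [othersSigma] using this
  have h2 : Indep (MeasurableSpace.comap τ₀ inferInstance)
      (⨆ w, MeasurableSpace.comap (ξ w) inferInstance) P := by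
    rw [hall]; exact hξ.indep_type
  have hmO : othersSigma ξ u ≤ ⨆ w, MeasurableSpace.comap (ξ w) inferInstance :=
    iSup₂_le fun w _ => le_iSup (fun w => MeasurableSpace.comap (ξ w) inferInstance) w
  have hmu : MeasurableSpace.comap (ξ u) inferInstance ≤
      ⨆ w, MeasurableSpace.comap (ξ w) inferInstance :=
    le_iSup (fun w => MeasurableSpace.comap (ξ w) inferInstance) u
  -- `σ(τ₀) ⊔ σ(ξ_w, w ≠ u)` is generated by the π-system of intersections of one set of each kind.
  set C : Set (Set Ω) := {s | ∃ A B, MeasurableSet[MeasurableSpace.comap τ₀ inferInstance] A ∧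
    MeasurableSet[othersSigma ξ u] B ∧ s = A ∩ B} with hC
  have hgen : exceptSigma τ₀ ξ u = MeasurableSpace.generateFrom C := by
    refine le_antisymm (sup_le (fun A hA => ?_) (fun B hB => ?_))
      (MeasurableSpace.generateFrom_le ?_)
    · exact MeasurableSpace.measurableSet_generateFrom
        ⟨A, univ, hA, MeasurableSet.univ, (inter_univ A).symm⟩
    · exact MeasurableSpace.measurableSet_generateFrom
        ⟨univ, B, MeasurableSet.univ, hB, (univ_inter B).symm⟩
    · rintro _ ⟨A, B, hA, hB, rfl⟩
      exact MeasurableSet.inter ((le_sup_left : _ ≤ exceptSigma τ₀ ξ u) A hA)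
        ((le_sup_right : _ ≤ exceptSigma τ₀ ξ u) B hB)
  have hpi : IsPiSystem C := by
    rintro _ ⟨A, B, hA, hB, rfl⟩ _ ⟨A', B', hA', hB', rfl⟩ -
    exact ⟨A ∩ A', B ∩ B', MeasurableSet.inter hA hA', MeasurableSet.inter hB hB',
      inter_inter_inter_comm A B A' B'⟩
  refine IndepSets.indep (hξ.exceptSigma_le u) (hξ.measurable_offspring u).comap_le hpi
    (@MeasurableSpace.isPiSystem_measurableSet Ω (MeasurableSpace.comap (ξ u) inferInstance)) hgen
    (@MeasurableSpace.generateFrom_measurableSet Ω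
      (MeasurableSpace.comap (ξ u) inferInstance)).symm ?_
  rw [IndepSets_iff]
  rintro _ D ⟨A, B, hA, hB, rfl⟩ hD
  rw [Indep_iff] at h1 h2
  rw [inter_assoc, h2 A (B ∩ D) hA (MeasurableSet.inter (hmO B hB) (hmu D hD)), h1 B D hB hD,
    h2 A B hA (hmO B hB), mul_assoc]

end IsReproduction

end Sigma

/-! ### Spectral radii of nonnegative matrices -/

section Spectral

variable {n : Type*} [Fintype n] [DecidableEq n]

/-- Gelfand's formula for the operator norm with respect to the maximum norm. -/
theorem tendsto_sup_sum_nnnorm_pow (A : Matrix n n ℂ) :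
    Tendsto (fun k : ℕ => ((Finset.univ.sup fun i => ∑ j, ‖(A ^ k) i j‖₊ : ℝ≥0) : ℝ≥0∞) ^
      (1 / k : ℝ)) atTop (𝓝 (spectralRadius ℂ A)) := by
  have hc : @CompleteSpace (Matrix n n ℂ)
      Matrix.linftyOpNormedRing.toMetricSpace.toPseudoMetricSpace.toUniformSpace :=
    inferInstanceAs (CompleteSpace (n → n → ℂ))
  refine (@spectrum.pow_nnnorm_pow_one_div_tendsto_nhds_spectralRadius (Matrix n n ℂ)
    Matrix.linftyOpNormedRing Matrix.linftyOpNormedAlgebra hc A).congr fun k => ?_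
  exact congrArg (fun x : ℝ≥0 => (x : ℝ≥0∞) ^ (1 / k : ℝ)) (Matrix.linfty_opNNNorm_def (A ^ k))

/-- A nonnegative matrix, as a complex matrix. -/
def toComplex : Matrix n n ℝ≥0 →+* Matrix n n ℂ := (algebraMap ℝ≥0 ℂ).mapMatrix

theorem toComplex_apply (A : Matrix n n ℝ≥0) (i j : n) : toComplex A i j = ((A i j : ℝ) : ℂ) := rfl

theorem nnnorm_toComplex_apply (A : Matrix n n ℝ≥0) (i j : n) : ‖toComplex A i j‖₊ = A i j := by
  rw [toComplex_apply]
  ext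
  simp

theorem pow_apply_le_pow_apply {A B : Matrix n n ℝ≥0} (h : ∀ i j, A i j ≤ B i j) (k : ℕ)
    (i j : n) :
    (A ^ k) i j ≤ (B ^ k) i j := by
  induction k generalizing i j with
  | zero => simp
  | succ k ih =>
    simp only [pow_succ, Matrix.mul_apply]
    exact Finset.sum_le_sum fun l _ => mul_le_mul' (ih i l) (h l j)

theorem spectralRadius_toComplex_mono {A B : Matrix n n ℝ≥0} (h : ∀ i j, A i j ≤ B i j) :
    spectralRadius ℂ (toComplex A) ≤ spectralRadius ℂ (toComplex B) := by
  refine le_of_tendsto_of_tendsto'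
    (tendsto_sup_sum_nnnorm_pow (toComplex A))
    (tendsto_sup_sum_nnnorm_pow (toComplex B)) fun k => ?_
  refine ENNReal.rpow_le_rpow ?_ (by positivity)
  simp only [← map_pow, nnnorm_toComplex_apply, ENNReal.coe_le_coe]
  exact Finset.sup_mono_fun fun i _ => Finset.sum_le_sum fun j _ => pow_apply_le_pow_apply h k i j

/-- The Neumann series of a nonnegative matrix of spectral radius less than `1` converges. -/
theorem tsum_pow_apply_lt_top {A : Matrix n n ℝ≥0} (h : spectralRadius ℂ (toComplex A) < 1)
    (i j : n) : ∑' k : ℕ, (((A ^ k) i j : ℝ≥0) : ℝ≥0∞) < ∞ := by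
  obtain ⟨r, hr, hr1⟩ := ENNReal.lt_iff_exists_nnreal_btwn.1 h
  have hev := (tendsto_sup_sum_nnnorm_pow (toComplex A)).eventually_lt_const hr
  have hr1' : r < 1 := by exact_mod_cast hr1
  have hs : Summable fun k : ℕ => (A ^ k) i j := by
    rw [← NNReal.summable_coe]
    refine Summable.of_norm_bounded_eventually_nat
      (NNReal.summable_coe.2 (NNReal.summable_geometric hr1')) ?_
    filter_upwards [hev, eventually_gt_atTop 0] with k hk hk0
    simp only [← map_pow, nnnorm_toComplex_apply] at hk
    have hk' : ((Finset.univ.sup fun i => ∑ j, (A ^ k) i j : ℝ≥0) : ℝ≥0∞) ≤ (r : ℝ≥0∞) ^ k := by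
      have := ENNReal.rpow_le_rpow hk.le (Nat.cast_nonneg (α := ℝ) k)
      rwa [← ENNReal.rpow_mul, one_div, inv_mul_cancel₀ (by positivity), ENNReal.rpow_one,
        ENNReal.rpow_natCast] at this
    have hle : (A ^ k) i j ≤ r ^ k := by
      refine le_trans ?_ (show (Finset.univ.sup fun i => ∑ j, (A ^ k) i j) ≤ r ^ k by
        exact_mod_cast hk')
      refine le_trans ?_ (Finset.le_sup (f := fun i => ∑ j, (A ^ k) i j) (Finset.mem_univ i))
      exact Finset.single_le_sum (f := fun j => (A ^ k) i j) (fun _ _ => zero_le)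
        (Finset.mem_univ j)
    simpa using (show (((A ^ k) i j : ℝ≥0) : ℝ) ≤ ((r ^ k : ℝ≥0) : ℝ) by exact_mod_cast hle)
  exact lt_top_iff_ne_top.2 (ENNReal.tsum_coe_ne_top_iff_summable.2 hs)

end Spectral

/-! ### Discounted number of individuals -/

section Discount

/-- The discount factor `e^{-β x}`, extended by `0` to `x = ∞`. -/
def discount (β : ℝ) (x : ℝ≥0∞) : ℝ≥0∞ :=
  if x < ∞ then ENNReal.ofReal (Real.exp (-β * x.toReal)) else 0

theorem discount_coe (β : ℝ) (x : ℝ≥0) :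
    discount β x = ENNReal.ofReal (Real.exp (-β * (x : ℝ))) := by
  simp [discount]

theorem discount_add (β : ℝ) (x y : ℝ≥0∞) : discount β (x + y) = discount β x * discount β y := by
  induction x with
  | top => simp [discount]
  | coe x =>
    induction y with
    | top => simp [discount]
    | coe y =>
      rw [← ENNReal.coe_add, discount_coe, discount_coe, discount_coe,
        ← ENNReal.ofReal_mul (Real.exp_pos _).le, ← Real.exp_add]
      congr 2
      push_cast
      ring

theorem measurable_discount (β : ℝ) : Measurable (discount β) := by
  refine Measurable.ite (measurableSet_lt measurable_id measurable_const) ?_ measurable_const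
  exact ENNReal.measurable_ofReal.comp
    (Real.measurable_exp.comp (ENNReal.measurable_toReal.const_mul _))

/-- A label is either that of the ancestor or that of a child. -/
def labelEquiv : Unit ⊕ (Label × ℕ+) ≃ Label where
  toFun x := x.elim (fun _ => []) fun y => y.2 :: y.1
  invFun u := match u with
    | [] => Sum.inl ()
    | k :: u => Sum.inr (u, k)
  left_inv x := by cases x <;> rfl
  right_inv u := by cases u <;> rfl

theorem tsum_label (f : Label → ℝ≥0∞) :
    ∑' u, f u = f [] + ∑' (u : Label) (k : ℕ+), f (k :: u) := by
  rw [← labelEquiv.tsum_eq, Summable.tsum_sum ENNReal.summable ENNReal.summable,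
    ENNReal.tsum_prod', tsum_fintype]
  simp [labelEquiv]

variable {Ω : Type*} [mΩ : MeasurableSpace Ω] {P : Measure Ω} {p : ℕ} {τ₀ : Ω → Fin p}
  {ξ : Label → Ω → Fin p → Fin p → Measure ℝ≥0}

namespace IsReproduction

theorem measurable_entry (hξ : IsReproduction P τ₀ ξ) (u : Label) (i j : Fin p) :
    Measurable fun ω => ξ u ω i j :=
  (measurable_pi_apply j).comp ((measurable_pi_apply i).comp (hξ.measurable_offspring u))

/-- Campbell's formula. -/
theorem lintegral_lintegral (hξ : IsReproduction P τ₀ ξ) (u : Label) (i j : Fin p)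
    {f : ℝ≥0 → ℝ≥0∞} (hf : Measurable f) :
    ∫⁻ ω, ∫⁻ s, f s ∂(ξ u ω i j) ∂P = ∫⁻ s, f s ∂(intensity P ξ i j) := by
  have hg : Measurable fun M : Fin p → Fin p → Measure ℝ≥0 => ∫⁻ s, f s ∂(M i j) :=
    (Measure.measurable_lintegral hf).comp ((measurable_pi_apply j).comp (measurable_pi_apply i))
  rw [intensity, Measure.lintegral_bind (hξ.measurable_entry [] i j).aemeasurable hf.aemeasurable]
  exact ((hξ.identDistrib u).comp hg).lintegral_eq

variable [IsProbabilityMeasure P]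

/-- The mean discounted number of children of type `j` of `u`: birth time and type of `u` are
independent of the offspring of `u`. -/
theorem sum_children_discount (hξ : IsReproduction P τ₀ ξ) (β : ℝ) (u : Label) (j : Fin p) :
    ∑' k : ℕ+, ∫⁻ ω, (if typeOf τ₀ ξ (k :: u) ω = j then
        discount β (birthTime τ₀ ξ (k :: u) ω) else 0) ∂P =
      ∑ i, (∫⁻ ω, (if typeOf τ₀ ξ u ω = i then discount β (birthTime τ₀ ξ u ω) else 0) ∂P) *
        ∫⁻ s, discount β (s : ℝ≥0) ∂(intensity P ξ i j) := by
  have hd : Measurable fun s : ℝ≥0 => discount β s :=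
    (measurable_discount β).comp measurable_coe_nnreal_ennreal
  have hmeas : ∀ v j, Measurable fun ω => if typeOf τ₀ ξ v ω = j then
      discount β (birthTime τ₀ ξ v ω) else 0 := fun v j =>
    Measurable.ite (hξ.measurable_typeOf v (measurableSet_singleton j))
      ((measurable_discount β).comp (hξ.measurable_birthTime v)) measurable_const
  rw [← lintegral_tsum fun k => (hmeas (k :: u) j).aemeasurable]
  have hpt : ∀ ω, (∑' k : ℕ+, if typeOf τ₀ ξ (k :: u) ω = j then
        discount β (birthTime τ₀ ξ (k :: u) ω) else 0) =
      ∑ i, (if typeOf τ₀ ξ u ω = i then discount β (birthTime τ₀ ξ u ω) else 0) *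
        ∫⁻ s, discount β (s : ℝ≥0) ∂(ξ u ω i j) := by
    intro ω
    have h := lintegral_children (fun j => hξ.isPointMeasure u ω (typeOf τ₀ ξ u ω) j)
      (typeOf τ₀ ξ u ω) (fun j' s => if j' = j then discount β (s : ℝ≥0) else 0)
    rw [Finset.sum_eq_single j (by intro b _ hb; simp [hb]) (by simp)] at h
    simp only [if_true] at h
    rw [Finset.sum_eq_single (typeOf τ₀ ξ u ω) (by intro b _ hb; simp [hb.symm]) (by simp), h,
      if_pos rfl, ← ENNReal.tsum_mul_left]
    congr 1
    ext k
    simp only [typeOf, birthTime, discount_add]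
    by_cases hk : childTime (ξ u ω (typeOf τ₀ ξ u ω)) k < ∞
    · simp [hk, ENNReal.coe_toNNReal hk.ne]
    · simp [hk, discount]
  simp only [hpt]
  rw [lintegral_finsetSum]
  · refine Finset.sum_congr rfl fun i _ => ?_
    rw [← hξ.lintegral_lintegral u i j hd]
    refine lintegral_mul_eq_lintegral_mul_lintegral_of_independent_measurableSpace
      (hξ.exceptSigma_le u) (hξ.measurable_offspring u).comap_le (hξ.indep_exceptSigma u) ?_ ?_
    · exact Measurable.ite ((hξ.measurable_except u).1 (measurableSet_singleton i))
        ((measurable_discount β).comp (hξ.measurable_except u).2) measurable_const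
    · have hg : Measurable fun M : Fin p → Fin p → Measure ℝ≥0 =>
          ∫⁻ s, discount β (s : ℝ≥0) ∂(M i j) :=
        (Measure.measurable_lintegral hd).comp
          ((measurable_pi_apply j).comp (measurable_pi_apply i))
      exact hg.comp (comap_measurable (ξ u))
  · intro i _
    exact (hmeas u i).mul ((Measure.measurable_lintegral hd).comp (hξ.measurable_entry u i j))

end IsReproduction

/-- The matrix of Laplace transforms at a real argument, as a nonnegative matrix. Infinite entries
are replaced by `0`; it is only used on the domain of the Laplace transform. -/
def realLaplace (μ : Fin p → Fin p → Measure ℝ≥0) (β : ℝ) : Matrix (Fin p) (Fin p) ℝ≥0 :=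
  Matrix.of fun i j => (∫⁻ s, discount β (s : ℝ≥0) ∂(μ i j)).toNNReal

theorem toComplex_realLaplace (μ : Fin p → Fin p → Measure ℝ≥0) (β : ℝ) :
    toComplex (realLaplace μ β) = laplace μ β := by
  ext i j
  rw [toComplex_apply, laplace, Matrix.of_apply, realLaplace, Matrix.of_apply]
  have : ∀ s : ℝ≥0,
      Complex.exp (-(β : ℂ) * ((s : ℝ) : ℂ)) = ((Real.exp (-β * (s : ℝ)) : ℝ) : ℂ) := by
    intro s; push_cast; rfl
  simp only [this, discount_coe]
  rw [integral_complex_ofReal, integral_eq_lintegral_of_nonneg_ae]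
  · rfl
  · exact Eventually.of_forall fun s => (Real.exp_pos _).le
  · exact (by fun_prop : Measurable fun s : ℝ≥0 => Real.exp (-β * (s : ℝ))).aestronglyMeasurable

theorem coe_realLaplace {μ : Fin p → Fin p → Measure ℝ≥0} {β : ℝ} (hβ : (β : ℂ) ∈ laplaceDom μ)
    (i j : Fin p) : ((realLaplace μ β i j : ℝ≥0) : ℝ≥0∞) = ∫⁻ s, discount β (s : ℝ≥0) ∂(μ i j) := by
  rw [realLaplace, Matrix.of_apply, ENNReal.coe_toNNReal]
  simpa [discount_coe] using (hβ i j).ne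

theorem mem_laplaceDom_of_le {μ : Fin p → Fin p → Measure ℝ≥0} {z w : ℂ} (hz : z ∈ laplaceDom μ)
    (hzw : z.re ≤ w.re) : w ∈ laplaceDom μ := by
  intro i j
  refine (lintegral_mono fun s => ENNReal.ofReal_le_ofReal (Real.exp_le_exp.2 ?_)).trans_lt (hz i j)
  have := mul_le_mul_of_nonneg_right hzw s.coe_nonneg
  linarith

/-- To the right of the Malthusian parameter the Laplace transform has spectral radius less than
`1`: the radius is nonincreasing, and it does not take the value `1` again. -/
theorem IsMalthusian.spectralRadius_lt_one {μ : Fin p → Fin p → Measure ℝ≥0} {α β : ℝ}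
    (hα : IsMalthusian μ α) (hβ : α < β) :
    spectralRadius ℂ (toComplex (realLaplace μ β)) < 1 := by
  obtain ⟨⟨hα0, hαd, hα1⟩, hmax⟩ := hα
  have hβd : (β : ℂ) ∈ laplaceDom μ := mem_laplaceDom_of_le hαd (by simpa using hβ.le)
  have hle : spectralRadius ℂ (toComplex (realLaplace μ β)) ≤ 1 := by
    rw [← hα1, ← toComplex_realLaplace]
    refine spectralRadius_toComplex_mono fun i j => ?_
    rw [← ENNReal.coe_le_coe, coe_realLaplace hαd, coe_realLaplace hβd]
    refine lintegral_mono fun s => ?_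
    rw [discount_coe, discount_coe]
    refine ENNReal.ofReal_le_ofReal (Real.exp_le_exp.2 ?_)
    have := mul_le_mul_of_nonneg_right hβ.le s.coe_nonneg
    linarith
  refine lt_of_le_of_ne hle fun h => ?_
  rw [toComplex_realLaplace] at h
  exact absurd (hmax ⟨hα0.trans hβ, hβd, h⟩) (not_le.2 hβ)

namespace IsReproduction

variable [IsProbabilityMeasure P]

/-- The mean discounted numbers of individuals of the `n`-th generation, listed by their types, form
the row vector `v (ℒμ(β)) ^ n`, where `v` is the distribution of the type of the ancestor, and the
spectral radius of `ℒμ(β)` is less than `1`. -/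
theorem tsum_discount_lt_top (hξ : IsReproduction P τ₀ ξ) {α β : ℝ}
    (hα : IsMalthusian (intensity P ξ) α) (hβ : α < β) :
    ∑' u, ∫⁻ ω, discount β (birthTime τ₀ ξ u ω) ∂P < ∞ := by
  classical
  have hβd : (β : ℂ) ∈ laplaceDom (intensity P ξ) :=
    mem_laplaceDom_of_le hα.1.2.1 (by simpa using hβ.le)
  set B := realLaplace (intensity P ξ) β with hB
  set v : Label → Fin p → ℝ≥0∞ := fun u j =>
    ∫⁻ ω, (if typeOf τ₀ ξ u ω = j then discount β (birthTime τ₀ ξ u ω) else 0) ∂P with hv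
  have hvsum : ∀ u, ∫⁻ ω, discount β (birthTime τ₀ ξ u ω) ∂P = ∑ j, v u j := by
    intro u
    rw [hv, ← lintegral_finsetSum]
    · simp
    · intro j _
      exact Measurable.ite (hξ.measurable_typeOf u (measurableSet_singleton j))
        ((measurable_discount β).comp (hξ.measurable_birthTime u)) measurable_const
  have hrec : ∀ u j, ∑' k : ℕ+, v (k :: u) j = ∑ i, v u i * (B i j : ℝ≥0) := by
    intro u j
    simp only [hv, hB, coe_realLaplace hβd]
    exact hξ.sum_children_discount β u j
  -- the discounted number of individuals of type `j` in generation `n`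
  set T : ℕ → Fin p → ℝ≥0∞ := fun n j => ∑' u : Label, if u.length = n then v u j else 0 with hT
  have hT0 : ∀ j, T 0 j = v [] j := by
    intro j
    rw [hT]
    simp only
    rw [tsum_eq_single []]
    · simp
    · intro u hu
      simp [hu]
  have hTsucc : ∀ n j, T (n + 1) j = ∑ i, T n i * (B i j : ℝ≥0) := by
    intro n j
    rw [hT]
    simp only
    rw [tsum_label]
    simp only [List.length_nil, List.length_cons, add_left_inj]
    simp only [← ENNReal.tsum_mul_right]
    rw [if_neg (by omega), zero_add, ← Summable.tsum_finsetSum (fun _ _ => ENNReal.summable)]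
    congr 1
    ext u
    by_cases h : u.length = n
    · simp [h, hrec]
    · simp [h]
  have hTn : ∀ n j, T n j = ∑ i, v [] i * ((B ^ n) i j : ℝ≥0) := by
    intro n
    induction n with
    | zero =>
      intro j
      rw [hT0, Finset.sum_eq_single j]
      · simp
      · intro i _ hi; simp [hi]
      · simp
    | succ n ih =>
      intro j
      rw [hTsucc]
      simp only [ih, pow_succ, Matrix.mul_apply, Finset.sum_mul, ENNReal.ofNNReal_finsetSum,
        Finset.mul_sum]
      rw [Finset.sum_comm]
      simp only [ENNReal.coe_mul, mul_assoc]
  simp only [hvsum]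
  rw [Summable.tsum_finsetSum (fun _ _ => ENNReal.summable)]
  refine ENNReal.sum_lt_top.2 fun j _ => ?_
  have h1 : ∑' u, v u j = ∑' n, T n j := by
    rw [hT, ENNReal.tsum_comm]
    congr 1
    ext u
    rw [tsum_eq_single u.length]
    · simp
    · intro n hn; simp [hn.symm]
  rw [h1]
  simp only [hTn]
  rw [Summable.tsum_finsetSum (fun _ _ => ENNReal.summable)]
  refine ENNReal.sum_lt_top.2 fun i _ => ?_
  rw [ENNReal.tsum_mul_left]
  refine ENNReal.mul_lt_top ?_ (tsum_pow_apply_lt_top (hα.spectralRadius_lt_one hβ) i j)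
  have : v [] i ≤ ∫⁻ _, 1 ∂P := by
    refine lintegral_mono fun ω => ?_
    split_ifs
    · simp [birthTime, discount]
    · simp
  exact this.trans_lt (by simp)

/-- An individual born up to time `t` contributes at least `e^{-(α + 1) t}` to a sum which is almost
surely finite. -/
theorem ae_finite_birthTime_le (hξ : IsReproduction P τ₀ ξ) {α : ℝ}
    (hα : IsMalthusian (intensity P ξ) α) (t : ℝ≥0) :
    ∀ᵐ ω ∂P, {u : Label | birthTime τ₀ ξ u ω ≤ t}.Finite := by
  have hβ : α < α + 1 := by linarith
  have hpos : 0 ≤ α + 1 := by linarith [hα.1.1]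
  have h := hξ.tsum_discount_lt_top hα hβ
  have hm : ∀ u, Measurable fun ω => discount (α + 1) (birthTime τ₀ ξ u ω) := fun u =>
    (measurable_discount _).comp (hξ.measurable_birthTime u)
  rw [← lintegral_tsum fun u => (hm u).aemeasurable] at h
  filter_upwards [ae_lt_top (Measurable.tsum hm) h.ne] with ω hω
  refine (ENNReal.finite_const_le_of_tsum_ne_top hω.ne
    (ε := ENNReal.ofReal (Real.exp (-(α + 1) * t))) (by simpa using Real.exp_pos _)).subset ?_
  intro u hu
  simp only [mem_ofPred_eq] at hu ⊢
  lift birthTime τ₀ ξ u ω to ℝ≥0 using (hu.trans_lt ENNReal.coe_lt_top).ne with x hx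
  rw [discount_coe]
  refine ENNReal.ofReal_le_ofReal (Real.exp_le_exp.2 ?_)
  have hxt : (x : ℝ) ≤ t := by exact_mod_cast hu
  have := mul_le_mul_of_nonneg_left hxt hpos
  linarith

end IsReproduction

end Discount

/-! ### The coefficient matrices of the resolvent -/

section Laurent

variable {p : ℕ} {μ : Fin p → Fin p → Measure ℝ≥0} {lam : ℂ}

/-- Only real parts matter for the domain, so that its interior is governed by the real line. -/
theorem re_mem_interior_integrableExpSet (hlam : lam ∈ interior (laplaceDom μ)) (i j : Fin p) :
    lam.re ∈ interior (integrableExpSet (fun s : ℝ≥0 => -(s : ℝ)) (μ i j)) := by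
  rw [mem_interior_iff_mem_nhds] at hlam ⊢
  have hc : Continuous fun x : ℝ => (x : ℂ) + lam.im * Complex.I := by fun_prop
  have hl : (lam.re : ℂ) + lam.im * Complex.I = lam := Complex.re_add_im lam
  have := hc.continuousAt.preimage_mem_nhds (x := lam.re) (by rw [hl]; exact hlam)
  filter_upwards [this] with x hx
  have h := hx i j
  simp only [Complex.add_re, Complex.ofReal_re, Complex.mul_re, Complex.I_re, mul_zero,
    Complex.ofReal_im, Complex.I_im, zero_mul, sub_self, add_zero] at h
  refine ⟨(by fun_prop : Measurable fun s : ℝ≥0 =>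
    Real.exp (x * -(s : ℝ))).aestronglyMeasurable, ?_⟩
  rw [hasFiniteIntegral_iff_ofReal (Eventually.of_forall fun s => (Real.exp_pos _).le)]
  simpa using h

/-- The value of the Laplace transform as a moment generating function. -/
theorem laplace_apply (z : ℂ) (i j : Fin p) :
    laplace μ z i j = complexMGF (fun s : ℝ≥0 => -(s : ℝ)) (μ i j) z := by
  simp [laplace, complexMGF]

theorem analyticAt_laplace (hlam : lam ∈ interior (laplaceDom μ)) (i j : Fin p) :
    AnalyticAt ℂ (fun z => laplace μ z i j) lam := by
  simp only [laplace_apply]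
  exact analyticAt_complexMGF (re_mem_interior_integrableExpSet hlam i j)

/-- The integral of `exp(lam, -s)` collects the Taylor coefficients of the Laplace transform. -/
theorem integral_expMatrix_neg (hlam : lam ∈ interior (laplaceDom μ)) (k : ℕ) (b c : Fin k)
    (i j : Fin p) :
    ∫ s, expMatrix k lam (-((s : ℝ≥0) : ℝ)) b c ∂(μ i j) = if b ≤ c then
      iteratedDeriv ((c : ℕ) - b) (fun z => laplace μ z i j) lam /
        (((c : ℕ) - (b : ℕ)).factorial : ℂ) else 0 := by
  simp only [expMatrix, Matrix.of_apply]
  split_ifs with h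
  · rw [integral_div]
    congr 1
    simp only [laplace_apply]
    rw [iteratedDeriv_complexMGF (re_mem_interior_integrableExpSet hlam i j)]
    congr 1
    ext s
    rw [mul_comm]
  · simp

theorem analyticAt_det {n : Type*} [Fintype n] [DecidableEq n] {A : ℂ → Matrix n n ℂ}
    (h : ∀ i j, AnalyticAt ℂ (fun z => A z i j) lam) : AnalyticAt ℂ (fun z => (A z).det) lam := by
  simp only [Matrix.det_apply']
  refine Finset.analyticAt_fun_sum _ fun σ _ => analyticAt_const.mul ?_
  exact Finset.analyticAt_fun_prod _ fun i _ => h _ _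

/-- Cramer's rule. It also holds where `1 - ℒμ(z)` is singular, both sides then being `0`. -/
theorem resolventEntry_eq (i j : Fin p) (z : ℂ) : resolventEntry μ i j z =
    (1 - laplace μ z).det⁻¹ * ((1 - laplace μ z).updateRow j (Pi.single i 1)).det := by
  rw [resolventEntry, Matrix.inv_def, Matrix.smul_apply, Matrix.adjugate_apply, smul_eq_mul,
    Ring.inverse_eq_inv']

theorem analyticAt_one_sub_laplace (hlam : lam ∈ interior (laplaceDom μ)) (i j : Fin p) :
    AnalyticAt ℂ (fun z => (1 - laplace μ z) i j) lam := by
  simp only [Matrix.sub_apply]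
  exact analyticAt_const.sub (analyticAt_laplace hlam i j)

theorem meromorphicAt_resolventEntry (hlam : lam ∈ interior (laplaceDom μ)) (i j : Fin p) :
    MeromorphicAt (resolventEntry μ i j) lam := by
  have h1 : AnalyticAt ℂ (fun z => (1 - laplace μ z).det) lam :=
    analyticAt_det (analyticAt_one_sub_laplace hlam)
  have h2 : AnalyticAt ℂ (fun z =>
      ((1 - laplace μ z).updateRow j (Pi.single i 1)).det) lam := by
    refine analyticAt_det fun a b => ?_
    simp only [Matrix.updateRow_apply]
    split_ifs
    · exact analyticAt_const
    · exact analyticAt_one_sub_laplace hlam a b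
  have h3 : resolventEntry μ i j = (fun z => (1 - laplace μ z).det)⁻¹ *
      fun z => ((1 - laplace μ z).updateRow j (Pi.single i 1)).det := by
    ext z
    exact resolventEntry_eq i j z
  rw [h3]
  exact h1.meromorphicAt.inv.mul h2.meromorphicAt

/-- After multiplication by `(z - lam)^k` the entries of the resolvent are analytic. -/
theorem exists_analyticAt_resolventEntry (hlam : lam ∈ interior (laplaceDom μ)) (i j : Fin p) :
    ∃ h : ℂ → ℂ, AnalyticAt ℂ h lam ∧ ∀ᶠ z in 𝓝[≠] lam,
      (z - lam) ^ poleOrder μ lam * resolventEntry μ i j z = h z := by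
  have hm := meromorphicAt_resolventEntry hlam i j
  have hle : (-(meromorphicOrderAt (resolventEntry μ i j) lam).untop₀).toNat ≤
      poleOrder μ lam := by
    have h := Finset.le_sup (f := fun ij : Fin p × Fin p =>
      (-(meromorphicOrderAt (resolventEntry μ ij.1 ij.2) lam).untop₀).toNat)
      (Finset.mem_univ (i, j))
    dsimp only at h
    exact h
  generalize poleOrder μ lam = k at hle ⊢
  by_cases htop : meromorphicOrderAt (resolventEntry μ i j) lam = ⊤
  · refine ⟨fun _ => 0, analyticAt_const, ?_⟩
    filter_upwards [meromorphicOrderAt_eq_top_iff.1 htop] with z hz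
    simp [hz]
  · obtain ⟨n, hn⟩ := WithTop.ne_top_iff_exists.1 htop
    obtain ⟨g, hg, -, hev⟩ := (meromorphicOrderAt_eq_int_iff hm).1 hn.symm
    rw [← hn, WithTop.untop₀_coe] at hle
    obtain ⟨m, hm⟩ : ∃ m : ℕ, (k : ℤ) + n = m := ⟨((k : ℤ) + n).toNat, by omega⟩
    refine ⟨fun z => (z - lam) ^ m * g z, by fun_prop, ?_⟩
    filter_upwards [hev, self_mem_nhdsWithin] with z hz hne
    have hne' : z - lam ≠ 0 := sub_ne_zero.2 hne
    rw [hz, smul_eq_mul, ← mul_assoc, ← zpow_natCast, ← zpow_natCast, ← zpow_add₀ hne', hm]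

/-- By Cauchy's formula, Laurent coefficients of `f` are Taylor coefficients of `(z - lam)^k f`. -/
theorem laurentCoeff_eq {f h : ℂ → ℂ} {k n : ℕ} (hn : 1 ≤ n) (hnk : n ≤ k)
    (hh : AnalyticAt ℂ h lam) (hf : ∀ᶠ z in 𝓝[≠] lam, (z - lam) ^ k * f z = h z) :
    laurentCoeff f lam n = iteratedDeriv (k - n) h lam / ((k - n).factorial : ℂ) := by
  refine Tendsto.limUnder_eq (tendsto_const_nhds.congr' ?_)
  obtain ⟨ε, hε, hball⟩ := Metric.eventually_nhds_iff_ball.1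
    (hh.eventually_analyticAt.and (eventually_nhdsWithin_iff.1 hf))
  filter_upwards [Ioo_mem_nhdsGT hε] with r ⟨hr0, hrε⟩
  have hsub : Metric.closedBall lam r ⊆ Metric.ball lam ε := Metric.closedBall_subset_ball hrε
  have hd : DiffContOnCl ℂ h (Metric.ball lam r) := by
    refine DifferentiableOn.diffContOnCl fun z hz => ?_
    have hz' := (hball z (hsub (Metric.closure_ball_subset_closedBall hz))).1
    exact hz'.differentiableAt.differentiableWithinAt
  have hcauchy := hd.circleIntegral_one_div_sub_center_pow_smul hr0 (k - n)
  have hcongr : (∮ z in C(lam, r), (z - lam) ^ (n - 1) * f z) =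
      ∮ z in C(lam, r), (1 / (z - lam) ^ (k - n + 1)) • h z := by
    refine circleIntegral.integral_congr hr0.le fun z hz => ?_
    have hne : z ≠ lam := by
      rintro rfl
      simp [hr0.ne] at hz
    have hne' : z - lam ≠ 0 := sub_ne_zero.2 hne
    have hz' := (hball z (hsub (Metric.sphere_subset_closedBall hz))).2 hne
    rw [← hz', smul_eq_mul, one_div, eq_inv_mul_iff_mul_eq₀ (pow_ne_zero _ hne'), ← mul_assoc,
      ← pow_add]
    congr 2
    omega
  rw [hcongr, hcauchy, smul_eq_mul]
  have hpi : (2 * Real.pi * Complex.I : ℂ) ≠ 0 := Complex.two_pi_I_ne_zero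
  field_simp

/-- If the determinant vanished identically, the junk values of the inverse would give pole order
`0`. -/
theorem eventually_det_ne_zero (hlam : lam ∈ interior (laplaceDom μ)) (hk : 0 < poleOrder μ lam) :
    ∀ᶠ z in 𝓝[≠] lam, (1 - laplace μ z).det ≠ 0 := by
  rcases (analyticAt_det (analyticAt_one_sub_laplace hlam)).eventually_eq_zero_or_eventually_ne_zero
    with h | h
  · exfalso
    have h0 : ∀ i j, meromorphicOrderAt (resolventEntry μ i j) lam = ⊤ := by
      intro i j
      rw [meromorphicOrderAt_eq_top_iff]
      filter_upwards [h.filter_mono nhdsWithin_le_nhds] with z hz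
      rw [resolventEntry_eq, hz, inv_zero, zero_mul]
    simp [poleOrder, h0] at hk
  · exact h

/-- The recursion of the coefficient matrices: comparing principal parts in
`(1 - ℒμ(z))⁻¹ = 1 + ℒμ(z) (1 - ℒμ(z))⁻¹` shows that the stacked matrix `A` satisfies
`∫ (exp(lam, -s) ⊗ μ(ds)) A = A`. -/
theorem sum_integral_expMatrix_mul_coeffStack (hlam : lam ∈ interior (laplaceDom μ))
    (b : Fin (poleOrder μ lam)) (i j : Fin p) :
    ∑ c, ∑ l, (∫ s, expMatrix (poleOrder μ lam) lam (-((s : ℝ≥0) : ℝ)) b c ∂(μ i l)) *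
      coeffStack μ lam (c, l) j = coeffStack μ lam (b, i) j := by
  have hdet := eventually_det_ne_zero hlam (Nat.zero_lt_of_lt b.2)
  choose h hh hev using fun i => exists_analyticAt_resolventEntry hlam i j
  have hA : ∀ (c : Fin (poleOrder μ lam)) l, coeffStack μ lam (c, l) j =
      iteratedDeriv (poleOrder μ lam - (c + 1)) (h l) lam /
        ((poleOrder μ lam - (c + 1)).factorial : ℂ) := by
    intro c l
    exact laurentCoeff_eq (by omega) (by omega) (hh l) (hev l)
  -- `h` is the `j`-th column of `(z - lam)^k (1 - ℒμ(z))⁻¹`, where `k = poleOrder μ lam`.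
  have hrec : h i =ᶠ[𝓝 lam] fun z =>
      (z - lam) ^ poleOrder μ lam * (1 : Matrix (Fin p) (Fin p) ℂ) i j +
        ∑ l, laplace μ z i l * h l z := by
    have han : AnalyticAt ℂ (fun z =>
        (z - lam) ^ poleOrder μ lam * (1 : Matrix (Fin p) (Fin p) ℂ) i j +
          ∑ l, laplace μ z i l * h l z) lam := by
      refine AnalyticAt.add (by fun_prop) (Finset.analyticAt_fun_sum _ fun l _ => ?_)
      exact (analyticAt_laplace hlam i l).mul (hh l)
    rw [← (hh i).continuousAt.eventuallyEq_nhds_iff_eventuallyEq_nhdsNE han.continuousAt]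
    filter_upwards [hdet, eventually_all.2 hev] with z hz hz2
    have h1 : (1 - laplace μ z) * (1 - laplace μ z)⁻¹ = 1 :=
      Matrix.mul_nonsing_inv _ (isUnit_iff_ne_zero.2 hz)
    rw [sub_mul, one_mul, sub_eq_iff_eq_add] at h1
    have h2 := congrFun (congrFun h1 i) j
    rw [Matrix.add_apply, Matrix.mul_apply] at h2
    rw [← hz2 i, resolventEntry, h2, mul_add, Finset.mul_sum]
    congr 1
    refine Finset.sum_congr rfl fun l _ => ?_
    rw [← hz2 l, resolventEntry]
    ring
  set m := poleOrder μ lam - (b + 1) with hm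
  have hmk : m < poleOrder μ lam := by omega
  -- Leibniz' rule; the derivatives of `(z - lam)^k` of order `m < k` vanish at `lam`.
  have hder : iteratedDeriv m (h i) lam = ∑ l, ∑ a ∈ Finset.range (m + 1),
      (m.choose a : ℂ) * iteratedDeriv a (fun z => laplace μ z i l) lam *
        iteratedDeriv (m - a) (h l) lam := by
    rw [hrec.iteratedDeriv_eq m]
    have hc1 : ∀ l, ContDiffAt ℂ m (fun z => laplace μ z i l) lam := fun l =>
      (analyticAt_laplace hlam i l).contDiffAt
    have hc2 : ∀ l, ContDiffAt ℂ m (h l) lam := fun l => (hh l).contDiffAt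
    rw [iteratedDeriv_fun_add (by fun_prop) (ContDiffAt.sum fun l _ => (hc1 l).mul (hc2 l)),
      iteratedDeriv_fun_sum (fun l _ => (hc1 l).mul (hc2 l))]
    rw [iteratedDeriv_mul_const_field,
      iteratedDeriv_comp_sub_const m (fun z => z ^ poleOrder μ lam) lam]
    simp only [iteratedDeriv_pow, sub_self]
    rw [zero_pow (by omega), mul_zero, zero_mul, zero_add]
    exact Finset.sum_congr rfl fun l _ => iteratedDeriv_fun_mul (hc1 l) (hc2 l)
  have hbi : coeffStack μ lam (b, i) j = ∑ l, ∑ a ∈ Finset.range (m + 1),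
      iteratedDeriv a (fun z => laplace μ z i l) lam / (a.factorial : ℂ) *
        (iteratedDeriv (m - a) (h l) lam / ((m - a).factorial : ℂ)) := by
    rw [hA, ← hm, hder, Finset.sum_div]
    refine Finset.sum_congr rfl fun l _ => ?_
    rw [Finset.sum_div]
    refine Finset.sum_congr rfl fun a ha => ?_
    have ha' : a ≤ m := Nat.lt_succ_iff.1 (Finset.mem_range.1 ha)
    rw [Nat.cast_choose ℂ ha']
    have f1 : (m.factorial : ℂ) ≠ 0 := Nat.cast_ne_zero.2 m.factorial_ne_zero
    have f2 : (a.factorial : ℂ) ≠ 0 := Nat.cast_ne_zero.2 a.factorial_ne_zero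
    have f3 : ((m - a).factorial : ℂ) ≠ 0 := Nat.cast_ne_zero.2 (m - a).factorial_ne_zero
    field_simp
  rw [hbi, Finset.sum_comm]
  refine Finset.sum_congr rfl fun l _ => ?_
  simp only [integral_expMatrix_neg hlam, hA, ite_mul, zero_mul]
  rw [← Finset.sum_filter]
  -- The minimum only serves to stay below `poleOrder μ lam` for irrelevant `a`.
  refine Finset.sum_nbij' (fun c => (c : ℕ) - b)
    (fun a => ⟨min (b + a) (poleOrder μ lam - 1), by omega⟩) ?_ ?_ ?_ ?_ ?_
  · intro c hc
    simp only [Finset.mem_filter, Finset.mem_univ, true_and, Fin.le_def] at hc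
    simp only [Finset.mem_range]
    omega
  · intro a ha
    simp only [Finset.mem_range] at ha
    simp only [Finset.mem_filter, Finset.mem_univ, true_and, Fin.le_def]
    omega
  · intro c hc
    simp only [Finset.mem_filter, Finset.mem_univ, true_and, Fin.le_def] at hc
    ext
    simp only
    omega
  · intro a ha
    simp only [Finset.mem_range] at ha
    simp only
    omega
  · intro c hc
    simp only [Finset.mem_filter, Finset.mem_univ, true_and, Fin.le_def] at hc
    have : m - ((c : ℕ) - b) = poleOrder μ lam - (c + 1) := by omega
    rw [this]

end Laurent

/-! ### An inequality of von Bahr and Esseen -/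

section VonBahrEsseen

/-- The complex conjugate of the gradient of `‖·‖ ^ q`. -/
def rpowGrad (q : ℝ) (a : ℂ) : ℂ := ((q * ‖a‖ ^ (q - 2) : ℝ) : ℂ) * (starRingEnd ℂ) a

theorem measurable_rpowGrad (q : ℝ) : Measurable (rpowGrad q) := by
  unfold rpowGrad
  refine Measurable.mul ?_ Complex.continuous_conj.measurable
  exact Complex.measurable_ofReal.comp ((measurable_norm.pow_const _).const_mul _)

variable {q : ℝ}

theorem norm_rpowGrad_le (hq1 : 1 < q) (hq2 : q ≤ 2) (a : ℂ) :
    ‖rpowGrad q a‖ ≤ 2 * (1 + ‖a‖ ^ q) := by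
  rcases eq_or_ne a 0 with rfl | ha
  · simp [rpowGrad]
    positivity
  have hX : 0 < ‖a‖ := norm_pos_iff.2 ha
  have h1 : ‖rpowGrad q a‖ = q * ‖a‖ ^ (q - 1) := by
    rw [rpowGrad, norm_mul, Complex.norm_real, RCLike.norm_conj,
      Real.norm_of_nonneg (by positivity), mul_assoc, ← Real.rpow_add_one hX.ne']
    congr 2
    ring
  have h2 : ‖a‖ ^ (q - 1) ≤ 1 + ‖a‖ ^ q := by
    rcases le_total ‖a‖ 1 with h | h
    · have := Real.rpow_le_one hX.le h (by linarith : 0 ≤ q - 1)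
      have := Real.rpow_nonneg hX.le q
      linarith
    · have := Real.rpow_le_rpow_of_exponent_le h (by linarith : q - 1 ≤ q)
      linarith
  rw [h1]
  have := Real.rpow_nonneg hX.le q
  exact mul_le_mul hq2 h2 (Real.rpow_nonneg hX.le _) (by norm_num)

/-- For `‖b‖ ≤ ‖a‖` this is concavity of `x ↦ x ^ (q / 2)`, applied to `‖a + b‖ ^ 2`. Otherwise
`‖a + b‖ ^ q ≤ 4 * ‖b‖ ^ q`, and the first order term is at least `-2 * ‖b‖ ^ q`. -/
theorem norm_add_rpow_le (hq1 : 1 < q) (hq2 : q ≤ 2) (a b : ℂ) :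
    ‖a + b‖ ^ q ≤ ‖a‖ ^ q + (rpowGrad q a * b).re + 6 * ‖b‖ ^ q := by
  rcases eq_or_ne a 0 with rfl | ha
  · have : 0 ≤ ‖b‖ ^ q := by positivity
    simp [rpowGrad, Real.zero_rpow (by linarith : q ≠ 0)]
    linarith
  have hX : 0 < ‖a‖ := norm_pos_iff.2 ha
  set R := ((starRingEnd ℂ) a * b).re with hR
  have hgrad : (rpowGrad q a * b).re = q * ‖a‖ ^ (q - 2) * R := by
    rw [rpowGrad, mul_assoc, Complex.re_ofReal_mul]
  have hsq : ‖a + b‖ ^ 2 = ‖a‖ ^ 2 + 2 * R + ‖b‖ ^ 2 := by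
    rw [← Complex.normSq_eq_norm_sq, ← Complex.normSq_eq_norm_sq, ← Complex.normSq_eq_norm_sq,
      Complex.normSq_add, hR]
    simp only [Complex.mul_re, Complex.conj_re, Complex.conj_im]
    ring
  have hRle : |R| ≤ ‖a‖ * ‖b‖ := by
    refine (Complex.abs_re_le_norm _).trans ?_
    rw [norm_mul, RCLike.norm_conj]
  have hXq : ‖a‖ ^ (q - 2) * ‖a‖ ^ 2 = ‖a‖ ^ q := by
    rw [← Real.rpow_natCast, ← Real.rpow_add hX]
    congr 1; push_cast; ring
  have hYnn : 0 ≤ ‖b‖ ^ q := by positivity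
  have hYq : ‖b‖ ≠ 0 → ‖b‖ ^ (q - 2) * ‖b‖ ^ 2 = ‖b‖ ^ q := by
    intro hb
    rw [← Real.rpow_natCast, ← Real.rpow_add (lt_of_le_of_ne (norm_nonneg _) hb.symm)]
    congr 1; push_cast; ring
  rw [hgrad]
  rcases le_or_gt ‖b‖ ‖a‖ with hab | hab
  · set s := (2 * R + ‖b‖ ^ 2) / ‖a‖ ^ 2 with hs
    have hs1 : ‖a + b‖ ^ 2 = ‖a‖ ^ 2 * (1 + s) := by
      rw [hsq, hs]
      field_simp
      ring
    have hs0 : 0 ≤ 1 + s := by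
      by_contra! h
      have : ‖a‖ ^ 2 * (1 + s) < 0 := mul_neg_of_pos_of_neg (by positivity) h
      rw [← hs1] at this
      exact absurd this (not_lt.2 (by positivity))
    have h1 : ‖a + b‖ ^ q = ‖a‖ ^ q * (1 + s) ^ (q / 2) := by
      have e : ∀ y : ℝ, 0 ≤ y → y ^ q = (y ^ 2) ^ (q / 2) := by
        intro y hy
        rw [← Real.rpow_natCast, ← Real.rpow_mul hy]
        congr 1; push_cast; ring
      rw [e _ (norm_nonneg (a + b)), hs1, Real.mul_rpow (by positivity) hs0, ← e _ hX.le]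
    have h2 : (1 + s) ^ (q / 2) ≤ 1 + q / 2 * s :=
      _root_.rpow_one_add_le_one_add_mul_self (by linarith) (by linarith) (by linarith)
    have h3 : ‖a‖ ^ q * s = ‖a‖ ^ (q - 2) * (2 * R + ‖b‖ ^ 2) := by
      rw [← hXq, hs]
      field_simp
    have h4 : ‖a‖ ^ (q - 2) * ‖b‖ ^ 2 ≤ ‖b‖ ^ q := by
      rcases eq_or_ne ‖b‖ 0 with hb | hb
      · rw [hb] at hYnn ⊢
        simpa using hYnn
      · rw [← hYq hb]
        refine mul_le_mul_of_nonneg_right ?_ (by positivity)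
        exact Real.rpow_le_rpow_of_nonpos (lt_of_le_of_ne (norm_nonneg _) hb.symm) hab (by linarith)
    have h4' : 0 ≤ ‖a‖ ^ (q - 2) * ‖b‖ ^ 2 := by positivity
    calc ‖a + b‖ ^ q ≤ ‖a‖ ^ q * (1 + q / 2 * s) := by
          rw [h1]; exact mul_le_mul_of_nonneg_left h2 (by positivity)
      _ = ‖a‖ ^ q + q / 2 * (‖a‖ ^ q * s) := by ring
      _ = ‖a‖ ^ q + q * ‖a‖ ^ (q - 2) * R + q / 2 * (‖a‖ ^ (q - 2) * ‖b‖ ^ 2) := by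
          rw [h3]; ring
      _ ≤ ‖a‖ ^ q + q * ‖a‖ ^ (q - 2) * R + 6 * ‖b‖ ^ q := by
          have : q / 2 * (‖a‖ ^ (q - 2) * ‖b‖ ^ 2) ≤ 1 * (‖a‖ ^ (q - 2) * ‖b‖ ^ 2) :=
            mul_le_mul_of_nonneg_right (by linarith) h4'
          linarith
  · have hY : 0 < ‖b‖ := hX.trans hab
    have h1 : ‖a + b‖ ^ q ≤ 4 * ‖b‖ ^ q := by
      calc ‖a + b‖ ^ q ≤ (2 * ‖b‖) ^ q :=
            Real.rpow_le_rpow (norm_nonneg _) (by linarith [norm_add_le a b]) (by linarith)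
        _ = 2 ^ q * ‖b‖ ^ q := Real.mul_rpow (by norm_num) hY.le
        _ ≤ 4 * ‖b‖ ^ q := by
            refine mul_le_mul_of_nonneg_right ?_ hYnn
            calc (2 : ℝ) ^ q ≤ 2 ^ (2 : ℝ) :=
                  Real.rpow_le_rpow_of_exponent_le (by norm_num) hq2
              _ = 4 := by norm_num
    have h2 : ‖a‖ ^ (q - 2) * (‖a‖ * ‖b‖) ≤ ‖b‖ ^ q := by
      calc ‖a‖ ^ (q - 2) * (‖a‖ * ‖b‖) = ‖a‖ ^ (q - 1) * ‖b‖ := by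
            rw [← mul_assoc, ← Real.rpow_add_one hX.ne']
            congr 2; ring
        _ ≤ ‖b‖ ^ (q - 1) * ‖b‖ := by
            refine mul_le_mul_of_nonneg_right ?_ hY.le
            exact Real.rpow_le_rpow hX.le hab.le (by linarith)
        _ = ‖b‖ ^ q := by
            rw [← Real.rpow_add_one hY.ne']
            congr 1; ring
    have h3 : -(2 * ‖b‖ ^ q) ≤ q * ‖a‖ ^ (q - 2) * R := by
      have hc : 0 ≤ q * ‖a‖ ^ (q - 2) := by positivity
      have h5 : -(q * ‖a‖ ^ (q - 2) * (‖a‖ * ‖b‖)) ≤ q * ‖a‖ ^ (q - 2) * R := by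
        rw [← mul_neg]
        exact mul_le_mul_of_nonneg_left (neg_le_of_abs_le hRle) hc
      have h6 : q * (‖a‖ ^ (q - 2) * (‖a‖ * ‖b‖)) ≤ 2 * ‖b‖ ^ q :=
        mul_le_mul hq2 h2 (by positivity) (by norm_num)
      linarith
    have : 0 ≤ ‖a‖ ^ q := by positivity
    linarith

variable {Ω : Type*} {𝒢 ℋ : MeasurableSpace Ω} {mΩ : MeasurableSpace Ω} {P : Measure Ω}

theorem integral_mul_eq_zero_of_indep (hind : Indep 𝒢 ℋ P)
    {f m : Ω → ℂ} (hf : Measurable[𝒢] f) (hm : Measurable[ℋ] m) (hfi : Integrable f P)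
    (hmi : Integrable m P) (hm0 : ∫ ω, m ω ∂P = 0) :
    Integrable (fun ω => f ω * m ω) P ∧ ∫ ω, f ω * m ω ∂P = 0 := by
  have hfm : IndepFun f m P := by
    rw [IndepFun_iff_Indep]
    exact indep_of_indep_of_le hind hf.comap_le hm.comap_le
  refine ⟨hfm.integrable_mul hfi hmi, ?_⟩
  rw [hfm.integral_fun_mul_eq_mul_integral hfi.1 hmi.1, hm0, mul_zero]

variable {ι : Type*} [Fintype ι]

theorem memLp_sum_mul (h𝒢 : 𝒢 ≤ mΩ) (hℋ : ℋ ≤ mΩ) {r : ℝ≥0∞}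
    {c m : ι → Ω → ℂ} (hc : ∀ i, Measurable[𝒢] (c i)) {K : ℝ} (hK : ∀ i ω, ‖c i ω‖ ≤ K)
    (hm : ∀ i, Measurable[ℋ] (m i)) (hmq : ∀ i, MemLp (m i) r P) :
    MemLp (fun ω => ∑ i, c i ω * m i ω) r P := by
  refine memLp_finsetSum _ fun i _ => (hmq i).of_le_mul (c := K) ?_ ?_
  · exact (((hc i).mono h𝒢 le_rfl).mul ((hm i).mono hℋ le_rfl)).aestronglyMeasurable
  · refine Eventually.of_forall fun ω => ?_
    rw [norm_mul]
    exact mul_le_mul_of_nonneg_right (hK i ω) (norm_nonneg _)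

variable [IsProbabilityMeasure P]

/-- One step of the von Bahr–Esseen inequality: the first order term vanishes in mean, since the
variables `m i` are centred and independent of `𝒢`. -/
theorem integral_norm_add_rpow_le (hq1 : 1 < q) (hq2 : q ≤ 2)
    (h𝒢 : 𝒢 ≤ mΩ) (hℋ : ℋ ≤ mΩ) (hind : Indep 𝒢 ℋ P) {x : Ω → ℂ} (hx : Measurable[𝒢] x)
    (hxq : MemLp x (ENNReal.ofReal q) P) {c m : ι → Ω → ℂ} (hc : ∀ i, Measurable[𝒢] (c i)) {K : ℝ}
    (hK : ∀ i ω, ‖c i ω‖ ≤ K) (hm : ∀ i, Measurable[ℋ] (m i))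
    (hmq : ∀ i, MemLp (m i) (ENNReal.ofReal q) P) (hm0 : ∀ i, ∫ ω, m i ω ∂P = 0) :
    ∫ ω, ‖x ω + ∑ i, c i ω * m i ω‖ ^ q ∂P ≤
      ∫ ω, ‖x ω‖ ^ q ∂P + 6 * ∫ ω, ‖∑ i, c i ω * m i ω‖ ^ q ∂P := by
  have hq0 : ENNReal.ofReal q ≠ 0 := by simp; linarith
  have hqr : (ENNReal.ofReal q).toReal = q := ENNReal.toReal_ofReal (by linarith)
  have hint : ∀ {f : Ω → ℂ}, MemLp f (ENNReal.ofReal q) P → Integrable (fun ω => ‖f ω‖ ^ q) P := by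
    intro f hf
    have := hf.integrable_norm_rpow hq0 ENNReal.ofReal_ne_top
    rwa [hqr] at this
  have hy := memLp_sum_mul h𝒢 hℋ hc hK hm hmq
  set y : Ω → ℂ := fun ω => ∑ i, c i ω * m i ω with hydef
  have hone : (1 : ℝ≥0∞) ≤ ENNReal.ofReal q := by
    rw [ENNReal.one_le_ofReal]; exact hq1.le
  have hgi : Integrable (fun ω => rpowGrad q (x ω)) P := by
    refine Integrable.mono' (((integrable_const (1 : ℝ)).add (hint hxq)).const_mul 2)
      ((measurable_rpowGrad q).comp (hx.mono h𝒢 le_rfl)).aestronglyMeasurable ?_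
    exact Eventually.of_forall fun ω => norm_rpowGrad_le hq1 hq2 (x ω)
  have hterm : ∀ i, Integrable (fun ω => (rpowGrad q (x ω) * c i ω) * m i ω) P ∧
      ∫ ω, (rpowGrad q (x ω) * c i ω) * m i ω ∂P = 0 := by
    intro i
    refine integral_mul_eq_zero_of_indep hind
      (Measurable.mul ((measurable_rpowGrad q).comp hx) (hc i)) (hm i) ?_
      ((hmq i).integrable hone) (hm0 i)
    exact hgi.mul_bdd ((hc i).mono h𝒢 le_rfl).aestronglyMeasurable
      (Eventually.of_forall fun ω => hK i ω)
  have heq : (fun ω => rpowGrad q (x ω) * y ω) =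
      fun ω => ∑ i, (rpowGrad q (x ω) * c i ω) * m i ω := by
    ext ω
    simp only [hydef, Finset.mul_sum, mul_assoc]
  have hgy : Integrable (fun ω => rpowGrad q (x ω) * y ω) P := by
    rw [heq]
    exact integrable_finsetSum _ fun i _ => (hterm i).1
  have hgy0 : ∫ ω, (rpowGrad q (x ω) * y ω).re ∂P = 0 := by
    have h := integral_re hgy
    simp only [RCLike.re_to_complex] at h
    rw [h, heq, integral_finsetSum _ fun i _ => (hterm i).1]
    simp [(hterm _).2]
  have hre : Integrable (fun ω => (rpowGrad q (x ω) * y ω).re) P := hgy.re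
  have hxi := hint hxq
  have hyi := hint hy
  calc ∫ ω, ‖x ω + y ω‖ ^ q ∂P
      ≤ ∫ ω, (‖x ω‖ ^ q + (rpowGrad q (x ω) * y ω).re + 6 * ‖y ω‖ ^ q) ∂P := by
        refine integral_mono (hint (hxq.add hy)) ((hxi.add hre).add (hyi.const_mul 6)) fun ω => ?_
        exact norm_add_rpow_le hq1 hq2 (x ω) (y ω)
    _ = ∫ ω, ‖x ω‖ ^ q ∂P + 6 * ∫ ω, ‖y ω‖ ^ q ∂P := by
        rw [integral_add (f := fun ω => ‖x ω‖ ^ q + (rpowGrad q (x ω) * y ω).re)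
          (hxi.add hre) (hyi.const_mul 6), integral_add hxi hre, integral_const_mul, hgy0,
          add_zero]

end VonBahrEsseen

/-! ### The matrix exponential -/

section ExpMatrix

variable {k : ℕ} {lam : ℂ}

theorem expMatrix_zero : expMatrix k lam 0 = 1 := by
  ext a b
  rw [expMatrix, Matrix.of_apply]
  rcases lt_trichotomy a b with h | rfl | h
  · have : (b : ℕ) - a ≠ 0 := by
      have := Fin.lt_def.1 h
      omega
    simp [h.le, Matrix.one_apply_ne h.ne, this]
  · simp
  · simp [not_le.2 h, Matrix.one_apply_ne h.ne']

/-- The binomial theorem. -/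
theorem expMatrix_add (x y : ℝ) :
    expMatrix k lam (x + y) = expMatrix k lam x * expMatrix k lam y := by
  ext a c
  rw [Matrix.mul_apply]
  simp only [expMatrix, Matrix.of_apply]
  by_cases hac : a ≤ c
  swap
  · rw [if_neg hac, eq_comm]
    refine Finset.sum_eq_zero fun b _ => ?_
    by_cases hab : a ≤ b
    · have : ¬ b ≤ c := fun h => hac (hab.trans h)
      simp [this]
    · simp [hab]
  rw [if_pos hac, Complex.ofReal_add, add_pow, Finset.mul_sum, Finset.sum_div]
  have hprod : ∀ b : Fin k, (if a ≤ b then Complex.exp (lam * x) * (x : ℂ) ^ ((b : ℕ) - a) /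
      (((b : ℕ) - (a : ℕ)).factorial : ℂ) else 0) * (if b ≤ c then Complex.exp (lam * y) *
      (y : ℂ) ^ ((c : ℕ) - b) / (((c : ℕ) - (b : ℕ)).factorial : ℂ) else 0) =
      if a ≤ b ∧ b ≤ c then Complex.exp (lam * x) * (x : ℂ) ^ ((b : ℕ) - a) /
      (((b : ℕ) - (a : ℕ)).factorial : ℂ) * (Complex.exp (lam * y) *
      (y : ℂ) ^ ((c : ℕ) - b) / (((c : ℕ) - (b : ℕ)).factorial : ℂ)) else 0 := by
    intro b
    by_cases h1 : a ≤ b <;> by_cases h2 : b ≤ c <;> simp [h1, h2]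
  simp only [hprod]
  rw [← Finset.sum_filter]
  have hac' := Fin.le_def.1 hac
  symm
  -- The minimum only serves to stay below `k` for irrelevant `n`.
  refine Finset.sum_nbij' (fun b => (b : ℕ) - a) (fun n => ⟨min (a + n) (k - 1), by omega⟩)
    ?_ ?_ ?_ ?_ ?_
  · intro b hb
    simp only [Finset.mem_filter, Finset.mem_univ, true_and, Fin.le_def] at hb
    simp only [Finset.mem_range]
    omega
  · intro n hn
    simp only [Finset.mem_range] at hn
    simp only [Finset.mem_filter, Finset.mem_univ, true_and, Fin.le_def]
    omega
  · intro b hb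
    simp only [Finset.mem_filter, Finset.mem_univ, true_and, Fin.le_def] at hb
    ext
    simp only
    omega
  · intro n hn
    simp only [Finset.mem_range] at hn
    simp only
    omega
  · intro b hb
    simp only [Finset.mem_filter, Finset.mem_univ, true_and, Fin.le_def] at hb
    have e1 : (c : ℕ) - a - (b - a) = c - b := by omega
    rw [e1, Nat.cast_choose ℂ (by omega : (b : ℕ) - a ≤ c - a), e1, mul_add, Complex.exp_add]
    have f1 : (((c : ℕ) - a).factorial : ℂ) ≠ 0 := Nat.cast_ne_zero.2 (Nat.factorial_ne_zero _)
    have f2 : (((b : ℕ) - a).factorial : ℂ) ≠ 0 := Nat.cast_ne_zero.2 (Nat.factorial_ne_zero _)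
    have f3 : (((c : ℕ) - b).factorial : ℂ) ≠ 0 := Nat.cast_ne_zero.2 (Nat.factorial_ne_zero _)
    field_simp

theorem measurable_expMatrix (a b : Fin k) : Measurable fun x : ℝ => expMatrix k lam x a b := by
  simp only [expMatrix, Matrix.of_apply]
  split_ifs <;> fun_prop

theorem norm_expMatrix_neg_le (a b : Fin k) {x : ℝ} (hx : 0 ≤ x) :
    ‖expMatrix k lam (-x) a b‖ ≤
      x ^ ((b : ℕ) - a) / (((b : ℕ) - (a : ℕ)).factorial : ℝ) * Real.exp (-lam.re * x) := by
  simp only [expMatrix, Matrix.of_apply]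
  split_ifs with h
  · rw [norm_div, norm_mul, Complex.norm_exp, norm_pow, Complex.norm_natCast, Complex.norm_real,
      norm_neg, Real.norm_of_nonneg hx]
    have : (lam * ((-x : ℝ) : ℂ)).re = -lam.re * x := by
      rw [mul_comm, Complex.re_ofReal_mul]; ring
    rw [this]
    exact (by ring : Real.exp (-lam.re * x) * x ^ ((b : ℕ) - a) /
      (((b : ℕ) - (a : ℕ)).factorial : ℝ) = _).le
  · simp only [norm_zero]
    positivity

theorem norm_expMatrix_neg_le_weight (a b : Fin k) {x : ℝ} (hx : 0 ≤ x) :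
    ‖expMatrix k lam (-x) a b‖ ≤ (1 + x ^ (k - 1)) * Real.exp (-lam.re * x) := by
  refine (norm_expMatrix_neg_le a b hx).trans ?_
  refine mul_le_mul_of_nonneg_right ?_ (Real.exp_pos _).le
  have h1 : x ^ ((b : ℕ) - a) / (((b : ℕ) - (a : ℕ)).factorial : ℝ) ≤ x ^ ((b : ℕ) - a) :=
    div_le_self (by positivity)
      (by exact_mod_cast Nat.one_le_iff_ne_zero.2 (Nat.factorial_ne_zero _))
  refine h1.trans ?_
  rcases le_total x 1 with h | h
  · have := pow_le_one₀ hx h (n := (b : ℕ) - a)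
    have : 0 ≤ x ^ (k - 1) := by positivity
    linarith
  · have := pow_le_pow_right₀ h (by omega : (b : ℕ) - a ≤ k - 1)
    linarith

theorem norm_expMatrix_neg_le_exp (a b : Fin k) {δ : ℝ} (hδ : δ < lam.re) {x : ℝ} (hx : 0 ≤ x) :
    ‖expMatrix k lam (-x) a b‖ ≤ (max 1 (lam.re - δ)⁻¹) ^ k * Real.exp (-δ * x) := by
  refine (norm_expMatrix_neg_le a b hx).trans ?_
  set c := lam.re - δ with hc
  have hc0 : 0 < c := by linarith
  set n := (b : ℕ) - a with hn
  have h1 : (c * x) ^ n / (n.factorial : ℝ) ≤ Real.exp (c * x) :=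
    Real.pow_div_factorial_le_exp _ (by positivity) n
  have h2 : x ^ n / (n.factorial : ℝ) = c⁻¹ ^ n * ((c * x) ^ n / (n.factorial : ℝ)) := by
    rw [mul_pow, inv_pow]
    field_simp
  have h3 : c⁻¹ ^ n ≤ (max 1 c⁻¹) ^ k :=
    (pow_le_pow_left₀ (by positivity) (le_max_right _ _) n).trans
      (pow_le_pow_right₀ (le_max_left _ _) (by omega))
  have h4 : Real.exp (-δ * x) = Real.exp (c * x) * Real.exp (-lam.re * x) := by
    rw [← Real.exp_add]; congr 1; rw [hc]; ring
  rw [h2, h4, mul_assoc, ← mul_assoc (max 1 c⁻¹ ^ k)]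
  rw [← mul_assoc]
  refine mul_le_mul_of_nonneg_right ?_ (Real.exp_pos _).le
  exact mul_le_mul h3 h1 (by positivity) (by positivity)

end ExpMatrix

/-! ### Innovations -/

section Innovation

variable {p k : ℕ}

/-- The entry `((b, i), j)` of `(∫ exp(lam, -s) ⊗ m(ds)) A - A`, for the offspring matrix `m` of an
individual: the value of its children, discounted to its own birth, minus the value of the
individual itself, if its type is `i`. -/
def innovation (lam : ℂ) (A : Matrix (Fin k × Fin p) (Fin p) ℂ)
    (m : Fin p → Fin p → Measure ℝ≥0) (b : Fin k) (i j : Fin p) : ℂ :=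
  ∑ c, ∑ l, (∫ s, expMatrix k lam (-((s : ℝ≥0) : ℝ)) b c ∂(m i l)) * A (c, l) j - A (b, i) j

theorem measurable_integral_entry {f : ℝ≥0 → ℂ} (hf : Measurable f) (i l : Fin p) :
    Measurable fun m : Fin p → Fin p → Measure ℝ≥0 => ∫ s, f s ∂(m i l) := by
  have h : Measurable fun ν : Measure ℝ≥0 => ∫ s, f s ∂ν :=
    (StronglyMeasurable.integral_kernel (κ := pointKernel id measurable_id)
      hf.stronglyMeasurable).measurable
  exact h.comp ((measurable_pi_apply l).comp (measurable_pi_apply i))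

theorem measurable_expMatrix_neg (lam : ℂ) (b c : Fin k) :
    Measurable fun s : ℝ≥0 => expMatrix k lam (-(s : ℝ)) b c :=
  (measurable_expMatrix b c).comp (by fun_prop)

theorem measurable_innovation (lam : ℂ) (A : Matrix (Fin k × Fin p) (Fin p) ℂ) (b : Fin k)
    (i j : Fin p) : Measurable fun m => innovation lam A m b i j := by
  unfold innovation
  refine Measurable.sub_const ?_ _
  refine Finset.measurable_sum _ fun c _ => Finset.measurable_sum _ fun l _ => ?_
  exact (measurable_integral_entry (measurable_expMatrix_neg lam b c) i l).mul_const _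

/-- The weight `(1 + s ^ (k - 1)) e^{-θ s}` of the moment condition. -/
def weight (k : ℕ) (θ : ℝ) (s : ℝ≥0) : ℝ := (1 + (s : ℝ) ^ (k - 1)) * Real.exp (-θ * (s : ℝ))

theorem measurable_weight (k : ℕ) (θ : ℝ) : Measurable (weight k θ) := by
  unfold weight; fun_prop

theorem weight_nonneg (k : ℕ) (θ : ℝ) (s : ℝ≥0) : 0 ≤ weight k θ s := by
  unfold weight; positivity

theorem integrable_expMatrix_neg {lam : ℂ} {ν : Measure ℝ≥0} (h : Integrable (weight k lam.re) ν)
    (b c : Fin k) : Integrable (fun s : ℝ≥0 => expMatrix k lam (-(s : ℝ)) b c) ν :=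
  h.mono' (measurable_expMatrix_neg lam b c).aestronglyMeasurable
    (Eventually.of_forall fun s => norm_expMatrix_neg_le_weight b c s.coe_nonneg)

theorem norm_entry_le_l2_opNorm {m n 𝕜 : Type*} [Fintype m] [Fintype n] [DecidableEq n] [RCLike 𝕜]
    (B : Matrix m n 𝕜) (i : m) (j : n) : ‖B i j‖ ≤ ‖B‖ := by
  have h := Matrix.l2_opNorm_mulVec B (EuclideanSpace.single j (1 : 𝕜))
  rw [PiLp.norm_single, norm_one, mul_one] at h
  refine le_trans ?_ h
  refine le_trans (le_of_eq ?_) (PiLp.norm_apply_le _ i)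
  simp

theorem norm_integral_expMatrix_neg_le {lam : ℂ} {m : Fin p → Fin p → Measure ℝ≥0} {i l : Fin p}
    (h : Integrable (weight k lam.re) (m i l)) (b c : Fin k) :
    ‖∫ s, expMatrix k lam (-((s : ℝ≥0) : ℝ)) b c ∂(m i l)‖ ≤ ‖weightedMass k lam.re m‖ := by
  calc ‖∫ s, expMatrix k lam (-((s : ℝ≥0) : ℝ)) b c ∂(m i l)‖
      ≤ ∫ s, weight k lam.re s ∂(m i l) := norm_integral_le_of_norm_le h
        (Eventually.of_forall fun s => norm_expMatrix_neg_le_weight b c s.coe_nonneg)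
    _ = weightedMass k lam.re m i l := rfl
    _ ≤ ‖weightedMass k lam.re m i l‖ := Real.le_norm_self _
    _ ≤ ‖weightedMass k lam.re m‖ := norm_entry_le_l2_opNorm _ _ _

theorem integrable_weight {μ : Fin p → Fin p → Measure ℝ≥0} {lam : ℂ}
    (hlam : lam ∈ interior (laplaceDom μ)) (i l : Fin p) :
    Integrable (weight k lam.re) (μ i l) := by
  have h := fun n : ℕ => integrable_pow_abs_mul_exp_of_mem_interior_integrableExpSet
    (re_mem_interior_integrableExpSet hlam i l) n
  convert! (h 0).add (h (k - 1)) using 1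
  ext s
  simp only [weight, Pi.add_apply, abs_neg, NNReal.abs_eq, pow_zero, one_mul]
  rw [mul_neg, neg_mul]
  ring

variable {Ω : Type*} [mΩ : MeasurableSpace Ω] {P : Measure Ω} {τ₀ : Ω → Fin p}
  {ξ : Label → Ω → Fin p → Fin p → Measure ℝ≥0} {lam : ℂ}
  {A : Matrix (Fin k × Fin p) (Fin p) ℂ} {q : ℝ}

namespace IsReproduction

theorem ae_integrable_weight (hξ : IsReproduction P τ₀ ξ)
    (hlam : lam ∈ interior (laplaceDom (intensity P ξ))) :
    ∀ᵐ ω ∂P, ∀ u i l, Integrable (weight k lam.re) (ξ u ω i l) := by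
  rw [ae_all_iff]; intro u
  rw [ae_all_iff]; intro i
  rw [ae_all_iff]; intro l
  have hm : Measurable fun s => ENNReal.ofReal (weight k lam.re s) :=
    (measurable_weight k lam.re).ennreal_ofReal
  have h := (integrable_weight (k := k) hlam i l).2
  rw [hasFiniteIntegral_iff_ofReal (Eventually.of_forall (weight_nonneg k lam.re)),
    ← hξ.lintegral_lintegral u i l hm] at h
  have hmeas : Measurable fun ω => ∫⁻ s, ENNReal.ofReal (weight k lam.re s) ∂(ξ u ω i l) :=
    (Measure.measurable_lintegral hm).comp (hξ.measurable_entry u i l)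
  filter_upwards [ae_lt_top hmeas h.ne] with ω hω
  refine ⟨(measurable_weight k lam.re).aestronglyMeasurable, ?_⟩
  rwa [hasFiniteIntegral_iff_ofReal (Eventually.of_forall (weight_nonneg k lam.re))]

/-- Campbell's formula for integrable functions. -/
theorem integral_integral (hξ : IsReproduction P τ₀ ξ) (i l : Fin p) {f : ℝ≥0 → ℂ}
    (hf : Integrable f (intensity P ξ i l)) :
    ∫ ω, ∫ s, f s ∂(ξ [] ω i l) ∂P = ∫ s, f s ∂(intensity P ξ i l) := by
  have h : intensity P ξ i l = (pointKernel _ (hξ.measurable_entry [] i l)) ∘ₘ P := rfl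
  rw [h, Measure.comp_eq_comp_const_apply] at hf ⊢
  exact (Kernel.integral_comp hf).symm

theorem memLp_integral_expMatrix (hξ : IsReproduction P τ₀ ξ)
    (hlam : lam ∈ interior (laplaceDom (intensity P ξ))) (hq : 1 < q)
    (hA3 : ∫⁻ ω, ‖weightedMass k lam.re (ξ [] ω)‖ₑ ^ q ∂P < ∞) (b c : Fin k) (i l : Fin p) :
    MemLp (fun ω => ∫ s, expMatrix k lam (-((s : ℝ≥0) : ℝ)) b c ∂(ξ [] ω i l))
      (ENNReal.ofReal q) P := by
  refine ⟨((measurable_integral_entry (measurable_expMatrix_neg lam b c) i l).comp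
    (hξ.measurable_offspring [])).aestronglyMeasurable, ?_⟩
  rw [eLpNorm_lt_top_iff_lintegral_rpow_enorm_lt_top (by simp; linarith) ENNReal.ofReal_ne_top,
    ENNReal.toReal_ofReal (by linarith)]
  refine lt_of_le_of_lt (lintegral_mono_ae ?_) hA3
  filter_upwards [hξ.ae_integrable_weight (k := k) hlam] with ω hω
  refine ENNReal.rpow_le_rpow ?_ (by linarith)
  rw [enorm_le_iff_norm_le]
  exact norm_integral_expMatrix_neg_le (hω [] i l) b c

variable [IsProbabilityMeasure P]

theorem memLp_innovation (hξ : IsReproduction P τ₀ ξ)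
    (hlam : lam ∈ interior (laplaceDom (intensity P ξ))) (hq : 1 < q)
    (hA3 : ∫⁻ ω, ‖weightedMass k lam.re (ξ [] ω)‖ₑ ^ q ∂P < ∞) (u : Label) (b : Fin k)
    (i j : Fin p) :
    MemLp (fun ω => innovation lam A (ξ u ω) b i j) (ENNReal.ofReal q) P := by
  have hid := (hξ.identDistrib u).comp (measurable_innovation lam A b i j)
  refine hid.memLp_iff.2 (MemLp.sub ?_ (memLp_const _))
  refine memLp_finsetSum _ fun c _ => memLp_finsetSum _ fun l _ => ?_
  exact (hξ.memLp_integral_expMatrix hlam hq hA3 b c i l).mul_const _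

/-- Innovations are centred if `A` satisfies `∫ (exp(lam, -s) ⊗ μ(ds)) A = A`. -/
theorem integral_innovation (hξ : IsReproduction P τ₀ ξ)
    (hlam : lam ∈ interior (laplaceDom (intensity P ξ))) (hq : 1 < q)
    (hA3 : ∫⁻ ω, ‖weightedMass k lam.re (ξ [] ω)‖ₑ ^ q ∂P < ∞)
    (hA : ∀ b i j, ∑ c, ∑ l, (∫ s, expMatrix k lam (-((s : ℝ≥0) : ℝ)) b c
      ∂(intensity P ξ i l)) * A (c, l) j = A (b, i) j) (u : Label) (b : Fin k) (i j : Fin p) :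
    ∫ ω, innovation lam A (ξ u ω) b i j ∂P = 0 := by
  have hid := (hξ.identDistrib u).comp (measurable_innovation lam A b i j)
  refine hid.integral_eq.trans ?_
  simp only [Function.comp_def, innovation]
  have hint : ∀ c l, Integrable
      (fun ω => ∫ s, expMatrix k lam (-((s : ℝ≥0) : ℝ)) b c ∂(ξ [] ω i l)) P := fun c l =>
    (hξ.memLp_integral_expMatrix hlam hq hA3 b c i l).integrable
      (by rw [ENNReal.one_le_ofReal]; exact hq.le)
  rw [integral_sub (integrable_finsetSum _ fun c _ => integrable_finsetSum _ fun l _ =>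
    (hint c l).mul_const _) (integrable_const _), integral_finsetSum _ fun c _ =>
    integrable_finsetSum _ fun l _ => (hint c l).mul_const _]
  simp only [integral_finsetSum _ fun l _ => (hint _ l).mul_const _, integral_mul_const,
    hξ.integral_integral i _ (integrable_expMatrix_neg (integrable_weight hlam _ _) _ _), hA]
  simp

end IsReproduction

end Innovation

/-! ### The filtration -/

section TimeSigma

variable {Ω : Type*} {mΩ : MeasurableSpace Ω} {P : Measure Ω} {p : ℕ} {τ₀ : Ω → Fin p}
  {ξ : Label → Ω → Fin p → Fin p → Measure ℝ≥0}

namespace IsReproduction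

theorem measurableSet_birthTime_le (hξ : IsReproduction P τ₀ ξ) (u : Label) (t : ℝ≥0) :
    MeasurableSet[lineageSigma τ₀ ξ u] {ω | birthTime τ₀ ξ u ω ≤ t} :=
  (hξ.measurable_lineage u).2 measurableSet_Iic

theorem timeSigma_le (hξ : IsReproduction P τ₀ ξ) (t : ℝ≥0) : timeSigma τ₀ ξ t ≤ mΩ := by
  refine MeasurableSpace.generateFrom_le ?_
  rintro _ ⟨u, B, hB, rfl⟩
  exact hξ.lineageSigma_le u _ (MeasurableSet.inter hB (hξ.measurableSet_birthTime_le u t))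

theorem timeSigma_mono (hξ : IsReproduction P τ₀ ξ) {s t : ℝ≥0} (hst : s ≤ t) :
    timeSigma τ₀ ξ s ≤ timeSigma τ₀ ξ t := by
  refine MeasurableSpace.generateFrom_le ?_
  rintro _ ⟨u, B, hB, rfl⟩
  refine MeasurableSpace.measurableSet_generateFrom
    ⟨u, _, MeasurableSet.inter hB (hξ.measurableSet_birthTime_le u s), ?_⟩
  ext ω
  simp only [mem_inter_iff, mem_ofPred_eq]
  refine ⟨fun h => ⟨h, h.2.trans (by exact_mod_cast hst)⟩, fun h => h.1⟩

/-- If `u` is born after time `s`, then what is known at time `s` does not involve `ξ_u`: an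
individual born up to time `s` does not descend from `u`. -/
theorem measurableSet_inter_lt_birthTime (hξ : IsReproduction P τ₀ ξ) {s : ℝ≥0} (u : Label)
    {B : Set Ω} (hB : MeasurableSet[timeSigma τ₀ ξ s] B) :
    MeasurableSet[exceptSigma τ₀ ξ u] (B ∩ {ω | (s : ℝ≥0∞) < birthTime τ₀ ξ u ω}) := by
  have hE : MeasurableSet[exceptSigma τ₀ ξ u] {ω | (s : ℝ≥0∞) < birthTime τ₀ ξ u ω} :=
    (hξ.measurable_except u).2 measurableSet_Ioi
  have hmono : ∀ (w v : Label) ω, birthTime τ₀ ξ v ω ≤ birthTime τ₀ ξ (w ++ v) ω := by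
    intro w v ω
    induction w with
    | nil => exact le_rfl
    | cons k w ih => exact ih.trans le_self_add
  induction B, hB using MeasurableSpace.generateFrom_induction with
  | hC B hBC hBm =>
    obtain ⟨v, A', hA', rfl⟩ := hBC
    by_cases hsuf : u <:+ v
    · obtain ⟨w, rfl⟩ := hsuf
      convert! MeasurableSet.empty using 1
      ext ω
      simp only [mem_inter_iff, mem_ofPred_eq, mem_empty_iff_false, iff_false]
      rintro ⟨⟨-, h1⟩, h2⟩
      exact absurd ((hmono w u ω).trans h1) (not_le.2 h2)
    · refine MeasurableSet.inter (lineageSigma_le_exceptSigma hsuf _ ?_) hE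
      exact MeasurableSet.inter hA' (hξ.measurableSet_birthTime_le v s)
  | empty => simp
  | compl B hBm ih =>
    have : Bᶜ ∩ {ω | (s : ℝ≥0∞) < birthTime τ₀ ξ u ω} =
        {ω | (s : ℝ≥0∞) < birthTime τ₀ ξ u ω} \ (B ∩ {ω | (s : ℝ≥0∞) < birthTime τ₀ ξ u ω}) := by
      ext ω; simp; tauto
    rw [this]
    exact hE.diff ih
  | iUnion f hf ih =>
    rw [iUnion_inter]
    exact MeasurableSet.iUnion ih

end IsReproduction

end TimeSigma

/-! ### Increments of the process -/

section Increment

variable {p k : ℕ} {Ω : Type*} {τ₀ : Ω → Fin p} {ξ : Label → Ω → Fin p → Fin p → Measure ℝ≥0}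
  {lam : ℂ} {A : Matrix (Fin k × Fin p) (Fin p) ℂ} {q : ℝ}

/-- The discount factor in front of the innovation of an individual `u` of type `i` born at a time
in `T`. -/
def coefficient (k : ℕ) (τ₀ : Ω → Fin p) (ξ : Label → Ω → Fin p → Fin p → Measure ℝ≥0) (lam : ℂ)
    (T : Set ℝ≥0∞) (u : Label) (a b : Fin k) (i : Fin p) (ω : Ω) : ℂ :=
  open Classical in if birthTime τ₀ ξ u ω ∈ T ∧ typeOf τ₀ ξ u ω = i then
    expMatrix k lam (-(birthTime τ₀ ξ u ω).toReal) a b else 0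

/-- The change of the total value when an individual `u`, born at a time in `T`, is replaced by its
children: a combination of innovations of `u` whose coefficients are determined by the birth time
and the type of `u`. It is `0` if the birth time of `u` is not in `T`. -/
def increment (τ₀ : Ω → Fin p) (ξ : Label → Ω → Fin p → Fin p → Measure ℝ≥0) (lam : ℂ)
    (A : Matrix (Fin k × Fin p) (Fin p) ℂ) (T : Set ℝ≥0∞) (a : Fin k) (j : Fin p) (u : Label)
    (ω : Ω) : ℂ :=
  ∑ bi : Fin k × Fin p, coefficient k τ₀ ξ lam T u a bi.1 bi.2 ω *
    innovation lam A (ξ u ω) bi.1 bi.2 j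

/-- The total size of the innovations of an individual. -/
def totalInnovation (lam : ℂ) (A : Matrix (Fin k × Fin p) (Fin p) ℂ) (j : Fin p)
    (m : Fin p → Fin p → Measure ℝ≥0) : ℝ :=
  ∑ bi : Fin k × Fin p, ‖innovation lam A m bi.1 bi.2 j‖

theorem measurable_totalInnovation (lam : ℂ) (A : Matrix (Fin k × Fin p) (Fin p) ℂ) (j : Fin p) :
    Measurable (totalInnovation lam A j) :=
  Finset.measurable_sum _ fun _ _ => (measurable_innovation lam A _ _ j).norm

theorem measurable_coefficient {𝓜 : MeasurableSpace Ω} {T : Set ℝ≥0∞} (hT : MeasurableSet T)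
    {u : Label} (h1 : Measurable[𝓜] (typeOf τ₀ ξ u)) (h2 : Measurable[𝓜] (birthTime τ₀ ξ u))
    (a b : Fin k) (i : Fin p) : Measurable[𝓜] (coefficient k τ₀ ξ lam T u a b i) := by
  refine Measurable.ite ((h2 hT).inter (h1 (measurableSet_singleton i))) ?_ measurable_const
  exact (measurable_expMatrix a b).comp h2.ennreal_toReal.neg

theorem measurable_increment {𝓜 : MeasurableSpace Ω} {T : Set ℝ≥0∞} (hT : MeasurableSet T)
    {u : Label} (h1 : Measurable[𝓜] (typeOf τ₀ ξ u)) (h2 : Measurable[𝓜] (birthTime τ₀ ξ u))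
    (h3 : Measurable[𝓜] (ξ u)) (a : Fin k) (j : Fin p) :
    Measurable[𝓜] (increment τ₀ ξ lam A T a j u) :=
  Finset.measurable_sum _ fun _ _ => (measurable_coefficient hT h1 h2 _ _ _).mul
    ((measurable_innovation lam A _ _ j).comp h3)

/-- The constant in the bound `‖exp(lam, -x)‖ ≤ C e^{-δ x}`. -/
def expBound (k : ℕ) (lam : ℂ) (δ : ℝ) : ℝ := (max 1 (lam.re - δ)⁻¹) ^ k

theorem expBound_pos (k : ℕ) (lam : ℂ) (δ : ℝ) : 0 < expBound k lam δ := by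
  unfold expBound; positivity

theorem enorm_coefficient_le {δ : ℝ} (hδ : δ < lam.re) {T : Set ℝ≥0∞} (hT : ∞ ∉ T) (u : Label)
    (a b : Fin k) (i : Fin p) (ω : Ω) : ‖coefficient k τ₀ ξ lam T u a b i ω‖ₑ ≤
      ENNReal.ofReal (expBound k lam δ) * T.indicator (discount δ) (birthTime τ₀ ξ u ω) := by
  unfold coefficient
  split_ifs with h
  · have hne : birthTime τ₀ ξ u ω ≠ ∞ := fun he => hT (he ▸ h.1)
    rw [indicator_of_mem h.1, discount, if_pos hne.lt_top,
      ← ENNReal.ofReal_mul (expBound_pos k lam δ).le, ← ofReal_norm]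
    exact ENNReal.ofReal_le_ofReal (norm_expMatrix_neg_le_exp a b hδ ENNReal.toReal_nonneg)
  · simp

theorem norm_coefficient_le {δ : ℝ} (hδ0 : 0 ≤ δ) (hδ : δ < lam.re) (T : Set ℝ≥0∞)
    (u : Label) (a b : Fin k) (i : Fin p) (ω : Ω) :
    ‖coefficient k τ₀ ξ lam T u a b i ω‖ ≤ expBound k lam δ := by
  unfold coefficient
  split_ifs with h
  · refine (norm_expMatrix_neg_le_exp a b hδ ENNReal.toReal_nonneg).trans ?_
    refine mul_le_of_le_one_right (expBound_pos k lam δ).le ?_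
    rw [Real.exp_le_one_iff, neg_mul, neg_nonpos]
    exact mul_nonneg hδ0 ENNReal.toReal_nonneg
  · simpa using (expBound_pos k lam δ).le

theorem enorm_increment_le {δ : ℝ} (hδ : δ < lam.re) {T : Set ℝ≥0∞} (hT : ∞ ∉ T) (a : Fin k)
    (j : Fin p) (u : Label) (ω : Ω) : ‖increment τ₀ ξ lam A T a j u ω‖ₑ ≤
      ENNReal.ofReal (expBound k lam δ) * T.indicator (discount δ) (birthTime τ₀ ξ u ω) *
        ‖totalInnovation lam A j (ξ u ω)‖ₑ := by
  have h1 : ‖totalInnovation lam A j (ξ u ω)‖ₑ =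
      ∑ bi : Fin k × Fin p, ‖innovation lam A (ξ u ω) bi.1 bi.2 j‖ₑ := by
    rw [totalInnovation, Real.enorm_eq_ofReal (by positivity),
      ENNReal.ofReal_sum_of_nonneg fun _ _ => norm_nonneg _]
    simp only [ofReal_norm]
  rw [h1, Finset.mul_sum]
  refine (enorm_sum_le _ _).trans (Finset.sum_le_sum fun bi _ => ?_)
  rw [enorm_mul]
  exact mul_le_mul' (enorm_coefficient_le hδ hT u a bi.1 bi.2 ω) le_rfl

theorem discount_rpow {q : ℝ} (hq : 0 < q) (δ : ℝ) (x : ℝ≥0∞) :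
    discount δ x ^ q = discount (q * δ) x := by
  unfold discount
  split_ifs
  · rw [ENNReal.ofReal_rpow_of_nonneg (Real.exp_pos _).le hq.le, ← Real.exp_mul]
    congr 2; ring
  · exact ENNReal.zero_rpow_of_pos hq

variable [mΩ : MeasurableSpace Ω] {P : Measure Ω}

namespace IsReproduction

theorem measurable_discount_mul (hξ : IsReproduction P τ₀ ξ) (β : ℝ) (u : Label) (j : Fin p)
    (r : ℝ) : Measurable fun ω =>
      discount β (birthTime τ₀ ξ u ω) * ‖totalInnovation lam A j (ξ u ω)‖ₑ ^ r :=
  ((measurable_discount β).comp (hξ.measurable_birthTime u)).mul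
    (((measurable_totalInnovation lam A j).comp (hξ.measurable_offspring u)).enorm.pow_const r)

variable [IsProbabilityMeasure P]

theorem memLp_totalInnovation (hξ : IsReproduction P τ₀ ξ)
    (hlam : lam ∈ interior (laplaceDom (intensity P ξ))) (hq : 1 < q)
    (hA3 : ∫⁻ ω, ‖weightedMass k lam.re (ξ [] ω)‖ₑ ^ q ∂P < ∞) (j : Fin p) :
    MemLp (fun ω => totalInnovation lam A j (ξ [] ω)) (ENNReal.ofReal q) P :=
  memLp_finsetSum _ fun bi _ => (hξ.memLp_innovation hlam hq hA3 [] bi.1 bi.2 j).norm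

/-- Birth time and innovations of an individual are independent. -/
theorem lintegral_discount_mul (hξ : IsReproduction P τ₀ ξ) (β : ℝ) (u : Label) (j : Fin p)
    (r : ℝ) : ∫⁻ ω, discount β (birthTime τ₀ ξ u ω) * ‖totalInnovation lam A j (ξ u ω)‖ₑ ^ r ∂P =
      (∫⁻ ω, discount β (birthTime τ₀ ξ u ω) ∂P) *
        ∫⁻ ω, ‖totalInnovation lam A j (ξ [] ω)‖ₑ ^ r ∂P := by
  have hg : Measurable fun m => ‖totalInnovation lam A j m‖ₑ ^ r :=
    (measurable_totalInnovation lam A j).enorm.pow_const r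
  refine (lintegral_mul_eq_lintegral_mul_lintegral_of_independent_measurableSpace
    (hξ.exceptSigma_le u) (hξ.measurable_offspring u).comap_le (hξ.indep_exceptSigma u)
    ((measurable_discount β).comp (hξ.measurable_except u).2)
    (hg.comp (comap_measurable (ξ u)))).trans ?_
  congr 1
  exact ((hξ.identDistrib u).comp hg).lintegral_eq

/-- Discounting with a rate `δ` slightly smaller than `Re lam` absorbs the polynomial factors of
`exp(lam, -x)`. -/
theorem lintegral_enorm_increment_rpow_le (hξ : IsReproduction P τ₀ ξ) {δ : ℝ} (hδ : δ < lam.re)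
    (hq : 0 < q) {T : Set ℝ≥0∞} (hT : ∞ ∉ T) (a : Fin k) (j : Fin p) (u : Label) :
    ∫⁻ ω, ‖increment τ₀ ξ lam A T a j u ω‖ₑ ^ q ∂P ≤
      (ENNReal.ofReal (expBound k lam δ) ^ q *
        ∫⁻ ω, ‖totalInnovation lam A j (ξ [] ω)‖ₑ ^ q ∂P) *
        ∫⁻ ω, discount (q * δ) (birthTime τ₀ ξ u ω) ∂P := by
  calc ∫⁻ ω, ‖increment τ₀ ξ lam A T a j u ω‖ₑ ^ q ∂P
      ≤ ∫⁻ ω, ENNReal.ofReal (expBound k lam δ) ^ q * (discount (q * δ) (birthTime τ₀ ξ u ω) *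
          ‖totalInnovation lam A j (ξ u ω)‖ₑ ^ q) ∂P := by
        refine lintegral_mono fun ω => ?_
        rw [← discount_rpow hq, ← ENNReal.mul_rpow_of_nonneg _ _ hq.le,
          ← ENNReal.mul_rpow_of_nonneg _ _ hq.le]
        refine ENNReal.rpow_le_rpow ((enorm_increment_le hδ hT a j u ω).trans ?_) hq.le
        rw [mul_assoc]
        gcongr
        exact indicator_le_self _ _ _
    _ = _ := by
        rw [lintegral_const_mul _ (hξ.measurable_discount_mul _ u j q), hξ.lintegral_discount_mul]
        ring

/-- On a bounded time interval any discount rate can be reached, at the cost of a factor depending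
on the interval. -/
theorem lintegral_enorm_increment_le (hξ : IsReproduction P τ₀ ξ) {δ β : ℝ} (hδ : δ < lam.re)
    (hβ : δ ≤ β) {T : Set ℝ≥0∞} {t : ℝ≥0} (hT : T ⊆ Iic (t : ℝ≥0∞)) (a : Fin k) (j : Fin p)
    (u : Label) :
    ∫⁻ ω, ‖increment τ₀ ξ lam A T a j u ω‖ₑ ∂P ≤
      (ENNReal.ofReal (expBound k lam δ) * ENNReal.ofReal (Real.exp ((β - δ) * t)) *
        ∫⁻ ω, ‖totalInnovation lam A j (ξ [] ω)‖ₑ ∂P) *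
        ∫⁻ ω, discount β (birthTime τ₀ ξ u ω) ∂P := by
  have hT' : ∞ ∉ T := fun h => absurd (hT h) (by simp)
  have hind : ∀ x, T.indicator (discount δ) x ≤
      ENNReal.ofReal (Real.exp ((β - δ) * t)) * discount β x := by
    intro x
    by_cases hx : x ∈ T
    · rw [indicator_of_mem hx]
      have hxt : x ≤ t := hT hx
      lift x to ℝ≥0 using (hxt.trans_lt ENNReal.coe_lt_top).ne
      rw [discount_coe, discount_coe, ← ENNReal.ofReal_mul (Real.exp_pos _).le, ← Real.exp_add]
      refine ENNReal.ofReal_le_ofReal (Real.exp_le_exp.2 ?_)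
      have hxt' : (x : ℝ) ≤ t := by exact_mod_cast hxt
      have := mul_le_mul_of_nonneg_left hxt' (by linarith : 0 ≤ β - δ)
      linarith
    · rw [indicator_of_notMem hx]; exact zero_le
  have hone := hξ.lintegral_discount_mul (lam := lam) (A := A) β u j 1
  simp only [ENNReal.rpow_one] at hone
  calc ∫⁻ ω, ‖increment τ₀ ξ lam A T a j u ω‖ₑ ∂P
      ≤ ∫⁻ ω, ENNReal.ofReal (expBound k lam δ) * ENNReal.ofReal (Real.exp ((β - δ) * t)) *
          (discount β (birthTime τ₀ ξ u ω) * ‖totalInnovation lam A j (ξ u ω)‖ₑ) ∂P := by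
        refine lintegral_mono fun ω => (enorm_increment_le hδ hT' a j u ω).trans ?_
        rw [mul_assoc (ENNReal.ofReal (expBound k lam δ)),
          mul_assoc (ENNReal.ofReal (expBound k lam δ)), ← mul_assoc (ENNReal.ofReal (Real.exp _))]
        exact mul_le_mul' le_rfl (mul_le_mul' (hind _) le_rfl)
    _ = _ := by
        have hm := hξ.measurable_discount_mul (lam := lam) (A := A) β u j 1
        simp only [ENNReal.rpow_one] at hm
        rw [lintegral_const_mul _ hm, hone]
        ring

theorem memLp_increment (hξ : IsReproduction P τ₀ ξ)
    (hlam : lam ∈ interior (laplaceDom (intensity P ξ))) (hq : 1 < q)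
    (hA3 : ∫⁻ ω, ‖weightedMass k lam.re (ξ [] ω)‖ₑ ^ q ∂P < ∞) {δ : ℝ} (hδ0 : 0 ≤ δ)
    (hδ : δ < lam.re) {T : Set ℝ≥0∞} (hTm : MeasurableSet T) (a : Fin k) (j : Fin p)
    (u : Label) : MemLp (increment τ₀ ξ lam A T a j u) (ENNReal.ofReal q) P := by
  have h := hξ.measurable_except u
  exact memLp_sum_mul (hξ.exceptSigma_le u) (hξ.measurable_offspring u).comap_le
    (c := fun bi : Fin k × Fin p => coefficient k τ₀ ξ lam T u a bi.1 bi.2)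
    (m := fun bi ω => innovation lam A (ξ u ω) bi.1 bi.2 j)
    (fun bi => measurable_coefficient hTm h.1 h.2 a bi.1 bi.2)
    (fun bi ω => norm_coefficient_le hδ0 hδ _ u a bi.1 bi.2 ω)
    (fun bi => (measurable_innovation lam A _ _ j).comp (comap_measurable (ξ u)))
    (fun bi => hξ.memLp_innovation hlam hq hA3 u bi.1 bi.2 j)

/-- The von Bahr–Esseen inequality for sums of increments. Removing a label of maximal length, the
remaining increments are determined by `τ₀` and the offspring of the other individuals. -/
theorem integral_norm_sum_increment_rpow_le (hξ : IsReproduction P τ₀ ξ)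
    (hlam : lam ∈ interior (laplaceDom (intensity P ξ))) (hq1 : 1 < q) (hq2 : q ≤ 2)
    (hA3 : ∫⁻ ω, ‖weightedMass k lam.re (ξ [] ω)‖ₑ ^ q ∂P < ∞)
    (hA : ∀ b i j, ∑ c, ∑ l, (∫ s, expMatrix k lam (-((s : ℝ≥0) : ℝ)) b c
      ∂(intensity P ξ i l)) * A (c, l) j = A (b, i) j) {δ : ℝ} (hδ0 : 0 ≤ δ)
    (hδ : δ < lam.re) {T : Set ℝ≥0∞} (hTm : MeasurableSet T) (a : Fin k) (j : Fin p)
    (f : Fin p → ℂ) (F : Finset Label) :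
    MemLp (fun ω => f (τ₀ ω) + ∑ u ∈ F, increment τ₀ ξ lam A T a j u ω) (ENNReal.ofReal q) P ∧
    ∫ ω, ‖f (τ₀ ω) + ∑ u ∈ F, increment τ₀ ξ lam A T a j u ω‖ ^ q ∂P ≤
      ∫ ω, ‖f (τ₀ ω)‖ ^ q ∂P +
        6 * ∑ u ∈ F, ∫ ω, ‖increment τ₀ ξ lam A T a j u ω‖ ^ q ∂P := by
  have hf : Measurable f := measurable_from_top
  induction F using Finset.induction_on_max_value (fun u : Label => u.length) with
  | empty =>
    refine ⟨?_, by simp⟩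
    simp only [Finset.sum_empty, add_zero]
    refine MemLp.of_bound (hf.comp hξ.measurable_type).aestronglyMeasurable (∑ i, ‖f i‖) ?_
    exact Eventually.of_forall fun ω =>
      Finset.single_le_sum (f := fun i => ‖f i‖) (fun _ _ => norm_nonneg _) (Finset.mem_univ _)
  | insert u F hu hmax ih =>
    have hy := hξ.memLp_increment (A := A) hlam hq1 hA3 hδ0 hδ hTm a j u
    have hsum : ∀ ω, f (τ₀ ω) + ∑ v ∈ insert u F, increment τ₀ ξ lam A T a j v ω =
        (f (τ₀ ω) + ∑ v ∈ F, increment τ₀ ξ lam A T a j v ω) +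
          increment τ₀ ξ lam A T a j u ω := by
      intro ω
      rw [Finset.sum_insert hu]; ring
    simp only [hsum]
    refine ⟨ih.1.add hy, ?_⟩
    -- As `u` has maximal length, no label in `F` descends from `u`.
    have hx : Measurable[exceptSigma τ₀ ξ u]
        fun ω => f (τ₀ ω) + ∑ v ∈ F, increment τ₀ ξ lam A T a j v ω := by
      refine Measurable.add (hf.comp (measurable_type_exceptSigma u))
        (Finset.measurable_sum _ fun v hv => ?_)
      have hne : v ≠ u := fun h => hu (h ▸ hv)
      have hsuf : ¬ u <:+ v := fun h => hne (h.eq_of_length_le (hmax v hv)).symm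
      have hle := lineageSigma_le_exceptSigma (τ₀ := τ₀) (ξ := ξ) hsuf
      have hv' := hξ.measurable_lineage v
      exact measurable_increment hTm (hv'.1.mono hle le_rfl) (hv'.2.mono hle le_rfl)
        (measurable_offspring_exceptSigma hne) a j
    have h := hξ.measurable_except u
    have key := integral_norm_add_rpow_le hq1 hq2 (hξ.exceptSigma_le u)
      (hξ.measurable_offspring u).comap_le (hξ.indep_exceptSigma u) hx ih.1
      (c := fun bi : Fin k × Fin p => coefficient k τ₀ ξ lam T u a bi.1 bi.2)
      (m := fun bi ω => innovation lam A (ξ u ω) bi.1 bi.2 j)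
      (fun bi => measurable_coefficient hTm h.1 h.2 a bi.1 bi.2)
      (fun bi ω => norm_coefficient_le hδ0 hδ _ u a bi.1 bi.2 ω)
      (fun bi => (measurable_innovation lam A _ _ j).comp (comap_measurable (ξ u)))
      (fun bi => hξ.memLp_innovation hlam hq1 hA3 u bi.1 bi.2 j)
      (fun bi => hξ.integral_innovation hlam hq1 hA3 hA u bi.1 bi.2 j)
    rw [Finset.sum_insert hu]
    refine key.trans ?_
    have := ih.2
    simp only [increment] at *
    linarith

/-- On `{S(u) > s}` the events known at time `s` are independent of the offspring of `u`, whose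
innovations are centred. -/
theorem setIntegral_increment_eq_zero (hξ : IsReproduction P τ₀ ξ)
    (hlam : lam ∈ interior (laplaceDom (intensity P ξ))) (hq1 : 1 < q)
    (hA3 : ∫⁻ ω, ‖weightedMass k lam.re (ξ [] ω)‖ₑ ^ q ∂P < ∞)
    (hA : ∀ b i j, ∑ c, ∑ l, (∫ s, expMatrix k lam (-((s : ℝ≥0) : ℝ)) b c
      ∂(intensity P ξ i l)) * A (c, l) j = A (b, i) j) {δ : ℝ} (hδ0 : 0 ≤ δ)
    (hδ : δ < lam.re) {s t : ℝ≥0} (a : Fin k) (j : Fin p) (u : Label) {B : Set Ω}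
    (hB : MeasurableSet[timeSigma τ₀ ξ s] B) :
    ∫ ω in B, increment τ₀ ξ lam A (Ioc (s : ℝ≥0∞) t) a j u ω ∂P = 0 := by
  have hE := hξ.measurableSet_inter_lt_birthTime u hB
  set E := B ∩ {ω | (s : ℝ≥0∞) < birthTime τ₀ ξ u ω}
  rw [← integral_indicator (hξ.timeSigma_le s B hB)]
  have heq : ∀ ω, B.indicator (increment τ₀ ξ lam A (Ioc (s : ℝ≥0∞) t) a j u) ω =
      ∑ bi : Fin k × Fin p,
        E.indicator (coefficient k τ₀ ξ lam (Ioc (s : ℝ≥0∞) t) u a bi.1 bi.2) ω *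
          innovation lam A (ξ u ω) bi.1 bi.2 j := by
    intro ω
    by_cases hω : ω ∈ B
    · rw [indicator_of_mem hω, increment]
      refine Finset.sum_congr rfl fun bi _ => ?_
      by_cases hs : (s : ℝ≥0∞) < birthTime τ₀ ξ u ω
      · rw [indicator_of_mem (show ω ∈ E from ⟨hω, hs⟩)]
      · rw [indicator_of_notMem (show ω ∉ E from fun h => hs h.2), coefficient, if_neg]
        exact fun h => hs h.1.1
    · rw [indicator_of_notMem hω]
      simp [indicator_of_notMem (show ω ∉ E from fun h => hω h.1)]
  simp only [heq]
  have hterm : ∀ bi : Fin k × Fin p, _ := fun bi =>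
    integral_mul_eq_zero_of_indep (hξ.indep_exceptSigma u)
      (f := E.indicator (coefficient k τ₀ ξ lam (Ioc (s : ℝ≥0∞) t) u a bi.1 bi.2))
      (m := fun ω => innovation lam A (ξ u ω) bi.1 bi.2 j)
      ((measurable_coefficient measurableSet_Ioc (hξ.measurable_except u).1
        (hξ.measurable_except u).2 a bi.1 bi.2).indicator hE)
      ((measurable_innovation lam A _ _ j).comp (comap_measurable (ξ u)))
      (Integrable.of_bound (C := expBound k lam δ)
        (((measurable_coefficient measurableSet_Ioc (hξ.measurable_typeOf u)
          (hξ.measurable_birthTime u) a bi.1 bi.2).indicator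
            (hξ.exceptSigma_le u _ hE)).aestronglyMeasurable)
        (Eventually.of_forall fun ω => (norm_indicator_le_norm_self _ _).trans
          (norm_coefficient_le hδ0 hδ _ u a bi.1 bi.2 ω)))
      ((hξ.memLp_innovation hlam hq1 hA3 u bi.1 bi.2 j).integrable
        (by rw [ENNReal.one_le_ofReal]; exact hq1.le))
      (hξ.integral_innovation hlam hq1 hA3 hA u bi.1 bi.2 j)
  rw [integral_finsetSum _ fun bi _ => (hterm bi).1]
  exact Finset.sum_eq_zero fun bi _ => (hterm bi).2

end IsReproduction

end Increment

/-! ### Decomposition into increments -/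

section Decomposition

variable {p k : ℕ}

/-- The discounted reproductive value of an individual of type `l` born at time `x`: the entry
`(a, j)` of `exp(lam, -x) (I ⊗ e_l) A`. -/
def reproductiveValue (lam : ℂ) (A : Matrix (Fin k × Fin p) (Fin p) ℂ) (a : Fin k) (j : Fin p)
    (x : ℝ) (l : Fin p) : ℂ :=
  ∑ c, expMatrix k lam (-x) a c * A (c, l) j

theorem expMatrix_add_apply (lam : ℂ) (x y : ℝ) (a c : Fin k) :
    expMatrix k lam (x + y) a c = ∑ b, expMatrix k lam x a b * expMatrix k lam y b c := by
  rw [expMatrix_add, Matrix.mul_apply]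

variable {lam : ℂ} {A : Matrix (Fin k × Fin p) (Fin p) ℂ} {m : Fin p → Fin p → Measure ℝ≥0}

theorem integrable_expMatrix_sub {ν : Measure ℝ≥0} (h : Integrable (weight k lam.re) ν) (x : ℝ)
    (b c : Fin k) : Integrable (fun s : ℝ≥0 => expMatrix k lam (x - (s : ℝ)) b c) ν := by
  simp only [sub_eq_add_neg, expMatrix_add_apply]
  exact integrable_finsetSum _ fun d _ => (integrable_expMatrix_neg h d c).const_mul _

theorem integrable_reproductiveValue {ν : Measure ℝ≥0} (h : Integrable (weight k lam.re) ν)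
    (a : Fin k) (j : Fin p) (x : ℝ) (l : Fin p) :
    Integrable (fun s : ℝ≥0 => reproductiveValue lam A a j (x + s) l) ν := by
  unfold reproductiveValue
  refine integrable_finsetSum _ fun c _ => Integrable.mul_const ?_ _
  simpa only [neg_add'] using integrable_expMatrix_sub h (-x) a c

/-- The discounted innovations of an individual of type `i` born at time `x` give the value of all
its children minus its own value. -/
theorem sum_expMatrix_mul_innovation (h : ∀ i l, Integrable (weight k lam.re) (m i l)) (a : Fin k)
    (i j : Fin p) (x : ℝ) :
    ∑ b, expMatrix k lam (-x) a b * innovation lam A m b i j =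
      ∑ l, ∫ s, reproductiveValue lam A a j (x + (s : ℝ≥0)) l ∂(m i l) -
        reproductiveValue lam A a j x i := by
  have h1 : ∀ l, ∫ s, reproductiveValue lam A a j (x + (s : ℝ≥0)) l ∂(m i l) =
      ∑ b, expMatrix k lam (-x) a b *
        ∑ c, (∫ s, expMatrix k lam (-((s : ℝ≥0) : ℝ)) b c ∂(m i l)) * A (c, l) j := by
    intro l
    have h2 : ∀ s : ℝ≥0, reproductiveValue lam A a j (x + s) l =
        ∑ b, expMatrix k lam (-x) a b *
          ∑ c, expMatrix k lam (-((s : ℝ≥0) : ℝ)) b c * A (c, l) j := by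
      intro s
      simp only [reproductiveValue, neg_add, expMatrix_add_apply, Finset.sum_mul, Finset.mul_sum]
      rw [Finset.sum_comm]
      simp only [mul_assoc]
    simp only [h2]
    rw [integral_finsetSum _ fun b _ => (integrable_finsetSum _ fun c _ =>
      (integrable_expMatrix_neg (h i l) b c).mul_const _).const_mul _]
    refine Finset.sum_congr rfl fun b _ => ?_
    rw [integral_const_mul, integral_finsetSum _ fun c _ =>
      (integrable_expMatrix_neg (h i l) b c).mul_const _]
    simp only [integral_mul_const]
  simp only [h1, innovation, mul_sub, Finset.sum_sub_distrib]
  rw [reproductiveValue]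
  congr 1
  rw [Finset.sum_comm]
  refine Finset.sum_congr rfl fun b _ => ?_
  rw [← Finset.mul_sum, Finset.sum_comm]

theorem rowSelect_mul_apply {n : Type*} (i : Fin p) (B : Matrix (Fin k × Fin p) n ℂ) (b : Fin k)
    (j : n) : (rowSelect k i * B) b j = B (b, i) j := by
  rw [Matrix.mul_apply, Finset.sum_eq_single (b, i)]
  · simp [rowSelect]
  · rintro ⟨c, l⟩ - hne
    have : ¬ (b = c ∧ l = i) := fun h => hne (by rw [h.1, h.2])
    simp [rowSelect, this]
  · simp

/-- The discounted characteristic of an individual born at time `x` is the value of its children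
born after time `t`. -/
theorem expMatrix_mul_rowSelect_mul_tailIntegral
    (h : ∀ i l, Integrable (weight k lam.re) (m i l)) (a : Fin k) (i j : Fin p) (t x : ℝ) :
    (expMatrix k lam (-t) * (rowSelect k i * (tailIntegral k lam m (t - x) * A))) a j =
      ∑ l, ∫ s in {s : ℝ≥0 | t - x < (s : ℝ)},
        reproductiveValue lam A a j (x + (s : ℝ≥0)) l ∂(m i l) := by
  have h1 : ∀ l, ∫ s in {s : ℝ≥0 | t - x < (s : ℝ)},
        reproductiveValue lam A a j (x + (s : ℝ≥0)) l ∂(m i l) =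
      ∑ b, expMatrix k lam (-t) a b *
        ∑ c, tailIntegral k lam m (t - x) (b, i) (c, l) * A (c, l) j := by
    intro l
    have h2 : ∀ s : ℝ≥0, reproductiveValue lam A a j (x + s) l =
        ∑ b, expMatrix k lam (-t) a b *
          ∑ c, expMatrix k lam (t - x - (s : ℝ)) b c * A (c, l) j := by
      intro s
      have h3 : -(x + (s : ℝ)) = -t + (t - x - s) := by ring
      simp only [reproductiveValue, h3, expMatrix_add_apply, Finset.sum_mul, Finset.mul_sum]
      rw [Finset.sum_comm]
      simp only [mul_assoc]
    have hi := fun b c => (integrable_expMatrix_sub (h i l) (t - x) b c).integrableOn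
      (s := {s : ℝ≥0 | t - x < (s : ℝ)})
    simp only [h2]
    rw [integral_finsetSum _ fun b _ => (integrable_finsetSum _ fun c _ =>
      (hi b c).mul_const _).const_mul _]
    refine Finset.sum_congr rfl fun b _ => ?_
    rw [integral_const_mul, integral_finsetSum _ fun c _ => (hi b c).mul_const _]
    simp only [integral_mul_const, tailIntegral, Matrix.of_apply]
  simp only [h1]
  rw [Finset.sum_comm, Matrix.mul_apply]
  refine Finset.sum_congr rfl fun b _ => ?_
  rw [← Finset.mul_sum, rowSelect_mul_apply, Matrix.mul_apply, Fintype.sum_prod_type,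
    Finset.sum_comm]

variable {Ω : Type*} {τ₀ : Ω → Fin p} {ξ : Label → Ω → Fin p → Fin p → Measure ℝ≥0}

/-- The contribution of the individual `u` to the branching process counted with the
characteristic `t ↦ (∫_{(t,∞)} exp(lam, t - s) ⊗ ξ_u(ds)) A`, `t ≥ 0`. For the stacked coefficient
matrix `A = coeffStack (intensity P ξ) lam` it is the summand of `countedProcess`. -/
def countedTerm (τ₀ : Ω → Fin p) (ξ : Label → Ω → Fin p → Fin p → Measure ℝ≥0) (lam : ℂ)
    (A : Matrix (Fin k × Fin p) (Fin p) ℂ) (t : ℝ) (u : Label) (ω : Ω) :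
    Matrix (Fin k) (Fin p) ℂ :=
  if birthTime τ₀ ξ u ω < ∞ then
    rowSelect k (typeOf τ₀ ξ u ω) * (if 0 ≤ t - (birthTime τ₀ ξ u ω).toReal then
      tailIntegral k lam (ξ u ω) (t - (birthTime τ₀ ξ u ω).toReal) * A else 0)
  else 0

theorem countedTerm_eq_zero {t : ℝ≥0} {u : Label} {ω : Ω} (h : ¬ birthTime τ₀ ξ u ω ≤ t) :
    countedTerm τ₀ ξ lam A t u ω = 0 := by
  unfold countedTerm
  split_ifs with h1 h2
  · refine absurd ?_ h
    rw [sub_nonneg] at h2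
    lift birthTime τ₀ ξ u ω to ℝ≥0 using h1.ne with x
    exact_mod_cast h2
  · simp
  · rfl

theorem increment_eq_zero {T : Set ℝ≥0∞} {u : Label} {ω : Ω} (h : birthTime τ₀ ξ u ω ∉ T)
    (a : Fin k) (j : Fin p) : increment τ₀ ξ lam A T a j u ω = 0 := by
  refine Finset.sum_eq_zero fun bi _ => ?_
  rw [coefficient, if_neg fun h' => h h'.1, zero_mul]

theorem increment_eq_sum {T : Set ℝ≥0∞} {u : Label} {ω : Ω} (h : birthTime τ₀ ξ u ω ∈ T)
    (a : Fin k) (j : Fin p) : increment τ₀ ξ lam A T a j u ω =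
      ∑ b, expMatrix k lam (-(birthTime τ₀ ξ u ω).toReal) a b *
        innovation lam A (ξ u ω) b (typeOf τ₀ ξ u ω) j := by
  rw [increment, Fintype.sum_prod_type]
  refine Finset.sum_congr rfl fun b _ => ?_
  rw [Finset.sum_eq_single (typeOf τ₀ ξ u ω)]
  · rw [coefficient, if_pos ⟨h, rfl⟩]
  · intro i _ hi
    rw [coefficient, if_neg fun h' => hi h'.2.symm, zero_mul]
  · simp

/-- The reproductive value of `u` if `u` is born up to time `t`, and `0` otherwise. -/
def bornValue (τ₀ : Ω → Fin p) (ξ : Label → Ω → Fin p → Fin p → Measure ℝ≥0) (lam : ℂ)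
    (A : Matrix (Fin k × Fin p) (Fin p) ℂ) (t : ℝ≥0) (a : Fin k) (j : Fin p) (ω : Ω)
    (u : Label) : ℂ :=
  open Classical in if birthTime τ₀ ξ u ω ≤ t then
    reproductiveValue lam A a j (birthTime τ₀ ξ u ω).toReal (typeOf τ₀ ξ u ω) else 0

/-- The children of `u` born up to time `t` carry the value which `u` passes on up to that time;
what `u` passes on later is its contribution to the counted process. -/
theorem hasSum_bornValue_cons {ω : Ω} (hp : ∀ u i j, IsPointMeasure (ξ u ω i j))
    (hw : ∀ u i l, Integrable (weight k lam.re) (ξ u ω i l)) (t : ℝ≥0) (a : Fin k) (j : Fin p)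
    (u : Label) :
    HasSum (fun n : ℕ+ => bornValue τ₀ ξ lam A t a j ω (n :: u))
      (bornValue τ₀ ξ lam A t a j ω u + increment τ₀ ξ lam A (Iic (t : ℝ≥0∞)) a j u ω -
        (expMatrix k lam (-(t : ℝ)) * countedTerm τ₀ ξ lam A t u ω) a j) := by
  by_cases hu : birthTime τ₀ ξ u ω ≤ t
  · have hmem : birthTime τ₀ ξ u ω ∈ Iic (t : ℝ≥0∞) := hu
    have hlt : birthTime τ₀ ξ u ω < ∞ := hu.trans_lt ENNReal.coe_lt_top
    rw [increment_eq_sum hmem, bornValue, if_pos hu, countedTerm, if_pos hlt,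
      sum_expMatrix_mul_innovation (hw u)]
    obtain ⟨x, hx⟩ : ∃ x : ℝ≥0, (x : ℝ≥0∞) = birthTime τ₀ ξ u ω :=
      ⟨_, ENNReal.coe_toNNReal hlt.ne⟩
    rw [← hx] at hu
    have hxt : x ≤ t := by exact_mod_cast hu
    have hxt' : (x : ℝ) ≤ t := by exact_mod_cast hxt
    rw [← hx, ENNReal.coe_toReal, if_pos (sub_nonneg.2 hxt'),
      expMatrix_mul_rowSelect_mul_tailIntegral (hw u)]
    have hchild := integral_children (hp u (typeOf τ₀ ξ u ω)) (typeOf τ₀ ξ u ω)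
      (fun l s => reproductiveValue lam A a j (x + (s : ℝ)) l) (t - x)
      fun l => (integrable_reproductiveValue (hw u _ l) a j x l).integrableOn
    convert! hchild using 1
    · ext n
      have hb : birthTime τ₀ ξ (n :: u) ω = x + childTime (ξ u ω (typeOf τ₀ ξ u ω)) n := by
        rw [birthTime, ← hx]
      rw [bornValue, hb]
      have hiff : (x : ℝ≥0∞) + childTime (ξ u ω (typeOf τ₀ ξ u ω)) n ≤ t ↔
          childTime (ξ u ω (typeOf τ₀ ξ u ω)) n ≤ ((t - x : ℝ≥0) : ℝ≥0∞) := by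
        rw [ENNReal.coe_sub, ENNReal.le_sub_iff_add_le_left ENNReal.coe_ne_top hu]
      by_cases hc : childTime (ξ u ω (typeOf τ₀ ξ u ω)) n ≤ ((t - x : ℝ≥0) : ℝ≥0∞)
      · rw [if_pos (hiff.2 hc), if_pos hc, ENNReal.toReal_add ENNReal.coe_ne_top
          (hc.trans_lt ENNReal.coe_lt_top).ne]
        rfl
      · rw [if_neg (fun h => hc (hiff.1 h)), if_neg hc]
    · rw [add_sub_cancel, ← Finset.sum_sub_distrib]
      refine Finset.sum_congr rfl fun l _ => ?_
      have hset : {s : ℝ≥0 | (t : ℝ) - x < (s : ℝ)} = (Iic (t - x))ᶜ := by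
        ext s
        rw [mem_ofPred_eq, mem_compl_iff, mem_Iic, not_le, ← NNReal.coe_lt_coe,
          NNReal.coe_sub hxt]
      rw [hset, sub_eq_iff_eq_add, integral_add_compl measurableSet_Iic
        (integrable_reproductiveValue (hw u _ l) a j x l)]
  · rw [bornValue, if_neg hu, increment_eq_zero (show birthTime τ₀ ξ u ω ∉ Iic (t : ℝ≥0∞) from hu),
      countedTerm_eq_zero hu]
    convert! hasSum_zero using 1
    · ext n
      rw [bornValue, if_neg]
      exact fun h => hu (le_trans le_self_add h)
    · simp

/-- Summation by parts on the tree of labels: every label but the root is a child, so that in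
`∑ v(u)` minus the sum of `v` over all children only the value of the root is left. -/
theorem tsum_eq_root_add_tsum {v y c : Label → ℂ} (hv : Summable v) (hy : Summable y)
    (hc : Summable c) (hchild : ∀ u, HasSum (fun n : ℕ+ => v (n :: u)) (v u + y u - c u)) :
    ∑' u, c u = v [] + ∑' u, y u := by
  have htotal : ∑' u, v u = v [] + ∑' u, (v u + y u - c u) := by
    have hv' : Summable fun x => v (labelEquiv x) := labelEquiv.summable_iff.2 hv
    have hprod : Summable fun x : Label × ℕ+ => v (x.2 :: x.1) :=
      hv'.comp_injective Sum.inr_injective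
    rw [← labelEquiv.tsum_eq v, Summable.tsum_sum (f := fun x => v (labelEquiv x))
      (hv'.comp_injective Sum.inl_injective) hprod]
    congr 1
    · exact (hasSum_unique fun _ : Unit => v []).tsum_eq
    · refine (hprod.tsum_prod' fun u => (hchild u).summable).trans ?_
      exact tsum_congr fun u => (hchild u).tsum_eq
  rw [(hv.add hy).tsum_sub hc, hv.tsum_add hy] at htotal
  linear_combination htotal

/-- The counted process is the value of the ancestor plus the sum of all increments. -/
theorem expMatrix_mul_tsum_countedTerm {ω : Ω} (hp : ∀ u i j, IsPointMeasure (ξ u ω i j))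
    (hw : ∀ u i l, Integrable (weight k lam.re) (ξ u ω i l)) {t : ℝ≥0}
    (hfin : {u : Label | birthTime τ₀ ξ u ω ≤ t}.Finite) (a : Fin k) (j : Fin p) :
    (expMatrix k lam (-(t : ℝ)) * ∑' u, countedTerm τ₀ ξ lam A t u ω) a j =
      A (a, τ₀ ω) j + ∑' u, increment τ₀ ξ lam A (Iic (t : ℝ≥0∞)) a j u ω := by
  have hnot : ∀ u ∉ hfin.toFinset, ¬ birthTime τ₀ ξ u ω ≤ t := fun u hu h =>
    hu (hfin.mem_toFinset.2 h)
  have hc0 : ∀ u ∉ hfin.toFinset, countedTerm τ₀ ξ lam A t u ω = 0 := fun u hu =>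
    countedTerm_eq_zero (hnot u hu)
  have hc1 : ∀ u ∉ hfin.toFinset,
      (expMatrix k lam (-(t : ℝ)) * countedTerm τ₀ ξ lam A t u ω) a j = 0 := fun u hu => by
    rw [hc0 u hu, Matrix.mul_zero, Matrix.zero_apply]
  have hy0 : ∀ u ∉ hfin.toFinset, increment τ₀ ξ lam A (Iic (t : ℝ≥0∞)) a j u ω = 0 :=
    fun u hu => increment_eq_zero (hnot u hu) a j
  have hv0 : ∀ u ∉ hfin.toFinset, bornValue τ₀ ξ lam A t a j ω u = 0 := fun u hu =>
    if_neg (hnot u hu)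
  have hroot : bornValue τ₀ ξ lam A t a j ω [] = A (a, τ₀ ω) j := by
    rw [bornValue, if_pos (by simp [birthTime])]
    simp [reproductiveValue, birthTime, typeOf, expMatrix_zero, Matrix.one_apply]
  rw [← hroot, ← tsum_eq_root_add_tsum (summable_of_ne_finset_zero hv0)
    (summable_of_ne_finset_zero hy0) (summable_of_ne_finset_zero hc1)
    (hasSum_bornValue_cons hp hw t a j), tsum_eq_sum hc0, tsum_eq_sum hc1, Matrix.mul_sum,
    Matrix.sum_apply]

end Decomposition

/-! ### Matrix-valued random variables and their entries -/

section Entries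

variable {Ω m n : Type*} [Fintype m] [Fintype n] [DecidableEq n]

theorem integral_matrix_congr {mΩ : MeasurableSpace Ω} {P : Measure Ω} {f g : Ω → Matrix m n ℂ}
    (hf : Integrable f P) (hg : Integrable g P)
    (h : ∀ a j, ∫ ω, f ω a j ∂P = ∫ ω, g ω a j ∂P) : ∫ ω, f ω ∂P = ∫ ω, g ω ∂P := by
  ext a j
  have := fun {e : Ω → Matrix m n ℂ} (he : Integrable e P) =>
    (LinearMap.toContinuousLinearMap (Matrix.entryLinearMap ℂ ℂ a j)).integral_comp_comm he
  simp only [LinearMap.coe_toContinuousLinearMap', Matrix.entryLinearMap_apply] at this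
  rw [← this hf, ← this hg, h]

variable [DecidableEq m]

theorem stronglyMeasurable_matrix {mΩ : MeasurableSpace Ω} {f : Ω → Matrix m n ℂ}
    (h : ∀ a j, Measurable fun ω => f ω a j) : StronglyMeasurable f := by
  have hf : f = fun ω => ∑ a, ∑ j, f ω a j • Matrix.single a j (1 : ℂ) := by
    ext1 ω
    conv_lhs => rw [Matrix.matrix_eq_sum_single (f ω)]
    simp
  rw [hf]
  exact Finset.stronglyMeasurable_fun_sum _ fun a _ => Finset.stronglyMeasurable_fun_sum _
    fun j _ => (h a j).stronglyMeasurable.smul_const _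

theorem stronglyMeasurable_mul_tsum {mΩ : MeasurableSpace Ω} {ι : Type*} [Countable ι]
    (B : Matrix m m ℂ) {f : ι → Ω → Matrix m n ℂ} (h : ∀ i a j, Measurable fun ω => f i ω a j) :
    StronglyMeasurable fun ω => B * ∑' i, f i ω := by
  have hc : Continuous fun C : Matrix m n ℂ => B * C := by fun_prop
  exact hc.comp_stronglyMeasurable
    (StronglyMeasurable.tsum fun i => stronglyMeasurable_matrix (h i))

theorem eLpNorm_matrix_le {mΩ : MeasurableSpace Ω} {P : Measure Ω} {r : ℝ≥0∞} (hr : 1 ≤ r)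
    {f : Ω → Matrix m n ℂ} (hf : ∀ a j, AEStronglyMeasurable (fun ω => f ω a j) P) :
    eLpNorm f r P ≤
      ∑ a, ∑ j, ‖Matrix.single a j (1 : ℂ)‖ₑ * eLpNorm (fun ω => f ω a j) r P := by
  have h : eLpNorm f r P ≤ eLpNorm
      (∑ x : m × n, fun ω => f ω x.1 x.2 • Matrix.single x.1 x.2 (1 : ℂ)) r P := by
    refine le_of_eq (congrArg (eLpNorm · r P) ?_)
    ext1 ω
    conv_lhs => rw [Matrix.matrix_eq_sum_single (f ω)]
    simp [Fintype.sum_prod_type]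
  refine h.trans ((eLpNorm_sum_le (fun x _ => (hf x.1 x.2).smul_const _) hr).trans ?_)
  rw [Fintype.sum_prod_type]
  refine Finset.sum_le_sum fun a _ => Finset.sum_le_sum fun j _ => ?_
  refine eLpNorm_le_mul_eLpNorm_of_ae_le_mul' (c := ‖Matrix.single a j (1 : ℂ)‖₊)
    (Eventually.of_forall fun ω => ?_) r
  rw [enorm_smul, mul_comm]
  rfl

end Entries

/-! ### The martingale property -/

section CountedMartingale

variable {Ω : Type*} {p k : ℕ} {τ₀ : Ω → Fin p} {ξ : Label → Ω → Fin p → Fin p → Measure ℝ≥0}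

theorem measurable_countedTerm {𝓜 : MeasurableSpace Ω} {u : Label}
    (h1 : Measurable[𝓜] (typeOf τ₀ ξ u)) (h2 : Measurable[𝓜] (birthTime τ₀ ξ u))
    (h3 : Measurable[𝓜] (ξ u)) (hp : ∀ ω i j, IsPointMeasure (ξ u ω i j)) (lam : ℂ)
    (A : Matrix (Fin k × Fin p) (Fin p) ℂ) (t : ℝ) (a : Fin k) (j : Fin p) :
    Measurable[𝓜] fun ω => countedTerm τ₀ ξ lam A t u ω a j := by
  classical
  have hS : Measurable fun ω => (birthTime τ₀ ξ u ω).toReal := h2.ennreal_toReal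
  have htail : ∀ (b c : Fin k) (i l : Fin p), Measurable fun ω =>
      tailIntegral k lam (ξ u ω) (t - (birthTime τ₀ ξ u ω).toReal) (b, i) (c, l) := by
    intro b c i l
    have hset : ∀ r : ℝ, MeasurableSet {s : ℝ≥0 | r < (s : ℝ)} := fun r =>
      measurableSet_lt measurable_const measurable_id.coe_nnreal_real
    simp only [tailIntegral, Matrix.of_apply, ← integral_indicator (hset _)]
    refine measurable_integral_pointMeasure
      ((measurable_pi_apply l).comp ((measurable_pi_apply i).comp h3)) (fun ω => hp ω i l) ?_
    have hr : Measurable fun x : Ω × ℝ≥0 => t - (birthTime τ₀ ξ u x.1).toReal :=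
      measurable_const.sub (hS.comp measurable_fst)
    have hs : Measurable fun x : Ω × ℝ≥0 => (x.2 : ℝ) := measurable_snd.coe_nnreal_real
    exact Measurable.ite (measurableSet_lt hr hs)
      ((measurable_expMatrix b c).comp (hr.sub hs)) measurable_const
  have heq : ∀ ω, countedTerm τ₀ ξ lam A t u ω a j =
      if birthTime τ₀ ξ u ω < ∞ ∧ 0 ≤ t - (birthTime τ₀ ξ u ω).toReal then
        ∑ i, if typeOf τ₀ ξ u ω = i then ∑ cl : Fin k × Fin p,
          tailIntegral k lam (ξ u ω) (t - (birthTime τ₀ ξ u ω).toReal) (a, i) cl * A cl j else 0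
      else 0 := by
    intro ω
    unfold countedTerm
    by_cases hb : birthTime τ₀ ξ u ω < ∞
    · by_cases ht : 0 ≤ t - (birthTime τ₀ ξ u ω).toReal
      · rw [if_pos hb, if_pos ht, if_pos ⟨hb, ht⟩, rowSelect_mul_apply, Matrix.mul_apply]
        simp
      · rw [if_pos hb, if_neg ht, if_neg fun h => ht h.2]
        simp
    · rw [if_neg hb, if_neg fun h => hb h.1]
      rfl
  simp only [heq]
  refine Measurable.ite ((measurableSet_lt h2 measurable_const).inter
    (measurableSet_le measurable_const (measurable_const.sub hS))) ?_ measurable_const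
  refine Finset.measurable_sum _ fun i _ => Measurable.ite (h1 (measurableSet_singleton i)) ?_
    measurable_const
  exact Finset.measurable_sum _ fun cl _ => (htail a cl.1 i cl.2).mul_const _

variable {lam : ℂ} {A : Matrix (Fin k × Fin p) (Fin p) ℂ} {q : ℝ}

theorem increment_Iic_eq_add {s t : ℝ≥0} (hst : s ≤ t) (a : Fin k) (j : Fin p) (u : Label)
    (ω : Ω) : increment τ₀ ξ lam A (Iic (t : ℝ≥0∞)) a j u ω =
      increment τ₀ ξ lam A (Iic (s : ℝ≥0∞)) a j u ω +
        increment τ₀ ξ lam A (Ioc (s : ℝ≥0∞) t) a j u ω := by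
  have hst' : (s : ℝ≥0∞) ≤ t := by exact_mod_cast hst
  by_cases h1 : birthTime τ₀ ξ u ω ≤ s
  · rw [increment_eq_sum (T := Iic (t : ℝ≥0∞)) (h1.trans hst'),
      increment_eq_sum (T := Iic (s : ℝ≥0∞)) h1,
      increment_eq_zero (T := Ioc (s : ℝ≥0∞) t) (fun h => absurd h1 (not_le.2 h.1)), add_zero]
  · rw [increment_eq_zero (T := Iic (s : ℝ≥0∞)) h1, zero_add]
    by_cases h2 : birthTime τ₀ ξ u ω ≤ t
    · rw [increment_eq_sum (T := Iic (t : ℝ≥0∞)) h2,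
        increment_eq_sum (T := Ioc (s : ℝ≥0∞) t) ⟨not_le.1 h1, h2⟩]
    · rw [increment_eq_zero (T := Iic (t : ℝ≥0∞)) h2,
        increment_eq_zero (T := Ioc (s : ℝ≥0∞) t) fun h => h2 h.2]

theorem summable_increment {T : Set ℝ≥0∞} {t : ℝ≥0} (hT : T ⊆ Iic (t : ℝ≥0∞)) {ω : Ω}
    (hfin : {u : Label | birthTime τ₀ ξ u ω ≤ t}.Finite) (a : Fin k) (j : Fin p) :
    Summable fun u => increment τ₀ ξ lam A T a j u ω :=
  summable_of_ne_finset_zero (s := hfin.toFinset) fun _ hu =>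
    increment_eq_zero (fun h => hu (hfin.mem_toFinset.2 (hT h))) a j

variable [mΩ : MeasurableSpace Ω] {P : Measure Ω}

namespace IsReproduction

/-- The contribution of `u` up to time `t` vanishes off `{S(u) ≤ t}`, hence is known at time `t`. -/
theorem measurable_timeSigma_countedTerm (hξ : IsReproduction P τ₀ ξ) (t : ℝ≥0) (u : Label)
    (a : Fin k) (j : Fin p) :
    Measurable[timeSigma τ₀ ξ t] fun ω => countedTerm τ₀ ξ lam A t u ω a j := by
  have hm := measurable_countedTerm (hξ.measurable_lineage u).1 (hξ.measurable_lineage u).2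
    (measurable_offspring_lineageSigma (List.suffix_refl u)) (hξ.isPointMeasure u) lam A t a j
  have hgen : ∀ B, MeasurableSet[lineageSigma τ₀ ξ u] B →
      MeasurableSet[timeSigma τ₀ ξ t] (B ∩ {ω | birthTime τ₀ ξ u ω ≤ t}) := fun B hB =>
    MeasurableSpace.measurableSet_generateFrom ⟨u, B, hB, rfl⟩
  have hE : MeasurableSet[timeSigma τ₀ ξ t] {ω | birthTime τ₀ ξ u ω ≤ t} := by
    simpa using hgen univ MeasurableSet.univ
  intro V hV
  have hsplit : (fun ω => countedTerm τ₀ ξ lam A t u ω a j) ⁻¹' V =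
      ((fun ω => countedTerm τ₀ ξ lam A t u ω a j) ⁻¹' V ∩ {ω | birthTime τ₀ ξ u ω ≤ t}) ∪
        ({ω | birthTime τ₀ ξ u ω ≤ t}ᶜ ∩ {_ω | (0 : ℂ) ∈ V}) := by
    ext ω
    by_cases hω : birthTime τ₀ ξ u ω ≤ t
    · simp [hω]
    · simp [hω, countedTerm_eq_zero hω]
  rw [hsplit]
  exact (hgen _ (hm hV)).union (MeasurableSet.inter hE.compl (MeasurableSet.const _))

theorem stronglyMeasurable_timeSigma (hξ : IsReproduction P τ₀ ξ) (t : ℝ≥0) :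
    StronglyMeasurable[timeSigma τ₀ ξ t] fun ω =>
      expMatrix k lam (-(t : ℝ)) * ∑' u, countedTerm τ₀ ξ lam A t u ω :=
  stronglyMeasurable_mul_tsum _ (hξ.measurable_timeSigma_countedTerm t)

end IsReproduction

namespace IsReproduction

theorem aestronglyMeasurable_countedTerm (hξ : IsReproduction P τ₀ ξ) (t : ℝ≥0) :
    AEStronglyMeasurable (fun ω =>
      expMatrix k lam (-(t : ℝ)) * ∑' u, countedTerm τ₀ ξ lam A t u ω) P :=
  ((hξ.stronglyMeasurable_timeSigma t).mono (hξ.timeSigma_le t)).aestronglyMeasurable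

variable [IsProbabilityMeasure P] {α δ : ℝ}

theorem ae_countedTerm_eq (hξ : IsReproduction P τ₀ ξ) (hα : IsMalthusian (intensity P ξ) α)
    (hlam : lam ∈ interior (laplaceDom (intensity P ξ))) (t : ℝ≥0) (a : Fin k) (j : Fin p) :
    ∀ᵐ ω ∂P, (expMatrix k lam (-(t : ℝ)) * ∑' u, countedTerm τ₀ ξ lam A t u ω) a j =
      A (a, τ₀ ω) j + ∑' u, increment τ₀ ξ lam A (Iic (t : ℝ≥0∞)) a j u ω := by
  filter_upwards [hξ.ae_finite_birthTime_le hα t, hξ.ae_integrable_weight (k := k) hlam]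
    with ω hfin hw
  exact expMatrix_mul_tsum_countedTerm (fun u => hξ.isPointMeasure u ω) hw hfin a j

theorem lintegral_enorm_totalInnovation_ne_top (hξ : IsReproduction P τ₀ ξ)
    (hlam : lam ∈ interior (laplaceDom (intensity P ξ))) (hq : 1 < q)
    (hA3 : ∫⁻ ω, ‖weightedMass k lam.re (ξ [] ω)‖ₑ ^ q ∂P < ∞) (j : Fin p) :
    ∫⁻ ω, ‖totalInnovation lam A j (ξ [] ω)‖ₑ ∂P ≠ ∞ :=
  ((hξ.memLp_totalInnovation hlam hq hA3 j).integrable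
    (by rw [ENNReal.one_le_ofReal]; exact hq.le)).2.ne

/-- The increments of individuals born in `(s, t]` vanish in mean on events known at time `s`. They
are summable in `L¹`, since a discount rate larger than `α` is available on `[0, t]`. -/
theorem setIntegral_tsum_increment_eq_zero (hξ : IsReproduction P τ₀ ξ)
    (hα : IsMalthusian (intensity P ξ) α)
    (hlam : lam ∈ interior (laplaceDom (intensity P ξ))) (hq1 : 1 < q)
    (hA3 : ∫⁻ ω, ‖weightedMass k lam.re (ξ [] ω)‖ₑ ^ q ∂P < ∞)
    (hA : ∀ b i j, ∑ c, ∑ l, (∫ s, expMatrix k lam (-((s : ℝ≥0) : ℝ)) b c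
      ∂(intensity P ξ i l)) * A (c, l) j = A (b, i) j) (hδ0 : 0 ≤ δ)
    (hδ : δ < lam.re) {s t : ℝ≥0} (a : Fin k) (j : Fin p) {B : Set Ω}
    (hB : MeasurableSet[timeSigma τ₀ ξ s] B) :
    ∫ ω in B, ∑' u, increment τ₀ ξ lam A (Ioc (s : ℝ≥0∞) t) a j u ω ∂P = 0 := by
  have hsum : ∑' u, ∫⁻ ω, ‖increment τ₀ ξ lam A (Ioc (s : ℝ≥0∞) t) a j u ω‖ₑ ∂P ≠ ∞ := by
    refine ne_top_of_le_ne_top ?_ (ENNReal.tsum_le_tsum fun u =>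
      hξ.lintegral_enorm_increment_le (β := max δ (α + 1)) hδ (le_max_left _ _)
        (Ioc_subset_Iic_self) a j u)
    rw [ENNReal.tsum_mul_left]
    refine ENNReal.mul_ne_top (ENNReal.mul_ne_top (by finiteness)
      (hξ.lintegral_enorm_totalInnovation_ne_top hlam hq1 hA3 j)) ?_
    exact (hξ.tsum_discount_lt_top hα (lt_max_of_lt_right (by linarith))).ne
  rw [integral_tsum]
  · simp [hξ.setIntegral_increment_eq_zero hlam hq1 hA3 hA hδ0 hδ a j _ hB]
  · exact fun u => (measurable_increment measurableSet_Ioc (hξ.measurable_typeOf u)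
      (hξ.measurable_birthTime u) (hξ.measurable_offspring u) a j).aestronglyMeasurable
  · exact ne_top_of_le_ne_top hsum (ENNReal.tsum_le_tsum fun u =>
      setLIntegral_le_lintegral _ _)

/-- By Fatou's lemma, the von Bahr–Esseen bound for finite sums passes to the limit. Since
`q δ > α`, the discounted birth times are summable, and the bound does not depend on `t`. -/
theorem exists_eLpNorm_entry_le (hξ : IsReproduction P τ₀ ξ)
    (hα : IsMalthusian (intensity P ξ) α)
    (hlam : lam ∈ interior (laplaceDom (intensity P ξ))) (hq1 : 1 < q) (hq2 : q ≤ 2)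
    (hA3 : ∫⁻ ω, ‖weightedMass k lam.re (ξ [] ω)‖ₑ ^ q ∂P < ∞)
    (hA : ∀ b i j, ∑ c, ∑ l, (∫ s, expMatrix k lam (-((s : ℝ≥0) : ℝ)) b c
      ∂(intensity P ξ i l)) * A (c, l) j = A (b, i) j) (hδ0 : 0 ≤ δ)
    (hδ : δ < lam.re) (hαδ : α < q * δ) (a : Fin k) (j : Fin p) :
    ∃ C : ℝ≥0, ∀ t : ℝ≥0, eLpNorm (fun ω =>
      (expMatrix k lam (-(t : ℝ)) * ∑' u, countedTerm τ₀ ξ lam A t u ω) a j)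
        (ENNReal.ofReal q) P ≤ C := by
  have hq0 : 0 < q := by linarith
  have hqne : ENNReal.ofReal q ≠ 0 := by simpa using hq0
  have hqtop : ENNReal.ofReal q ≠ ∞ := ENNReal.ofReal_ne_top
  have hqR : (ENNReal.ofReal q).toReal = q := ENNReal.toReal_ofReal hq0.le
  set K : ℝ≥0∞ := ENNReal.ofReal (expBound k lam δ) ^ q *
    ∫⁻ ω, ‖totalInnovation lam A j (ξ [] ω)‖ₑ ^ q ∂P with hK
  set D : ℝ≥0∞ := ∑' u, ∫⁻ ω, discount (q * δ) (birthTime τ₀ ξ u ω) ∂P with hD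
  have hKtop : K ≠ ∞ := by
    refine ENNReal.mul_ne_top (by finiteness) ?_
    have h := lintegral_rpow_enorm_lt_top_of_eLpNorm_lt_top hqne hqtop
      (hξ.memLp_totalInnovation (A := A) hlam hq1 hA3 j).2
    rw [hqR] at h
    exact h.ne
  have hDtop : D ≠ ∞ := (hξ.tsum_discount_lt_top hα hαδ).ne
  set M : ℝ≥0∞ := (ENNReal.ofReal (∫ ω, ‖A (a, τ₀ ω) j‖ ^ q ∂P) + 6 * (K * D)) ^ (1 / q) with hM
  have hMtop : M ≠ ∞ := by
    refine ENNReal.rpow_ne_top_of_nonneg (by positivity) (ENNReal.add_ne_top.2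
      ⟨ENNReal.ofReal_ne_top, ENNReal.mul_ne_top (by finiteness) (ENNReal.mul_ne_top hKtop hDtop)⟩)
  refine ⟨M.toNNReal, fun t => ?_⟩
  rw [ENNReal.coe_toNNReal hMtop]
  obtain ⟨F, hF⟩ := exists_seq_tendsto (atTop : Filter (Finset Label))
  have hfinite := fun n => hξ.integral_norm_sum_increment_rpow_le hlam hq1 hq2 hA3 hA hδ0 hδ
    (measurableSet_Iic (a := (t : ℝ≥0∞))) a j (fun i => A (a, i) j) (F n)
  have hlim := Lp.eLpNorm_lim_le_liminf_eLpNorm (p := ENNReal.ofReal q)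
    (fun n => (hfinite n).1.1) (fun ω =>
      (expMatrix k lam (-(t : ℝ)) * ∑' u, countedTerm τ₀ ξ lam A t u ω) a j) ?_
  · refine hlim.trans (liminf_le_of_le (by isBoundedDefault) fun b hb => ?_)
    obtain ⟨n, hn⟩ := hb.exists
    refine hn.trans ?_
    rw [eLpNorm_eq_lintegral_rpow_enorm_toReal hqne hqtop, hqR, hM]
    refine ENNReal.rpow_le_rpow ?_ (by positivity)
    have hof : ∀ {f : Ω → ℂ}, MemLp f (ENNReal.ofReal q) P →
        ENNReal.ofReal (∫ ω, ‖f ω‖ ^ q ∂P) = ∫⁻ ω, ‖f ω‖ₑ ^ q ∂P := by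
      intro f hf
      have hi := hf.integrable_norm_rpow hqne hqtop
      rw [hqR] at hi
      rw [ofReal_integral_eq_lintegral_ofReal hi (Eventually.of_forall fun ω => by positivity)]
      refine lintegral_congr fun ω => ?_
      rw [← ENNReal.ofReal_rpow_of_nonneg (norm_nonneg _) hq0.le, ofReal_norm]
    rw [← hof (hfinite n).1]
    refine (ENNReal.ofReal_le_ofReal (hfinite n).2).trans ?_
    rw [ENNReal.ofReal_add (by positivity) (by positivity), ENNReal.ofReal_mul (by norm_num),
      ENNReal.ofReal_sum_of_nonneg fun u _ => by positivity]
    gcongr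
    · simp
    calc ∑ u ∈ F n, ENNReal.ofReal (∫ ω, ‖increment τ₀ ξ lam A (Iic (t : ℝ≥0∞)) a j u ω‖ ^ q ∂P)
        ≤ ∑ u ∈ F n, K * ∫⁻ ω, discount (q * δ) (birthTime τ₀ ξ u ω) ∂P := by
          refine Finset.sum_le_sum fun u _ => ?_
          rw [hof (hξ.memLp_increment hlam hq1 hA3 hδ0 hδ measurableSet_Iic a j u)]
          exact hξ.lintegral_enorm_increment_rpow_le hδ hq0 (by simp) a j u
      _ ≤ K * D := by
          rw [← Finset.mul_sum]
          gcongr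
          exact ENNReal.sum_le_tsum _
  · filter_upwards [hξ.ae_countedTerm_eq (A := A) hα hlam t a j, hξ.ae_finite_birthTime_le hα t]
      with ω hω hfin
    rw [hω]
    exact ((summable_increment subset_rfl hfin a j).hasSum.comp hF).const_add _

theorem exists_eLpNorm_le (hξ : IsReproduction P τ₀ ξ)
    (hα : IsMalthusian (intensity P ξ) α)
    (hlam : lam ∈ interior (laplaceDom (intensity P ξ))) (hq1 : 1 < q) (hq2 : q ≤ 2)
    (hA3 : ∫⁻ ω, ‖weightedMass k lam.re (ξ [] ω)‖ₑ ^ q ∂P < ∞)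
    (hA : ∀ b i j, ∑ c, ∑ l, (∫ s, expMatrix k lam (-((s : ℝ≥0) : ℝ)) b c
      ∂(intensity P ξ i l)) * A (c, l) j = A (b, i) j) (hδ0 : 0 ≤ δ)
    (hδ : δ < lam.re) (hαδ : α < q * δ) :
    ∃ C : ℝ≥0, ∀ t : ℝ≥0, eLpNorm (fun ω =>
      expMatrix k lam (-(t : ℝ)) * ∑' u, countedTerm τ₀ ξ lam A t u ω)
        (ENNReal.ofReal q) P ≤ C := by
  choose C hC using
    hξ.exists_eLpNorm_entry_le hα hlam hq1 hq2 hA3 hA hδ0 hδ hαδ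
  refine ⟨∑ a, ∑ j, ‖Matrix.single a j (1 : ℂ)‖₊ * C a j, fun t => ?_⟩
  refine (eLpNorm_matrix_le (ENNReal.one_le_ofReal.2 hq1.le) fun a j => ?_).trans ?_
  · exact (LinearMap.toContinuousLinearMap
      (Matrix.entryLinearMap ℂ ℂ a j)).continuous.comp_aestronglyMeasurable
        (hξ.aestronglyMeasurable_countedTerm t)
  · push_cast
    refine Finset.sum_le_sum fun a _ => Finset.sum_le_sum fun j _ => ?_
    exact mul_le_mul' le_rfl (hC a j t)

/-- The martingale property, checked entry by entry on events known at time `s`. -/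
theorem condExp_countedTerm (hξ : IsReproduction P τ₀ ξ)
    (hα : IsMalthusian (intensity P ξ) α)
    (hlam : lam ∈ interior (laplaceDom (intensity P ξ))) (hq1 : 1 < q)
    (hA3 : ∫⁻ ω, ‖weightedMass k lam.re (ξ [] ω)‖ₑ ^ q ∂P < ∞)
    (hA : ∀ b i j, ∑ c, ∑ l, (∫ s, expMatrix k lam (-((s : ℝ≥0) : ℝ)) b c
      ∂(intensity P ξ i l)) * A (c, l) j = A (b, i) j) (hδ0 : 0 ≤ δ)
    (hδ : δ < lam.re)
    (hint : ∀ t : ℝ≥0, Integrable (fun ω =>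
      expMatrix k lam (-(t : ℝ)) * ∑' u, countedTerm τ₀ ξ lam A t u ω) P)
    {s t : ℝ≥0} (hst : s ≤ t) :
    P[fun ω => expMatrix k lam (-(t : ℝ)) * ∑' u, countedTerm τ₀ ξ lam A t u ω |
      timeSigma τ₀ ξ s] =ᵐ[P]
      fun ω => expMatrix k lam (-(s : ℝ)) * ∑' u, countedTerm τ₀ ξ lam A s u ω := by
  refine (ae_eq_condExp_of_forall_setIntegral_eq (hξ.timeSigma_le s) (hint t)
    (fun _ _ _ => (hint s).integrableOn) (fun B hB _ => ?_)
    (hξ.stronglyMeasurable_timeSigma s).aestronglyMeasurable).symm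
  refine integral_matrix_congr (hint s).integrableOn (hint t).integrableOn fun a j => ?_
  have hentry : ∀ r : ℝ≥0, Integrable (fun ω =>
      (expMatrix k lam (-(r : ℝ)) * ∑' u, countedTerm τ₀ ξ lam A r u ω) a j) P := fun r =>
    (LinearMap.toContinuousLinearMap (Matrix.entryLinearMap ℂ ℂ a j)).integrable_comp (hint r)
  rw [← sub_eq_zero, ← integral_sub (hentry s).integrableOn (hentry t).integrableOn,
    ← neg_eq_zero, ← integral_neg]
  refine Eq.trans (setIntegral_congr_ae (hξ.timeSigma_le s B hB) ?_)
    (hξ.setIntegral_tsum_increment_eq_zero (t := t) hα hlam hq1 hA3 hA hδ0 hδ a j hB)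
  filter_upwards [hξ.ae_countedTerm_eq (A := A) hα hlam s a j,
    hξ.ae_countedTerm_eq (A := A) hα hlam t a j, hξ.ae_finite_birthTime_le hα t]
    with ω hs ht hfin _
  have hst' : (s : ℝ≥0∞) ≤ t := by exact_mod_cast hst
  rw [hs, ht]
  simp only [increment_Iic_eq_add hst]
  rw [(summable_increment (Iic_subset_Iic.2 hst') hfin a j).tsum_add
    (summable_increment Ioc_subset_Iic_self hfin a j)]
  ring

end IsReproduction

end CountedMartingale

end CMJ

end

theorem theorem2p3 {Ω : Type*} [mΩ : MeasurableSpace Ω] (P : Measure Ω) [IsProbabilityMeasure P]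
    {p : ℕ} (τ₀ : Ω → Fin p) (ξ : CMJ.Label → Ω → Fin p → Fin p → Measure ℝ≥0)
    (hξ : CMJ.IsReproduction P τ₀ ξ)
    (hA1 : spectralRadius ℂ (CMJ.instantMean (CMJ.intensity P ξ)) < 1)
    (α : ℝ) (hA2 : CMJ.IsMalthusian (CMJ.intensity P ξ) α)
    (lam : ℂ) (hlam : lam ∈ interior (CMJ.laplaceDom (CMJ.intensity P ξ)))
    (hroot : (1 - CMJ.laplace (CMJ.intensity P ξ) lam).det = 0)
    (q : ℝ) (hq1 : 1 < q) (hq2 : q ≤ 2)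
    (hA3 : ∫⁻ ω, ‖CMJ.weightedMass (CMJ.poleOrder (CMJ.intensity P ξ) lam) lam.re
      (ξ [] ω)‖ₑ ^ q ∂P < ∞)
    (hre : α / q < lam.re) :
    ∃ ℱ : Filtration ℝ≥0 mΩ,
      (∀ t, ℱ t = CMJ.timeSigma τ₀ ξ t) ∧
      (∀ t : ℝ≥0, ∀ᵐ ω ∂P, {u : CMJ.Label | CMJ.birthTime τ₀ ξ u ω ≤ t}.Finite) ∧
      Martingale (CMJ.nerman P τ₀ ξ lam) ℱ P ∧
      ∃ C : ℝ≥0, ∀ t : ℝ≥0, eLpNorm (CMJ.nerman P τ₀ ξ lam t) (ENNReal.ofReal q) P ≤ C := by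
  have hq0 : 0 < q := by linarith
  have hα0 : 0 < α / q := div_pos hA2.1.1 hq0
  -- `δ < Re lam` absorbs the polynomial factors of `exp(lam, -x)`, and `q δ > α` makes the `q`-th
  -- powers of the discount factors summable over all individuals.
  set δ : ℝ := (α / q + lam.re) / 2 with hδ
  have hδ0 : 0 ≤ δ := by linarith
  have hδlam : δ < lam.re := by linarith
  have hαδ : α < q * δ := by
    have h : α / q < δ := by linarith
    rwa [div_lt_iff₀' hq0] at h
  have hA := CMJ.sum_integral_expMatrix_mul_coeffStack hlam
  obtain ⟨C, hC⟩ := hξ.exists_eLpNorm_le hA2 hlam hq1 hq2 hA3 hA hδ0 hδlam hαδ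
  have hint := fun t : ℝ≥0 =>
    MemLp.integrable (ENNReal.one_le_ofReal.2 hq1.le)
      ⟨hξ.aestronglyMeasurable_countedTerm (lam := lam)
        (A := CMJ.coeffStack (CMJ.intensity P ξ) lam) t, (hC t).trans_lt ENNReal.coe_lt_top⟩
  refine ⟨⟨CMJ.timeSigma τ₀ ξ, fun s t hst => hξ.timeSigma_mono hst, hξ.timeSigma_le⟩,
    fun t => rfl, hξ.ae_finite_birthTime_le hA2, ⟨hξ.stronglyMeasurable_timeSigma,
      fun s t hst => hξ.condExp_countedTerm hA2 hlam hq1 hA3 hA hδ0 hδlam hint hst⟩, C, hC⟩
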